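/- Let $q\in L_2(0,\pi)$ be real valued, let $h,H\in\mathbb R$, and put $\omega=h+H+\frac12\int_0^\pi q(t)\,dt$. Solutions of second order equations on $[0,\pi]$ are $C^1$ functions with absolutely continuous derivative that satisfy the equation almost everywhere. For $\rho\in\mathbb C$ with $\rho^2\in\mathbb R$ let $c(\rho,\cdot)$ be the solution of $-y''+q(x)y=\rho^2y$ on $[0,\pi]$ with $y(0)=1$, $y'(0)=h$. Let $\lambda_0<\lambda_1<\lambda_2<\dots$ be all the eigenvalues of the problem $$-y''+q(x)y=\lambda y,\qquad y'(0)-hy(0)=y'(\pi)+Hy(\pi)=0,$$ and put $\rho_n=\sqrt{\lambda_n}$ (purely imaginary if $\lambda_n<0$), $\alpha_n=\int_0^\pi c(\rho_n,x)^2\,dx$, and $\alpha_n^0=\pi/2$ for $n\ge1$, $\alpha_0^0=\pi$. Let $G(x,t)$, continuous on $0\le t\le x\le\pi$, be the kernel of the transmutation operator $T[u](x)=u(x)+\int_0^xG(x,s)u(s)\,ds$, that is: for every $u\in C^2[0,\pi]$ with $u'(0)=0$ the function $v=T[u]$ satisfies $v''-qv=T[u'']$ and $v'(0)=hv(0)$.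 Let the kernel $H(x,t)$ (not to be confused with the number $H$), continuous on $0\le t\le x\le\pi$, be that of the inverse operator, $T^{-1}[u](x)=u(x)+\int_0^xH(x,s)u(s)\,ds$ for $u\in C[0,\pi]$. All these objects exist, $\alpha_n>0$ for all $n$, and for all $0\le t\le x\le\pi$ (including $x=t=\pi$) $$\begin{aligned}G(x,t)=&\sum_{n=1}^\infty\Bigl(\frac{c(n,x)\cos nt}{\alpha_n^0}-\frac{c(\rho_n,x)\cos\rho_nt}{\alpha_n}-\frac{2\omega}{\pi^2n}\bigl(x\sin nx\cos nt+t\sin nt\cos nx\bigr)\Bigr)\\&+\frac{c(0,x)}{\pi}-\frac{c(\rho_0,x)\cos\rho_0t}{\alpha_0}+\frac{\omega}{\pi^2}\bigl(\pi x-x^2-t^2\bigr)\end{aligned}$$ and $$\begin{aligned}H(x,t)=&\sum_{n=1}^\infty\Bigl(\frac{\cos\rho_nx\,c(\rho_n,t)}{\alpha_n}-\frac{\cos nx\,c(n,t)}{\alpha_n^0}+\frac{2\omega}{\pi^2n}\bigl(x\sin nx\cos nt+t\sin nt\cos nx\bigr)\Bigr)\\&+\frac{\cos\rho_0x\,c(\rho_0,t)}{\alpha_0}-\frac{c(0,t)}{\pi}-\frac{\omega}{\pi^2}\bigl(\pi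 x-x^2-t^2\bigr).\end{aligned}$$ Both series, as well as the series of the absolute values of their terms, converge uniformly on $0\le t\le x\le\pi$. -/

import Mathlib

open Set MeasureTheory Filter
open scoped Real

noncomputable section

namespace SturmLiouville

/-- `v` is `C¹` on `[0, π]` with derivative `v₁`, `v₁` is absolutely continuous on `[0, π]`, and
`v'' = g` almost everywhere on `(0, π)`. -/
structure HasSecondDeriv (v v₁ g : ℝ → ℝ) : Prop where
  hasDeriv : ∀ x ∈ Icc 0 π, HasDerivWithinAt v (v₁ x) (Icc 0 π) x
  absCont : AbsolutelyContinuousOnInterval v₁ 0 π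
  deriv_ae : ∀ᵐ x, x ∈ Ioo 0 π → HasDerivAt v₁ (g x) x

/-- `y`, with derivative `y₁`, solves `-y'' + q y = μ y` on `[0, π]`. -/
def IsSolution (q : ℝ → ℝ) (μ : ℝ) (y y₁ : ℝ → ℝ) : Prop :=
  HasSecondDeriv y y₁ (fun x => q x * y x - μ * y x)

/-- For every real `μ`, `c μ` is the solution of `-y'' + q y = μ y`, `y(0) = 1`, `y'(0) = h`.
The solution only depends on the spectral parameter `ρ` through `μ = ρ²`: it is `c(ρ, x)`. -/
def IsCauchyFamily (q : ℝ → ℝ) (h : ℝ) (c : ℝ → ℝ → ℝ) : Prop :=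
  ∀ μ : ℝ, ∃ y₁ : ℝ → ℝ, IsSolution q μ (c μ) y₁ ∧ c μ 0 = 1 ∧ y₁ 0 = h

/-- `μ` is an eigenvalue of `-y'' + q y = μ y`, `y'(0) - h y(0) = 0`, `y'(π) + H y(π) = 0`. -/
def IsEigenvalue (q : ℝ → ℝ) (h H μ : ℝ) : Prop :=
  ∃ y y₁ : ℝ → ℝ, IsSolution q μ y y₁ ∧
    y₁ 0 - h * y 0 = 0 ∧ y₁ π + H * y π = 0 ∧ ∃ x ∈ Icc 0 π, y x ≠ 0

/-- `lam 0 < lam 1 < lam 2 < ...` is the sequence of all the eigenvalues. -/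
def IsEigenvalueSequence (q : ℝ → ℝ) (h H : ℝ) (lam : ℕ → ℝ) : Prop :=
  StrictMono lam ∧ ∀ μ : ℝ, (∃ n, lam n = μ) ↔ IsEigenvalue q h H μ

/-- `0 ≤ t ≤ x ≤ π`, a point being written `(x, t)`. -/
def triangle : Set (ℝ × ℝ) := {p | 0 ≤ p.2 ∧ p.2 ≤ p.1 ∧ p.1 ≤ π}

/-- The Volterra operator `u ↦ u(x) + ∫₀ˣ A(x, s) u(s) ds`. -/
def volterra (A : ℝ → ℝ → ℝ) (u : ℝ → ℝ) (x : ℝ) : ℝ :=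
  u x + ∫ s in (0 : ℝ)..x, A x s * u s

/-- `G` is continuous on the triangle, and `T = volterra G` transmutes `B = d²/dx²` into
`L = d²/dx² - q`: if `u ∈ C²[0, π]` and `u'(0) = 0` then `v = T u` satisfies `L v = T (B u)`
and `v'(0) = h v(0)`. Here `u₁`, `u₂` are the first two derivatives of `u`. -/
def IsTransmutationKernel (q : ℝ → ℝ) (h : ℝ) (G : ℝ → ℝ → ℝ) : Prop :=
  ContinuousOn (fun p : ℝ × ℝ => G p.1 p.2) triangle ∧
  ∀ u u₁ u₂ : ℝ → ℝ,
    (∀ x ∈ Icc 0 π, HasDerivWithinAt u (u₁ x) (Icc 0 π) x) →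
    (∀ x ∈ Icc 0 π, HasDerivWithinAt u₁ (u₂ x) (Icc 0 π) x) →
    ContinuousOn u₂ (Icc 0 π) → u₁ 0 = 0 →
    ∃ v₁ : ℝ → ℝ,
      HasSecondDeriv (volterra G u) v₁ (fun x => q x * volterra G u x + volterra G u₂ x) ∧
      v₁ 0 = h * volterra G u 0

/-- `K` is continuous on the triangle and `volterra K` is the inverse of `volterra G`
on `C[0, π]`. -/
def IsInverseKernel (G K : ℝ → ℝ → ℝ) : Prop :=
  ContinuousOn (fun p : ℝ × ℝ => K p.1 p.2) triangle ∧
  ∀ u : ℝ → ℝ, ContinuousOn u (Icc 0 π) → ∀ x ∈ Icc 0 π,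
    volterra K (volterra G u) x = u x ∧ volterra G (volterra K u) x = u x

/-- `ω = h + H + ½ ∫₀^π q`. -/
def omega (q : ℝ → ℝ) (h H : ℝ) : ℝ := h + H + (1 / 2) * ∫ t in (0 : ℝ)..π, q t

/-- The weight numbers `αₙ = ∫₀^π c(ρₙ, x)² dx`. -/
def weight (c : ℝ → ℝ → ℝ) (lam : ℕ → ℝ) (n : ℕ) : ℝ := ∫ x in (0 : ℝ)..π, c (lam n) x ^ 2

/-- The weight numbers `αₙ⁰` of `q = 0`, `h = H = 0`. -/
def weight₀ (n : ℕ) : ℝ := if n = 0 then π else π / 2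

/-- `cos (ρ x)` with `ρ = √μ`. It is real also for `μ < 0`, where `ρ` is imaginary. -/
def cosRoot (μ x : ℝ) : ℝ := (Complex.cos ((μ : ℂ) ^ (1 / 2 : ℂ) * (x : ℂ))).re

/-- `(2ω / (π² n)) (x sin nx cos nt + t sin nt cos nx)`. -/
def correction (ω : ℝ) (n : ℕ) (x t : ℝ) : ℝ :=
  2 * ω / (π ^ 2 * n) *
    (x * Real.sin (n * x) * Real.cos (n * t) + t * Real.sin (n * t) * Real.cos (n * x))

/-- The `n`-th term, `n ≥ 1`, of the corrected series for the kernel `G(x, t)`. -/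
def termG (c : ℝ → ℝ → ℝ) (lam : ℕ → ℝ) (ω : ℝ) (n : ℕ) (x t : ℝ) : ℝ :=
  c ((n : ℝ) ^ 2) x * Real.cos (n * t) / weight₀ n
    - c (lam n) x * cosRoot (lam n) t / weight c lam n
    - correction ω n x t

/-- The closed-form part of the representation of `G(x, t)`. -/
def closedG (c : ℝ → ℝ → ℝ) (lam : ℕ → ℝ) (ω : ℝ) (x t : ℝ) : ℝ :=
  c 0 x / π - c (lam 0) x * cosRoot (lam 0) t / weight c lam 0
    + ω / π ^ 2 * (π * x - x ^ 2 - t ^ 2)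

/-- The `n`-th term, `n ≥ 1`, of the corrected series for the inverse kernel `H(x, t)`. -/
def termH (c : ℝ → ℝ → ℝ) (lam : ℕ → ℝ) (ω : ℝ) (n : ℕ) (x t : ℝ) : ℝ :=
  cosRoot (lam n) x * c (lam n) t / weight c lam n
    - Real.cos (n * x) * c ((n : ℝ) ^ 2) t / weight₀ n
    + correction ω n x t

/-- The closed-form part of the representation of `H(x, t)`. -/
def closedH (c : ℝ → ℝ → ℝ) (lam : ℕ → ℝ) (ω : ℝ) (x t : ℝ) : ℝ :=
  cosRoot (lam 0) x * c (lam 0) t / weight c lam 0 - c 0 t / π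
    - ω / π ^ 2 * (π * x - x ^ 2 - t ^ 2)

/-- On `S`, the series `∑_{n ≥ 1} f n` converges absolutely and uniformly, and so does the series
of absolute values. -/
def ConvergesAbsolutelyUniformlyOn (f : ℕ → ℝ → ℝ → ℝ) (S : Set (ℝ × ℝ)) : Prop :=
  (∀ p ∈ S, Summable fun n : ℕ => |f (n + 1) p.1 p.2|) ∧
  TendstoUniformlyOn (fun (N : ℕ) (p : ℝ × ℝ) => ∑ n ∈ Finset.Icc 1 N, |f n p.1 p.2|)
    (fun p => ∑' n : ℕ, |f (n + 1) p.1 p.2|) atTop S ∧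
  TendstoUniformlyOn (fun (N : ℕ) (p : ℝ × ℝ) => ∑ n ∈ Finset.Icc 1 N, f n p.1 p.2)
    (fun p => ∑' n : ℕ, f (n + 1) p.1 p.2) atTop S

end SturmLiouville

end

noncomputable section

namespace SturmLiouville

/-! Write `T = I + G` and `T⁻¹ = I + K`. Since `T` carries `u''` to `v'' - q v`, uniqueness for the
Cauchy problem gives `c(ρ, ·) = T cos(ρ ·)`, hence also `cos(ρₙ ·) = T⁻¹ c(ρₙ, ·)`. Test the series
against a product `g(x) f(t)`. Parseval for the cosines sums `c(n, x) cos nt / αₙ⁰` to `⟨T f, g⟩`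
(`hasSum_cos_kernel`), and Parseval for the eigenfunctions sums `c(ρₙ, x) cos ρₙt / αₙ` to `⟨f, T⁻¹
g⟩` (`hasSum_eigen_kernel`). The two copies of `⟨f, g⟩` cancel. What remains is the kernel that
equals `G(x, t)` for `t < x` and `-K(t, x)` for `x < t`. Both representations are therefore halves
of one identity on the square, and the series for the inverse kernel is minus the series for `G`
with the variables exchanged.

The corrections make the convergence good enough to pass from this weak identity to a pointwise one.
Since `ρₙ - n` is close to `ω / (πn)` and `αₙ` to `π / 2`, the first-order part of the `n`-th
difference is exactly `correction`. By the cosine expansion of `x · 1_{t < x}` (`hasSum_sin_cos`)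
the corrections have the weak sum `(ω / π²)(π max(x, t) - x² - t²)`, which explains the closed-form
part. What is left of each term is at most `aₙ(x) / n` with `∑ aₙ(x)²` bounded uniformly in `x`
(`exists_termG_dominated`), by Bessel's inequality for `q` and for the sections of `G`.
Cauchy–Schwarz then gives absolute uniform convergence on the whole closed square. The sum is
continuous, test functions supported on one side of the diagonal identify it with `G` or `-K` in the
open triangle (`kernel_eq_tsum`, `inverseKernel_eq_tsum`), and continuity reaches the diagonal and
the corner `(π, π)`.

Three ingredients carry this. The transmutation kernel is obtained from a Goursat problem
(`exists_isTransmutationKernel`) and its inverse from a resolvent equation. Square roots of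
eigenvalues are located near large integers by the intermediate value theorem and refined to `ρₙ = n
+ ω / (πn) + κₙ / n` with square summable `κₙ` (`exists_root_near_nat`, `exists_root_asymptotics`).
Completeness of the eigenfunctions, and the fact that the root near `n` is the one with index `n`,
come from comparing the eigenfunctions with the cosine basis (`exists_spectralTail`). -/

/-! ### Absolutely continuous derivatives and uniqueness for the Cauchy problem -/

lemma intervalIntegrable_of_memLp_two {q : ℝ → ℝ}
    (hq : MemLp q 2 (volume.restrict (Ioo 0 π))) : IntervalIntegrable q volume 0 π := by
  rw [intervalIntegrable_iff_integrableOn_Ioo_of_le Real.pi_pos.le]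
  exact hq.integrable (by norm_num)

/-- Fundamental theorem of calculus for absolutely continuous functions. -/
lemma integral_eq_sub_of_absCont {F f : ℝ → ℝ} {a b : ℝ} (hab : a ≤ b)
    (hF : AbsolutelyContinuousOnInterval F a b)
    (hd : ∀ᵐ x, x ∈ Ioo a b → HasDerivAt F (f x) x) :
    IntervalIntegrable f volume a b ∧ ∫ x in a..b, f x = F b - F a := by
  have hb : ∀ᵐ x : ℝ, x ≠ b := by simp [ae_iff, measure_singleton]
  have key : ∀ᵐ x, x ∈ uIoc a b → deriv F x = f x := by
    filter_upwards [hd, hb] with x hx hxb hm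
    rw [uIoc_of_le hab] at hm
    exact (hx ⟨hm.1, lt_of_le_of_ne hm.2 hxb⟩).deriv
  refine ⟨hF.intervalIntegrable_deriv.congr_ae ?_, ?_⟩
  · rw [EventuallyEq, ae_restrict_iff' measurableSet_uIoc]
    exact key
  · rw [← hF.integral_deriv_eq_sub]
    refine (intervalIntegral.integral_congr_ae key).symm

lemma absCont_of_hasDerivWithinAt {w w₁ : ℝ → ℝ} {a b : ℝ} (hab : a ≤ b)
    (hw : ∀ x ∈ Icc a b, HasDerivWithinAt w (w₁ x) (Icc a b) x)
    (hw₁ : ContinuousOn w₁ (Icc a b)) : AbsolutelyContinuousOnInterval w a b := by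
  obtain ⟨C, hC⟩ := isCompact_Icc.exists_bound_of_continuousOn hw₁
  apply LipschitzOnWith.absolutelyContinuousOnInterval (K := C.toNNReal)
  rw [uIcc_of_le hab]
  refine Convex.lipschitzOnWith_of_nnnorm_hasDerivWithin_le (convex_Icc a b) hw ?_
  intro x hx
  rw [← NNReal.coe_le_coe]
  exact (hC x hx).trans (Real.le_coe_toNNReal C)

namespace HasSecondDeriv

variable {v v₁ g w w₁ k : ℝ → ℝ}

lemma continuousOn_deriv (hv : HasSecondDeriv v v₁ g) : ContinuousOn v₁ (Icc 0 π) := by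
  have := hv.absCont.continuousOn
  rwa [uIcc_of_le Real.pi_pos.le] at this

lemma continuousOn (hv : HasSecondDeriv v v₁ g) : ContinuousOn v (Icc 0 π) :=
  fun x hx => (hv.hasDeriv x hx).continuousWithinAt

lemma absCont_left (hv : HasSecondDeriv v v₁ g) : AbsolutelyContinuousOnInterval v 0 π :=
  absCont_of_hasDerivWithinAt Real.pi_pos.le hv.hasDeriv hv.continuousOn_deriv

lemma hasDerivAt (hv : HasSecondDeriv v v₁ g) {x : ℝ} (hx : x ∈ Ioo 0 π) :
    HasDerivAt v (v₁ x) x :=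
  (hv.hasDeriv x (Ioo_subset_Icc_self hx)).hasDerivAt (Icc_mem_nhds hx.1 hx.2)

lemma integral_eq_sub (hv : HasSecondDeriv v v₁ g) {x : ℝ} (hx : x ∈ Icc 0 π) :
    ∫ s in (0 : ℝ)..x, g s = v₁ x - v₁ 0 := by
  refine (integral_eq_sub_of_absCont hx.1 (hv.absCont.mono ?_) ?_).2
  · rw [uIcc_of_le hx.1, uIcc_of_le Real.pi_pos.le]
    exact Icc_subset_Icc_right hx.2
  · filter_upwards [hv.deriv_ae] with s hs hm
    exact hs ⟨hm.1, hm.2.trans_le hx.2⟩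

lemma integral_deriv_eq_sub (hv : HasSecondDeriv v v₁ g) {x : ℝ} (hx : x ∈ Icc 0 π) :
    ∫ s in (0 : ℝ)..x, v₁ s = v x - v 0 := by
  refine (integral_eq_sub_of_absCont hx.1 (hv.absCont_left.mono ?_) ?_).2
  · rw [uIcc_of_le hx.1, uIcc_of_le Real.pi_pos.le]
    exact Icc_subset_Icc_right hx.2
  · refine Eventually.of_forall fun s hm => ?_
    exact hv.hasDerivAt ⟨hm.1, hm.2.trans_le hx.2⟩

lemma sub (hv : HasSecondDeriv v v₁ g) (hw : HasSecondDeriv w w₁ k) :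
    HasSecondDeriv (fun x => v x - w x) (fun x => v₁ x - w₁ x) (fun x => g x - k x) where
  hasDeriv x hx := (hv.hasDeriv x hx).sub (hw.hasDeriv x hx)
  absCont := hv.absCont.fun_sub hw.absCont
  deriv_ae := by
    filter_upwards [hv.deriv_ae, hw.deriv_ae] with x h1 h2 hx
    exact (h1 hx).sub (h2 hx)

lemma add (hv : HasSecondDeriv v v₁ g) (hw : HasSecondDeriv w w₁ k) :
    HasSecondDeriv (fun x => v x + w x) (fun x => v₁ x + w₁ x) (fun x => g x + k x) where
  hasDeriv x hx := (hv.hasDeriv x hx).add (hw.hasDeriv x hx)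
  absCont := hv.absCont.fun_add hw.absCont
  deriv_ae := by
    filter_upwards [hv.deriv_ae, hw.deriv_ae] with x h1 h2 hx
    exact (h1 hx).add (h2 hx)

lemma const_mul (hv : HasSecondDeriv v v₁ g) (a : ℝ) :
    HasSecondDeriv (fun x => a * v x) (fun x => a * v₁ x) (fun x => a * g x) where
  hasDeriv x hx := (hv.hasDeriv x hx).const_mul a
  absCont := hv.absCont.const_mul a
  deriv_ae := by
    filter_upwards [hv.deriv_ae] with x h1 hx
    exact (h1 hx).const_mul a

lemma congr_ae (hv : HasSecondDeriv v v₁ g) (h : ∀ᵐ x, x ∈ Ioo 0 π → g x = k x) :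
    HasSecondDeriv v v₁ k where
  hasDeriv := hv.hasDeriv
  absCont := hv.absCont
  deriv_ae := by
    filter_upwards [hv.deriv_ae, h] with x h1 h2 hx
    exact h2 hx ▸ h1 hx

/-- Green's identity. -/
lemma green (hv : HasSecondDeriv v v₁ g) (hw : HasSecondDeriv w w₁ k) {x : ℝ}
    (hx : x ∈ Icc 0 π) :
    ∫ s in (0 : ℝ)..x, (g s * w s - v s * k s)
      = (v₁ x * w x - v x * w₁ x) - (v₁ 0 * w 0 - v 0 * w₁ 0) := by
  have hsub : uIcc 0 x ⊆ uIcc 0 π := by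
    rw [uIcc_of_le hx.1, uIcc_of_le Real.pi_pos.le]
    exact Icc_subset_Icc_right hx.2
  refine (integral_eq_sub_of_absCont (F := fun s => v₁ s * w s - v s * w₁ s) hx.1
    (((hv.absCont.fun_mul hw.absCont_left).fun_sub
      (hv.absCont_left.fun_mul hw.absCont)).mono hsub) ?_).2
  filter_upwards [hv.deriv_ae, hw.deriv_ae] with s h1 h2 hm
  have hs : s ∈ Ioo 0 π := ⟨hm.1, hm.2.trans_le hx.2⟩
  convert! ((h1 hs).mul (hw.hasDerivAt hs)).sub ((hv.hasDerivAt hs).mul (h2 hs)) using 1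
  ring

end HasSecondDeriv

lemma intervalIntegrable_mono_Icc {g : ℝ → ℝ} (hg : IntervalIntegrable g volume 0 π) {x y : ℝ}
    (hx : x ∈ Icc 0 π) (hy : y ∈ Icc 0 π) : IntervalIntegrable g volume x y := by
  refine hg.mono_set ?_
  rw [uIcc_of_le Real.pi_pos.le]
  exact uIcc_subset_Icc hx hy

lemma continuousOn_primitive {g : ℝ → ℝ} (hg : IntervalIntegrable g volume 0 π) :
    ContinuousOn (fun x => ∫ s in (0 : ℝ)..x, g s) (Icc 0 π) := by
  have := intervalIntegral.continuousOn_primitive_interval' hg left_mem_uIcc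
  rwa [uIcc_of_le Real.pi_pos.le] at this

/-- Solutions are constructed as twice integrated right-hand sides. For a merely integrable `g` the
inner integral is absolutely continuous and differentiable almost everywhere by Lebesgue's theorem,
which is all that `HasSecondDeriv` asks for. -/
lemma hasSecondDeriv_of_integral {v g : ℝ → ℝ} {a b : ℝ} (hg : IntervalIntegrable g volume 0 π)
    (hv : ∀ x ∈ Icc 0 π, v x = a + ∫ s in (0 : ℝ)..x, (b + ∫ r in (0 : ℝ)..s, g r)) :
    HasSecondDeriv v (fun x => b + ∫ r in (0 : ℝ)..x, g r) g where
  hasDeriv x hx := by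
    have hc : ContinuousOn (fun x => b + ∫ r in (0 : ℝ)..x, g r) (Icc 0 π) :=
      continuousOn_const.add (continuousOn_primitive hg)
    have hi : IntervalIntegrable (fun x => b + ∫ r in (0 : ℝ)..x, g r) volume 0 π :=
      ContinuousOn.intervalIntegrable (by rwa [uIcc_of_le Real.pi_pos.le])
    have : Fact (x ∈ Icc 0 π) := ⟨hx⟩
    have := intervalIntegral.integral_hasDerivWithinAt_right (s := Icc 0 π) (t := Icc 0 π)
      (intervalIntegrable_mono_Icc hi (left_mem_Icc.2 Real.pi_pos.le) hx)
      (hc.stronglyMeasurableAtFilter_nhdsWithin measurableSet_Icc x) (hc x hx)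
    exact (this.const_add a).congr hv (hv x hx)
  absCont := by
    refine AbsolutelyContinuousOnInterval.fun_add (f := fun _ => b)
      (LipschitzOnWith.absolutelyContinuousOnInterval (K := 0) ?_)
      (hg.absolutelyContinuousOnInterval_intervalIntegral (c := 0) left_mem_uIcc)
    exact LipschitzWith.lipschitzOnWith (LipschitzWith.const b)
  deriv_ae := by
    filter_upwards [hg.ae_hasDerivAt_integral] with x hx hm
    have := hx (by rw [uIcc_of_le Real.pi_pos.le]; exact Ioo_subset_Icc_self hm) 0 left_mem_uIcc
    exact this.const_add b

/-- Grönwall's argument with zero data and an integrable weight. Beyond a point `x` with `∫₀ˣ g f ≤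
0` choose `z` with `∫ₓᶻ g < 1/2`. The maximum `f m` over `[x, z]` then satisfies `f m ≤ f m / 2`, so
it is not positive and the inequality persists up to `z`. Continuous induction covers `[0, π]`. -/
lemma eq_zero_of_le_integral_mul {f g : ℝ → ℝ} (hf : ContinuousOn f (Icc 0 π))
    (hf0 : ∀ x ∈ Icc 0 π, 0 ≤ f x) (hg : IntervalIntegrable g volume 0 π)
    (hg0 : ∀ x, 0 ≤ g x) (h : ∀ x ∈ Icc 0 π, f x ≤ ∫ s in (0 : ℝ)..x, g s * f s) :
    ∀ x ∈ Icc 0 π, f x = 0 := by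
  have hgf : IntervalIntegrable (fun s => g s * f s) volume 0 π :=
    hg.mul_continuousOn (by rwa [uIcc_of_le Real.pi_pos.le])
  have h0 : (0 : ℝ) ∈ Icc 0 π := left_mem_Icc.2 Real.pi_pos.le
  have hint : ContinuousOn (fun x => ∫ s in (0 : ℝ)..x, g s * f s) (Icc 0 π) :=
    continuousOn_primitive hgf
  have hsub : Icc 0 π ⊆ {x | ∫ s in (0 : ℝ)..x, g s * f s ≤ 0} := by
    refine IsClosed.Icc_subset_of_forall_exists_gt ?_ (by simp) ?_
    · have : IsClosed (Icc 0 π ∩ (fun x => ∫ s in (0 : ℝ)..x, g s * f s) ⁻¹' Iic 0) :=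
        hint.preimage_isClosed_of_isClosed isClosed_Icc isClosed_Iic
      rw [inter_comm] at this
      exact this
    · rintro x ⟨hx, hxm⟩ y hy
      have hxI : x ∈ Icc 0 π := Ico_subset_Icc_self hxm
      have hG : ContinuousWithinAt (fun z => ∫ s in (0 : ℝ)..z, g s) (Icc 0 π) x :=
        continuousOn_primitive hg x hxI
      have hev : ∀ᶠ z in nhdsWithin x (Icc 0 π),
          ∫ s in (0 : ℝ)..z, g s < (∫ s in (0 : ℝ)..x, g s) + 1 / 2 :=
        hG.eventually_lt_const (by linarith)
      obtain ⟨ε, hε, hball⟩ := Metric.mem_nhdsWithin_iff.1 hev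
      set z := min (min y π) (x + ε / 2) with hz
      have hxz : x < z := lt_min (lt_min hy hxm.2) (by linarith)
      have hzπ : z ≤ π := (min_le_left _ _).trans (min_le_right _ _)
      have hzI : z ∈ Icc 0 π := ⟨hxI.1.trans hxz.le, hzπ⟩
      have hzG : ∫ s in x..z, g s < 1 / 2 := by
        have : z ∈ Metric.ball x ε ∩ Icc 0 π := by
          refine ⟨?_, hzI⟩
          have : z ≤ x + ε / 2 := min_le_right _ _
          rw [Metric.mem_ball, Real.dist_eq, abs_of_pos (by linarith)]
          linarith
        have h1 := hball this
        have h2 := intervalIntegral.integral_add_adjacent_intervals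
          (intervalIntegrable_mono_Icc hg h0 hxI) (intervalIntegrable_mono_Icc hg hxI hzI)
        simp only [mem_ofPred_eq] at h1
        linarith
      have hIzs : Icc x z ⊆ Icc 0 π := Icc_subset_Icc hxI.1 hzπ
      obtain ⟨m, hm, hmax⟩ := isCompact_Icc.exists_isMaxOn (nonempty_Icc.2 hxz.le)
        (hf.mono hIzs)
      have hmI := hIzs hm
      have hbd : ∀ w ∈ Icc x z, ∫ s in x..w, g s * f s ≤ f m / 2 := by
        intro w hw
        have hwI := hIzs hw
        calc ∫ s in x..w, g s * f s ≤ ∫ s in x..w, g s * f m := by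
              refine intervalIntegral.integral_mono_on hw.1
                (intervalIntegrable_mono_Icc hgf hxI hwI)
                ((intervalIntegrable_mono_Icc hg hxI hwI).mul_const _) ?_
              intro s hs
              exact mul_le_mul_of_nonneg_left (hmax ⟨hs.1, hs.2.trans hw.2⟩) (hg0 s)
          _ = (∫ s in x..w, g s) * f m := by rw [intervalIntegral.integral_mul_const]
          _ ≤ (1 / 2) * f m := by
              refine mul_le_mul_of_nonneg_right ?_ (hf0 m hmI)
              have h2 := intervalIntegral.integral_add_adjacent_intervals
                (intervalIntegrable_mono_Icc hg hxI hwI) (intervalIntegrable_mono_Icc hg hwI hzI)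
              have h3 : 0 ≤ ∫ s in w..z, g s :=
                intervalIntegral.integral_nonneg hw.2 fun s _ => hg0 s
              linarith
          _ = f m / 2 := by ring
      have hsplit : ∀ w ∈ Icc x z, ∫ s in (0 : ℝ)..w, g s * f s ≤ f m / 2 := by
        intro w hw
        have h2 := intervalIntegral.integral_add_adjacent_intervals
          (intervalIntegrable_mono_Icc hgf h0 hxI) (intervalIntegrable_mono_Icc hgf hxI (hIzs hw))
        have := hbd w hw
        simp only [mem_ofPred_eq] at hx
        linarith
      have hfm : f m ≤ 0 := by
        have := h m hmI
        have := hsplit m hm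
        linarith
      refine ⟨z, ?_, hxz, (min_le_left _ _).trans (min_le_left _ _)⟩
      have := hsplit z ⟨hxz.le, le_rfl⟩
      simp only [mem_ofPred_eq]
      linarith
  intro x hx
  exact le_antisymm ((h x hx).trans (hsub hx)) (hf0 x hx)

/-- With zero data, `|y'|` is at most `∫ |q - μ| |y|` and so `|y(x)| ≤ π ∫₀ˣ |q - μ| |y|`. The
previous Grönwall lemma applies with the weight `π |q - μ|`. -/
lemma eqOn_zero_of_isSolution {q : ℝ → ℝ} (hq : IntervalIntegrable q volume 0 π) {μ : ℝ}
    {y y₁ : ℝ → ℝ} (hy : IsSolution q μ y y₁) (h0 : y 0 = 0) (h1 : y₁ 0 = 0) :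
    ∀ x ∈ Icc 0 π, y x = 0 := by
  have hqm : IntervalIntegrable (fun s => π * |q s - μ|) volume 0 π :=
    ((hq.sub intervalIntegrable_const).abs).const_mul π
  have hyc := hy.continuousOn
  have hI0 : (0 : ℝ) ∈ Icc 0 π := left_mem_Icc.2 Real.pi_pos.le
  have hprod : IntervalIntegrable (fun s => |q s - μ| * |y s|) volume 0 π :=
    ((hq.sub intervalIntegrable_const).abs).mul_continuousOn
      (by rw [uIcc_of_le Real.pi_pos.le]; exact hyc.abs)
  have key := eq_zero_of_le_integral_mul (f := fun x => |y x|) hyc.abs (fun x _ => abs_nonneg _) hqm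
    (fun x => by positivity) ?_
  · intro x hx
    exact abs_eq_zero.1 (key x hx)
  intro x hx
  have hy1 : ∀ s ∈ Icc 0 x, |y₁ s| ≤ ∫ r in (0 : ℝ)..x, |q r - μ| * |y r| := by
    intro s hs
    have hsI : s ∈ Icc 0 π := ⟨hs.1, hs.2.trans hx.2⟩
    have e := hy.integral_eq_sub hsI
    rw [h1, sub_zero] at e
    rw [← e]
    calc |∫ r in (0 : ℝ)..s, (q r * y r - μ * y r)|
        ≤ ∫ r in (0 : ℝ)..s, |q r * y r - μ * y r| :=
          intervalIntegral.abs_integral_le_integral_abs hs.1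
      _ = ∫ r in (0 : ℝ)..s, |q r - μ| * |y r| := by
          refine intervalIntegral.integral_congr fun r _ => ?_
          simp only [← abs_mul, sub_mul]
      _ ≤ ∫ r in (0 : ℝ)..x, |q r - μ| * |y r| := by
          refine intervalIntegral.integral_mono_interval le_rfl hs.1 hs.2
            (Eventually.of_forall fun r => by positivity)
            (intervalIntegrable_mono_Icc hprod hI0 hx)
  have e := hy.integral_deriv_eq_sub hx
  rw [h0, sub_zero] at e
  have hb : ‖∫ s in (0 : ℝ)..x, y₁ s‖ ≤ (∫ r in (0 : ℝ)..x, |q r - μ| * |y r|) * |x - 0| := by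
    refine intervalIntegral.norm_integral_le_of_norm_le_const fun s hs => ?_
    rw [uIoc_of_le hx.1] at hs
    exact hy1 s (Ioc_subset_Icc_self hs)
  have hnn : 0 ≤ ∫ r in (0 : ℝ)..x, |q r - μ| * |y r| :=
    intervalIntegral.integral_nonneg hx.1 fun r _ => by positivity
  rw [e, sub_zero, abs_of_nonneg hx.1, Real.norm_eq_abs] at hb
  calc |y x| ≤ _ := hb
    _ ≤ (∫ r in (0 : ℝ)..x, |q r - μ| * |y r|) * π := mul_le_mul_of_nonneg_left hx.2 hnn
    _ = ∫ r in (0 : ℝ)..x, π * |q r - μ| * |y r| := by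
        simp only [mul_assoc, intervalIntegral.integral_const_mul]
        ring

/-- The Cauchy problem for `-y'' + q y = μ y` has at most one solution. -/
lemma IsSolution.eqOn {q : ℝ → ℝ} (hq : IntervalIntegrable q volume 0 π) {μ : ℝ}
    {y y₁ z z₁ : ℝ → ℝ} (hy : IsSolution q μ y y₁) (hz : IsSolution q μ z z₁) (h0 : y 0 = z 0)
    (h1 : y₁ 0 = z₁ 0) : ∀ x ∈ Icc 0 π, y x = z x := by
  have : IsSolution q μ (fun x => y x - z x) (fun x => y₁ x - z₁ x) :=
    (HasSecondDeriv.sub hy hz).congr_ae (Eventually.of_forall fun x _ => by ring)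
  intro x hx
  exact sub_eq_zero.1 (eqOn_zero_of_isSolution hq this (by simp [h0]) (by simp [h1]) x hx)

/-! ### Bessel and Parseval for orthogonal families in `L²` -/

section Orthogonal

variable {α ι : Type*} [MeasurableSpace α] {ν : Measure α}

lemma inner_toLp {f g : α → ℝ} (hf : MemLp f 2 ν) (hg : MemLp g 2 ν) :
    inner ℝ (hf.toLp f) (hg.toLp g) = ∫ x, f x * g x ∂ν := by
  rw [L2.inner_def]
  refine integral_congr_ae ?_
  filter_upwards [hf.coeFn_toLp, hg.coeFn_toLp] with x h1 h2
  rw [h1, h2]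
  simp [mul_comm]

/-- The normalized elements of an orthogonal family of functions in `L²`. -/
def normalizedLp (φ : ι → α → ℝ) (hφ : ∀ n, MemLp (φ n) 2 ν) (n : ι) : Lp ℝ 2 ν :=
  (√(∫ x, φ n x ^ 2 ∂ν))⁻¹ • (hφ n).toLp (φ n)

variable {φ : ι → α → ℝ} {hφ : ∀ n, MemLp (φ n) 2 ν}

lemma inner_normalizedLp {f : α → ℝ} (hf : MemLp f 2 ν) (n : ι) :
    inner ℝ (hf.toLp f) (normalizedLp φ hφ n)
      = (√(∫ x, φ n x ^ 2 ∂ν))⁻¹ * ∫ x, f x * φ n x ∂ν := by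
  rw [normalizedLp, inner_smul_right, inner_toLp]

lemma inner_normalizedLp_mul (hpos : ∀ n, 0 < ∫ x, φ n x ^ 2 ∂ν) {f g : α → ℝ}
    (hf : MemLp f 2 ν) (hg : MemLp g 2 ν) (n : ι) :
    inner ℝ (hf.toLp f) (normalizedLp φ hφ n) * inner ℝ (hg.toLp g) (normalizedLp φ hφ n)
      = (∫ x, f x * φ n x ∂ν) * (∫ x, g x * φ n x ∂ν) / ∫ x, φ n x ^ 2 ∂ν := by
  rw [inner_normalizedLp, inner_normalizedLp]
  have h := Real.mul_self_sqrt (hpos n).le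
  have h2 : √(∫ x, φ n x ^ 2 ∂ν) ≠ 0 := (Real.sqrt_pos.2 (hpos n)).ne'
  rw [eq_div_iff (hpos n).ne']
  nth_rewrite 3 [← h]
  field_simp

lemma orthonormal_normalizedLp (hpos : ∀ n, 0 < ∫ x, φ n x ^ 2 ∂ν)
    (horth : ∀ n m, n ≠ m → ∫ x, φ n x * φ m x ∂ν = 0) :
    Orthonormal ℝ (normalizedLp φ hφ) := by
  classical
  rw [orthonormal_iff_ite]
  intro i j
  nth_rewrite 1 [normalizedLp]
  rw [inner_smul_left, inner_normalizedLp]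
  split_ifs with h
  · subst h
    have h := Real.mul_self_sqrt (hpos i).le
    have h2 : √(∫ x, φ i x ^ 2 ∂ν) ≠ 0 := (Real.sqrt_pos.2 (hpos i)).ne'
    have h3 : ∫ x, φ i x * φ i x ∂ν = ∫ x, φ i x ^ 2 ∂ν := by simp only [sq]
    rw [h3]
    nth_rewrite 3 [← h]
    simp
    field_simp
  · rw [horth i j h]
    simp

lemma bessel (hφ : ∀ n, MemLp (φ n) 2 ν) (hpos : ∀ n, 0 < ∫ x, φ n x ^ 2 ∂ν)
    (horth : ∀ n m, n ≠ m → ∫ x, φ n x * φ m x ∂ν = 0) {f : α → ℝ} (hf : MemLp f 2 ν) :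
    Summable (fun n => (∫ x, f x * φ n x ∂ν) ^ 2 / ∫ x, φ n x ^ 2 ∂ν) ∧
    ∑' n, (∫ x, f x * φ n x ∂ν) ^ 2 / (∫ x, φ n x ^ 2 ∂ν) ≤ ∫ x, f x ^ 2 ∂ν := by
  have ho := orthonormal_normalizedLp (hφ := hφ) hpos horth
  have h1 := ho.inner_products_summable (hf.toLp f)
  have h2 := ho.tsum_inner_products_le (hf.toLp f)
  have e : ∀ n, ‖inner ℝ (normalizedLp φ hφ n) (hf.toLp f)‖ ^ 2
      = (∫ x, f x * φ n x ∂ν) ^ 2 / ∫ x, φ n x ^ 2 ∂ν := by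
    intro n
    rw [Real.norm_eq_abs, sq_abs, real_inner_comm, sq, inner_normalizedLp_mul hpos, sq]
  simp only [e] at h1 h2
  refine ⟨h1, h2.trans_eq ?_⟩
  rw [← real_inner_self_eq_norm_sq, inner_toLp]
  simp only [sq]

lemma exists_hilbertBasis (hφ : ∀ n, MemLp (φ n) 2 ν) (hpos : ∀ n, 0 < ∫ x, φ n x ^ 2 ∂ν)
    (horth : ∀ n m, n ≠ m → ∫ x, φ n x * φ m x ∂ν = 0)
    (hcompl : ∀ f, MemLp f 2 ν → (∀ n, ∫ x, f x * φ n x ∂ν = 0) → f =ᵐ[ν] 0) :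
    ∃ b : HilbertBasis ι ℝ (Lp ℝ 2 ν), ⇑b = normalizedLp φ hφ := by
  have ho := orthonormal_normalizedLp (hφ := hφ) hpos horth
  have hbot : (Submodule.span ℝ (range (normalizedLp φ hφ)))ᗮ = ⊥ := by
    rw [Submodule.eq_bot_iff]
    intro v hv
    have hv' : ∀ n, inner ℝ v (normalizedLp φ hφ n) = 0 := fun n => by
      rw [real_inner_comm]
      exact (Submodule.mem_orthogonal _ _).1 hv _ (Submodule.subset_span ⟨n, rfl⟩)
    have hvL : MemLp v 2 ν := Lp.memLp v
    have hz : (v : α → ℝ) =ᵐ[ν] 0 := by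
      refine hcompl v hvL fun n => ?_
      have := hv' n
      rw [← Lp.toLp_coeFn v hvL, inner_normalizedLp] at this
      rcases mul_eq_zero.1 this with h | h
      · exact absurd h (inv_ne_zero (Real.sqrt_pos.2 (hpos n)).ne')
      · exact h
    exact (Lp.eq_zero_iff_ae_eq_zero).2 hz
  exact ⟨HilbertBasis.mkOfOrthogonalEqBot ho hbot, HilbertBasis.coe_mkOfOrthogonalEqBot _ _⟩

lemma parseval (hφ : ∀ n, MemLp (φ n) 2 ν) (hpos : ∀ n, 0 < ∫ x, φ n x ^ 2 ∂ν)
    (horth : ∀ n m, n ≠ m → ∫ x, φ n x * φ m x ∂ν = 0)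
    (hcompl : ∀ f, MemLp f 2 ν → (∀ n, ∫ x, f x * φ n x ∂ν = 0) → f =ᵐ[ν] 0)
    {f g : α → ℝ} (hf : MemLp f 2 ν) (hg : MemLp g 2 ν) :
    HasSum (fun n => (∫ x, f x * φ n x ∂ν) * (∫ x, g x * φ n x ∂ν) / ∫ x, φ n x ^ 2 ∂ν)
      (∫ x, f x * g x ∂ν) := by
  obtain ⟨b, hb⟩ := exists_hilbertBasis hφ hpos horth hcompl
  have := b.hasSum_inner_mul_inner (hf.toLp f) (hg.toLp g)
  rw [inner_toLp] at this
  have e : (fun n => (∫ x, f x * φ n x ∂ν) * (∫ x, g x * φ n x ∂ν) / ∫ x, φ n x ^ 2 ∂ν)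
      = fun n => inner ℝ (hf.toLp f) (b n) * inner ℝ (b n) (hg.toLp g) := by
    funext n
    rw [hb, ← inner_normalizedLp_mul hpos hf hg (hφ := hφ),
      real_inner_comm (hg.toLp g)]
  rw [e]
  exact this

end Orthogonal

/-! ### Cosine and sine systems on `[0, π]` -/

lemma integral_cos_int_mul {k : ℤ} (hk : k ≠ 0) : ∫ x in (0 : ℝ)..π, Real.cos (k * x) = 0 := by
  have hk' : (k : ℝ) ≠ 0 := by exact_mod_cast hk
  rw [intervalIntegral.integral_comp_mul_left (fun x => Real.cos x) hk', integral_cos]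
  simp [Real.sin_int_mul_pi]

lemma integral_cos_mul_cos {n m : ℕ} (h : n ≠ m) :
    ∫ x in (0 : ℝ)..π, Real.cos (n * x) * Real.cos (m * x) = 0 := by
  have e : ∀ x : ℝ, Real.cos (n * x) * Real.cos (m * x)
      = (1 / 2) * Real.cos (((n - m : ℤ) : ℝ) * x) + (1 / 2) * Real.cos (((n + m : ℤ) : ℝ) * x) := by
    intro x
    push_cast
    rw [sub_mul, add_mul, Real.cos_sub, Real.cos_add]
    ring
  simp only [e]
  rw [intervalIntegral.integral_add (by apply Continuous.intervalIntegrable; fun_prop)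
    (by apply Continuous.intervalIntegrable; fun_prop), intervalIntegral.integral_const_mul,
    intervalIntegral.integral_const_mul, integral_cos_int_mul (by omega),
    integral_cos_int_mul (by omega)]
  simp

lemma integral_sin_mul_sin {n m : ℕ} (h : n ≠ m) :
    ∫ x in (0 : ℝ)..π, Real.sin (n * x) * Real.sin (m * x) = 0 := by
  have e : ∀ x : ℝ, Real.sin (n * x) * Real.sin (m * x)
      = (1 / 2) * Real.cos (((n - m : ℤ) : ℝ) * x) - (1 / 2) * Real.cos (((n + m : ℤ) : ℝ) * x) := by
    intro x
    push_cast
    rw [sub_mul, add_mul, Real.cos_sub, Real.cos_add]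
    ring
  simp only [e]
  rw [intervalIntegral.integral_sub (by apply Continuous.intervalIntegrable; fun_prop)
    (by apply Continuous.intervalIntegrable; fun_prop), intervalIntegral.integral_const_mul,
    intervalIntegral.integral_const_mul, integral_cos_int_mul (by omega),
    integral_cos_int_mul (by omega)]
  simp

lemma integral_cos_sq (n : ℕ) : ∫ x in (0 : ℝ)..π, Real.cos (n * x) ^ 2 = weight₀ n := by
  rcases Nat.eq_zero_or_pos n with rfl | hn
  · simp [weight₀]
  have e : ∀ x : ℝ, Real.cos (n * x) ^ 2 = 1 / 2 + (1 / 2) * Real.cos (((2 * n : ℤ) : ℝ) * x) := by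
    intro x
    push_cast
    rw [Real.cos_sq, mul_assoc]
    ring
  simp only [e]
  rw [intervalIntegral.integral_add (by simp)
    (by apply Continuous.intervalIntegrable; fun_prop), intervalIntegral.integral_const_mul,
    integral_cos_int_mul (by omega)]
  simp [weight₀, hn.ne']
  ring

lemma integral_sin_sq {n : ℕ} (hn : n ≠ 0) : ∫ x in (0 : ℝ)..π, Real.sin (n * x) ^ 2 = π / 2 := by
  have e : ∀ x : ℝ, Real.sin (n * x) ^ 2 = 1 / 2 - (1 / 2) * Real.cos (((2 * n : ℤ) : ℝ) * x) := by
    intro x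
    push_cast
    rw [Real.sin_sq, Real.cos_sq, mul_assoc]
    ring
  simp only [e]
  rw [intervalIntegral.integral_sub (by simp)
    (by apply Continuous.intervalIntegrable; fun_prop), intervalIntegral.integral_const_mul,
    integral_cos_int_mul (by omega)]
  simp
  ring

/-- The linear span of the functions `cos (n t)`. -/
def cosSpan : Submodule ℝ (ℝ → ℝ) :=
  Submodule.span ℝ (range fun (n : ℕ) (t : ℝ) => Real.cos (n * t))

lemma cos_mem_cosSpan (n : ℕ) : (fun t : ℝ => Real.cos (n * t)) ∈ cosSpan :=
  Submodule.subset_span ⟨n, rfl⟩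

/-- Product-to-sum formulas make the linear span an algebra, so the output of the Stone–Weierstrass
theorem stays in the span. The frequency `n - m` may be negative, hence the `natAbs` and the
evenness of the cosine. -/
lemma cosSpan_mul {p r : ℝ → ℝ} (hp : p ∈ cosSpan) (hr : r ∈ cosSpan) : p * r ∈ cosSpan := by
  induction hp using Submodule.span_induction with
  | zero => simp
  | add a b _ _ ha hb => rw [add_mul]; exact add_mem ha hb
  | smul c a _ ha => rw [smul_mul_assoc]; exact Submodule.smul_mem _ _ ha
  | mem a ha =>
    obtain ⟨n, rfl⟩ := ha
    induction hr using Submodule.span_induction with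
    | zero => simp
    | add a b _ _ ha hb => rw [mul_add]; exact add_mem ha hb
    | smul c a _ ha => rw [mul_smul_comm]; exact Submodule.smul_mem _ _ ha
    | mem a ha =>
      obtain ⟨m, rfl⟩ := ha
      have e : ((fun t : ℝ => Real.cos (n * t)) * fun t : ℝ => Real.cos (m * t))
          = (1 / 2 : ℝ) • (fun t : ℝ => Real.cos ((n + m : ℕ) * t))
            + (1 / 2 : ℝ) • (fun t : ℝ => Real.cos (((n - m : ℤ).natAbs : ℕ) * t)) := by
        funext t
        have h2 : Real.cos (((n - m : ℤ).natAbs : ℕ) * t) = Real.cos (((n : ℝ) - m) * t) := by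
          have h3 : (((n - m : ℤ).natAbs : ℕ) : ℝ) = |(n : ℝ) - m| := by
            rw [Nat.cast_natAbs]
            push_cast
            rfl
          rw [h3]
          rcases abs_choice ((n : ℝ) - m) with h | h <;> rw [h]
          rw [neg_mul, Real.cos_neg]
        simp only [Pi.mul_apply, Pi.add_apply, Pi.smul_apply, smul_eq_mul, h2]
        push_cast
        rw [sub_mul, add_mul, Real.cos_sub, Real.cos_add]
        ring
      rw [e]
      exact add_mem (Submodule.smul_mem _ _ (cos_mem_cosSpan _))
        (Submodule.smul_mem _ _ (cos_mem_cosSpan _))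

/-- Every continuous function on `[0, π]` is a uniform limit of cosine polynomials. -/
lemma exists_cosSpan_near {w : ℝ → ℝ} (hw : ContinuousOn w (Icc 0 π)) {ε : ℝ} (hε : 0 < ε) :
    ∃ p ∈ cosSpan, ∀ t ∈ Icc 0 π, |w t - p t| < ε := by
  let cm : C(Icc (0 : ℝ) π, ℝ) := ⟨fun t => Real.cos t, by fun_prop⟩
  let A : Subalgebra ℝ C(Icc (0 : ℝ) π, ℝ) := Algebra.adjoin ℝ {cm}
  -- One generator suffices to separate points because the cosine is injective on `[0, π]`.
  have hsep : A.SeparatesPoints := by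
    intro x y hxy
    refine ⟨cm, ⟨cm, Algebra.subset_adjoin rfl, rfl⟩, fun h => hxy ?_⟩
    exact Subtype.ext (Real.injOn_cos x.2 y.2 h)
  have hA : ∀ f ∈ A, ∃ p ∈ cosSpan, ∀ t : Icc (0 : ℝ) π, f t = p t := by
    intro f hf
    induction hf using Algebra.adjoin_induction with
    | mem f hf =>
      rw [mem_singleton_iff] at hf
      subst hf
      exact ⟨_, cos_mem_cosSpan 1, fun t => by simp [cm]⟩
    | algebraMap r =>
      exact ⟨_, Submodule.smul_mem _ r (cos_mem_cosSpan 0), fun t => by simp⟩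
    | add f g _ _ hf hg =>
      obtain ⟨p, hp, hfp⟩ := hf
      obtain ⟨r, hr, hgr⟩ := hg
      exact ⟨p + r, add_mem hp hr, fun t => by simp [hfp, hgr]⟩
    | mul f g _ _ hf hg =>
      obtain ⟨p, hp, hfp⟩ := hf
      obtain ⟨r, hr, hgr⟩ := hg
      exact ⟨p * r, cosSpan_mul hp hr, fun t => by simp [hfp, hgr]⟩
  let wm : C(Icc (0 : ℝ) π, ℝ) := ⟨fun t => w t, continuousOn_iff_continuous_domRestrict.1 hw⟩
  obtain ⟨g, hg⟩ := ContinuousMap.exists_mem_subalgebra_near_continuousMap_of_separatesPoints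
    A hsep wm ε hε
  obtain ⟨p, hp, hgp⟩ := hA g g.2
  refine ⟨p, hp, fun t ht => ?_⟩
  have h1 := ((g : C(Icc (0 : ℝ) π, ℝ)) - wm).norm_coe_le_norm ⟨t, ht⟩
  have h2 := h1.trans_lt hg
  rw [ContinuousMap.sub_apply, hgp, Real.norm_eq_abs, abs_sub_comm] at h2
  exact h2

lemma continuous_of_mem_cosSpan {p : ℝ → ℝ} (hp : p ∈ cosSpan) : Continuous p := by
  induction hp using Submodule.span_induction with
  | zero => exact continuous_const
  | add a b _ _ ha hb => exact ha.add hb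
  | smul c a _ ha => exact ha.const_smul c
  | mem a ha =>
    obtain ⟨n, rfl⟩ := ha
    fun_prop

lemma memLp_of_continuousOn {f : ℝ → ℝ} (hf : ContinuousOn f (Icc 0 π)) :
    MemLp f 2 (volume.restrict (Ioc 0 π)) := by
  obtain ⟨C, hC⟩ := isCompact_Icc.exists_bound_of_continuousOn hf
  refine MemLp.of_bound ((hf.mono Ioc_subset_Icc_self).aestronglyMeasurable measurableSet_Ioc) C ?_
  exact (ae_restrict_iff' measurableSet_Ioc).2
    (Eventually.of_forall fun x hx => hC x (Ioc_subset_Icc_self hx))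

lemma memLp_Ioc_of_Ioo {q : ℝ → ℝ} (hq : MemLp q 2 (volume.restrict (Ioo 0 π))) :
    MemLp q 2 (volume.restrict (Ioc 0 π)) := by
  rwa [← Measure.restrict_congr_set Ioo_ae_eq_Ioc]

/-- Orthogonality to the cosines extends to their span, then by uniform approximation to all
continuous functions, in particular to smooth functions compactly supported in `(0, π)`. These
already force `f` to vanish almost everywhere. -/
lemma cos_complete {f : ℝ → ℝ} (hf : MemLp f 2 (volume.restrict (Ioc 0 π)))
    (h : ∀ n : ℕ, ∫ x in Ioc 0 π, f x * Real.cos (n * x) = 0) :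
    f =ᵐ[volume.restrict (Ioc 0 π)] 0 := by
  have hfi : Integrable f (volume.restrict (Ioc 0 π)) := hf.integrable (by norm_num)
  have hmul : ∀ g : ℝ → ℝ, Continuous g →
      Integrable (fun x => f x * g x) (volume.restrict (Ioc 0 π)) := by
    intro g hg
    exact MemLp.integrable_mul hf (memLp_of_continuousOn hg.continuousOn)
  have hspan : ∀ p ∈ cosSpan, ∫ x in Ioc 0 π, f x * p x = 0 := by
    intro p hp
    induction hp using Submodule.span_induction with
    | zero => simp
    | add a b ha' hb' ha hb =>
      simp only [Pi.add_apply, mul_add]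
      rw [integral_add (hmul a (continuous_of_mem_cosSpan ha'))
        (hmul b (continuous_of_mem_cosSpan hb')), ha, hb, add_zero]
    | smul c a _ ha =>
      simp only [Pi.smul_apply, smul_eq_mul, mul_left_comm _ c]
      rw [integral_const_mul, ha, mul_zero]
    | mem a ha =>
      obtain ⟨n, rfl⟩ := ha
      exact h n
  have hcont : ∀ g : ℝ → ℝ, Continuous g → ∫ x in Ioc 0 π, f x * g x = 0 := by
    intro g hg
    by_contra hne
    set I := ∫ x in Ioc 0 π, ‖f x‖
    have hI : 0 ≤ I := integral_nonneg fun x => norm_nonneg _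
    have hpos : 0 < |∫ x in Ioc 0 π, f x * g x| := abs_pos.2 hne
    -- The tolerance is chosen so that replacing `g` by `p` changes the integral by at most `I · ε`,
    -- which is less than its supposed nonzero absolute value, although `∫ f p = 0`.
    obtain ⟨p, hp, hgp⟩ := exists_cosSpan_near hg.continuousOn
      (ε := |∫ x in Ioc 0 π, f x * g x| / (2 * (I + 1))) (by positivity)
    have hpc := continuous_of_mem_cosSpan hp
    have h1 : ∫ x in Ioc 0 π, f x * g x = ∫ x in Ioc 0 π, (f x * g x - f x * p x) := by
      rw [integral_sub (hmul g hg) (hmul p hpc), hspan p hp, sub_zero]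
    have h2 : ‖∫ x in Ioc 0 π, (f x * g x - f x * p x)‖
        ≤ ∫ x in Ioc 0 π, ‖f x‖ * (|∫ x in Ioc 0 π, f x * g x| / (2 * (I + 1))) := by
      refine norm_integral_le_of_norm_le (hfi.norm.mul_const _) ?_
      refine (ae_restrict_iff' measurableSet_Ioc).2 (Eventually.of_forall fun x hx => ?_)
      rw [← mul_sub, norm_mul]
      exact mul_le_mul_of_nonneg_left (hgp x (Ioc_subset_Icc_self hx)).le (norm_nonneg _)
    rw [← h1, integral_mul_const, Real.norm_eq_abs] at h2
    have h3 : I * (|∫ x in Ioc 0 π, f x * g x| / (2 * (I + 1)))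
        < |∫ x in Ioc 0 π, f x * g x| := by
      rw [mul_div_assoc', div_lt_iff₀ (by positivity)]
      nlinarith
    linarith
  have hloc : LocallyIntegrableOn f (Ioo 0 π) volume := by
    have : IntegrableOn f (Ioo 0 π) volume := by
      have : IntegrableOn f (Ioc 0 π) volume := hfi
      exact this.mono_set Ioo_subset_Ioc_self
    exact this.locallyIntegrableOn
  have := isOpen_Ioo.ae_eq_zero_of_integral_contDiff_smul_eq_zero hloc ?_
  · rw [EventuallyEq, ← Measure.restrict_congr_set (Ioo_ae_eq_Ioc (a := (0 : ℝ)) (b := π)),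
      ae_restrict_iff' measurableSet_Ioo]
    exact this
  · intro g hg _ hsupp
    have h1 := hcont g hg.continuous
    rw [← h1]
    have : ∀ x, x ∉ Ioc 0 π → g x • f x = 0 := by
      intro x hx
      rw [image_eq_zero_of_notMem_tsupport (fun hx' => hx (Ioo_subset_Ioc_self (hsupp hx'))),
        zero_smul]
    rw [← setIntegral_eq_integral_of_forall_compl_eq_zero this]
    simp only [smul_eq_mul, mul_comm]

/-- Parseval's identity for the cosines. -/
lemma hasSum_cos {f g : ℝ → ℝ} (hf : MemLp f 2 (volume.restrict (Ioc 0 π)))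
    (hg : MemLp g 2 (volume.restrict (Ioc 0 π))) :
    HasSum (fun n : ℕ => (∫ x in (0 : ℝ)..π, f x * Real.cos (n * x))
      * (∫ x in (0 : ℝ)..π, g x * Real.cos (n * x)) / weight₀ n)
      (∫ x in (0 : ℝ)..π, f x * g x) := by
  simp only [← integral_cos_sq]
  simp only [intervalIntegral.integral_of_le Real.pi_pos.le]
  refine parseval (φ := fun (n : ℕ) x => Real.cos (n * x)) (ν := volume.restrict (Ioc 0 π))
    ?_ ?_ ?_ ?_ hf hg
  · exact fun n => memLp_of_continuousOn (by fun_prop)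
  · intro n
    rw [← intervalIntegral.integral_of_le Real.pi_pos.le, integral_cos_sq, weight₀]
    have := Real.pi_pos
    split_ifs <;> positivity
  · intro n m hnm
    rw [← intervalIntegral.integral_of_le Real.pi_pos.le, integral_cos_mul_cos hnm]
  · exact fun f hf h => cos_complete hf h

lemma weight₀_pos (n : ℕ) : 0 < weight₀ n := by
  have := Real.pi_pos
  rw [weight₀]
  split_ifs <;> positivity

lemma weight₀_le (n : ℕ) : weight₀ n ≤ π := by
  have := Real.pi_pos
  rw [weight₀]
  split_ifs <;> linarith

lemma bessel_cos {f : ℝ → ℝ} (hf : MemLp f 2 (volume.restrict (Ioc 0 π))) :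
    Summable (fun n : ℕ => (∫ x in (0 : ℝ)..π, f x * Real.cos (n * x)) ^ 2) ∧
    ∑' n : ℕ, (∫ x in (0 : ℝ)..π, f x * Real.cos (n * x)) ^ 2
      ≤ π * ∫ x in (0 : ℝ)..π, f x ^ 2 := by
  have h := (hasSum_cos hf hf).mul_left π
  have hle : ∀ n : ℕ, (∫ x in (0 : ℝ)..π, f x * Real.cos (n * x)) ^ 2
      ≤ π * ((∫ x in (0 : ℝ)..π, f x * Real.cos (n * x))
      * (∫ x in (0 : ℝ)..π, f x * Real.cos (n * x)) / weight₀ n) := by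
    intro n
    have := weight₀_pos n
    rw [mul_div_assoc', le_div_iff₀ this, ← sq, mul_comm]
    exact mul_le_mul_of_nonneg_right (weight₀_le n) (sq_nonneg _)
  have hs := Summable.of_nonneg_of_le (fun n => sq_nonneg _) hle h.summable
  refine ⟨hs, ?_⟩
  have := hs.tsum_le_tsum hle h.summable
  rw [h.tsum_eq] at this
  simpa only [sq] using this

/-- The orthogonal family starts with `sin x`, since the sine of index `0` vanishes and cannot be
normalised. Its zero coefficient is put back by a shift of the index. -/
lemma bessel_sin {f : ℝ → ℝ} (hf : MemLp f 2 (volume.restrict (Ioc 0 π))) :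
    Summable (fun n : ℕ => (∫ x in (0 : ℝ)..π, f x * Real.sin (n * x)) ^ 2) ∧
    ∑' n : ℕ, (∫ x in (0 : ℝ)..π, f x * Real.sin (n * x)) ^ 2
      ≤ π * ∫ x in (0 : ℝ)..π, f x ^ 2 := by
  have hb := bessel (φ := fun (n : ℕ) x => Real.sin ((n + 1 : ℕ) * x))
    (ν := volume.restrict (Ioc 0 π)) (fun n => memLp_of_continuousOn (by fun_prop))
    (fun n => by
      rw [← intervalIntegral.integral_of_le Real.pi_pos.le, integral_sin_sq (by omega)]
      have := Real.pi_pos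
      positivity)
    (fun n m hnm => by
      rw [← intervalIntegral.integral_of_le Real.pi_pos.le, integral_sin_mul_sin (by omega)]) hf
  simp only [← intervalIntegral.integral_of_le Real.pi_pos.le, integral_sin_sq (Nat.succ_ne_zero _)]
    at hb
  obtain ⟨h1, h2⟩ := hb
  have h3 : Summable (fun n : ℕ => (∫ x in (0 : ℝ)..π, f x * Real.sin ((n + 1 : ℕ) * x)) ^ 2) := by
    refine (h1.mul_right (π / 2)).congr fun n => ?_
    have := Real.pi_pos
    field_simp
  have h4 : Summable (fun n : ℕ => (∫ x in (0 : ℝ)..π, f x * Real.sin (n * x)) ^ 2) :=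
    (summable_nat_add_iff 1).1 h3
  refine ⟨h4, ?_⟩
  rw [h4.tsum_eq_zero_add]
  simp only [Nat.cast_zero, zero_mul, Real.sin_zero, mul_zero, intervalIntegral.integral_zero]
  rw [tsum_div_const, div_le_iff₀ (by have := Real.pi_pos; positivity)] at h2
  have h5 : 0 ≤ ∫ x in (0 : ℝ)..π, f x ^ 2 :=
    intervalIntegral.integral_nonneg Real.pi_pos.le fun x _ => sq_nonneg _
  have := Real.pi_pos
  nlinarith

/-! ### Volterra operators with kernels continuous on the triangle -/

/-- The projection of `ℝ` onto `[0, π]`. -/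
def clamp (x : ℝ) : ℝ := max 0 (min π x)

lemma continuous_clamp : Continuous clamp := by
  unfold clamp
  fun_prop

lemma clamp_mem (x : ℝ) : clamp x ∈ Icc 0 π :=
  ⟨le_max_left _ _, max_le Real.pi_pos.le (min_le_left _ _)⟩

lemma clamp_of_mem {x : ℝ} (hx : x ∈ Icc 0 π) : clamp x = x := by
  rw [clamp, min_eq_right hx.2, max_eq_right hx.1]

lemma exists_continuous_extension_Icc {u : ℝ → ℝ} (hu : ContinuousOn u (Icc 0 π)) :
    ∃ u' : ℝ → ℝ, Continuous u' ∧ ∀ x ∈ Icc 0 π, u' x = u x :=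
  ⟨fun x => u (clamp x), hu.comp_continuous continuous_clamp clamp_mem,
    fun _ hx => congrArg u (clamp_of_mem hx)⟩

/-- Composition with a retraction onto the triangle. A Volterra operator only sees the triangle, so
a kernel may be replaced by a globally continuous one whenever Fubini or continuity of parametric
integrals is needed. -/
lemma exists_continuous_extension_triangle {A : ℝ → ℝ → ℝ}
    (hA : ContinuousOn (fun p : ℝ × ℝ => A p.1 p.2) triangle) :
    ∃ A' : ℝ → ℝ → ℝ, Continuous (Function.uncurry A') ∧
      ∀ x t, 0 ≤ t → t ≤ x → x ≤ π → A' x t = A x t := by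
  refine ⟨fun x t => A (clamp x) (min (clamp t) (clamp x)), ?_, ?_⟩
  · have h : Continuous fun p : ℝ × ℝ => (clamp p.1, min (clamp p.2) (clamp p.1)) := by
      have := continuous_clamp
      fun_prop
    exact hA.comp_continuous h fun p =>
      ⟨le_min (clamp_mem _).1 (clamp_mem _).1, min_le_right _ _, (clamp_mem _).2⟩
  · intro x t h0 h1 h2
    simp only
    rw [clamp_of_mem ⟨h0.trans h1, h2⟩, clamp_of_mem ⟨h0, h1.trans h2⟩, min_eq_left h1]

lemma volterra_congr {A A' : ℝ → ℝ → ℝ} {u u' : ℝ → ℝ}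
    (hA : ∀ x t, 0 ≤ t → t ≤ x → x ≤ π → A' x t = A x t) (hu : ∀ x ∈ Icc 0 π, u' x = u x)
    {x : ℝ} (hx : x ∈ Icc 0 π) : volterra A' u' x = volterra A u x := by
  rw [volterra, volterra, hu x hx]
  congr 1
  refine intervalIntegral.integral_congr fun s hs => ?_
  rw [uIcc_of_le hx.1] at hs
  rw [hA x s hs.1 hs.2 hx.2, hu s ⟨hs.1, hs.2.trans hx.2⟩]

lemma continuous_volterra {A : ℝ → ℝ → ℝ} {u : ℝ → ℝ} (hA : Continuous (Function.uncurry A))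
    (hu : Continuous u) : Continuous (volterra A u) := by
  unfold volterra
  refine hu.add ?_
  refine intervalIntegral.continuous_parametric_intervalIntegral_of_continuous
    (f := fun x s => A x s * u s) ?_ continuous_id
  exact Continuous.mul (by exact hA) (by fun_prop)

lemma continuousOn_volterra {A : ℝ → ℝ → ℝ} {u : ℝ → ℝ}
    (hA : ContinuousOn (fun p : ℝ × ℝ => A p.1 p.2) triangle)
    (hu : ContinuousOn u (Icc 0 π)) : ContinuousOn (volterra A u) (Icc 0 π) := by
  obtain ⟨A', hA', hAA⟩ := exists_continuous_extension_triangle hA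
  obtain ⟨u', hu', huu⟩ := exists_continuous_extension_Icc hu
  exact (continuous_volterra hA' hu').continuousOn.congr fun x hx =>
    (volterra_congr hAA huu hx).symm

lemma exists_bound_triangle {A : ℝ → ℝ → ℝ}
    (hA : ContinuousOn (fun p : ℝ × ℝ => A p.1 p.2) triangle) :
    ∃ M, 0 < M ∧ ∀ x t, 0 ≤ t → t ≤ x → x ≤ π → |A x t| ≤ M := by
  obtain ⟨A', hA', hAA⟩ := exists_continuous_extension_triangle hA
  obtain ⟨C, hC⟩ := (isCompact_Icc.prod isCompact_Icc).exists_bound_of_continuousOn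
    (hA'.continuousOn (s := Icc 0 π ×ˢ Icc 0 π))
  refine ⟨max C 1, by positivity, fun x t h0 h1 h2 => ?_⟩
  rw [← hAA x t h0 h1 h2]
  exact (hC (x, t) ⟨⟨h0.trans h1, h2⟩, ⟨h0, h1.trans h2⟩⟩).trans (le_max_left _ _)

lemma intervalIntegrable_volterra {A : ℝ → ℝ → ℝ} {u : ℝ → ℝ}
    (hA : ContinuousOn (fun p : ℝ × ℝ => A p.1 p.2) triangle)
    (hu : ContinuousOn u (Icc 0 π)) {x : ℝ} (hx : x ∈ Icc 0 π) :
    IntervalIntegrable (fun s => A x s * u s) volume 0 x := by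
  refine ContinuousOn.intervalIntegrable ?_
  rw [uIcc_of_le hx.1]
  have hAx : ContinuousOn (fun s => A x s) (Icc 0 x) :=
    hA.comp (f := fun s : ℝ => (x, s)) (by fun_prop) fun s hs => ⟨hs.1, hs.2, hx.2⟩
  exact hAx.mul (hu.mono (Icc_subset_Icc_right hx.2))

lemma volterra_add {A : ℝ → ℝ → ℝ} {u w : ℝ → ℝ}
    (hA : ContinuousOn (fun p : ℝ × ℝ => A p.1 p.2) triangle)
    (hu : ContinuousOn u (Icc 0 π)) (hw : ContinuousOn w (Icc 0 π)) {x : ℝ} (hx : x ∈ Icc 0 π) :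
    volterra A (fun s => u s + w s) x = volterra A u x + volterra A w x := by
  simp only [volterra, mul_add]
  rw [intervalIntegral.integral_add (intervalIntegrable_volterra hA hu hx)
    (intervalIntegrable_volterra hA hw hx)]
  ring

lemma volterra_const_mul {A : ℝ → ℝ → ℝ} {u : ℝ → ℝ} (a x : ℝ) :
    volterra A (fun s => a * u s) x = a * volterra A u x := by
  simp only [volterra, mul_left_comm _ a, intervalIntegral.integral_const_mul]
  ring

lemma volterra_sub {A : ℝ → ℝ → ℝ} {u w : ℝ → ℝ}
    (hA : ContinuousOn (fun p : ℝ × ℝ => A p.1 p.2) triangle)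
    (hu : ContinuousOn u (Icc 0 π)) (hw : ContinuousOn w (Icc 0 π)) {x : ℝ} (hx : x ∈ Icc 0 π) :
    volterra A (fun s => u s - w s) x = volterra A u x - volterra A w x := by
  simp only [volterra, mul_sub]
  rw [intervalIntegral.integral_sub (intervalIntegrable_volterra hA hu hx)
    (intervalIntegrable_volterra hA hw hx)]
  ring

lemma abs_volterra_le {A : ℝ → ℝ → ℝ} {u : ℝ → ℝ} {M B : ℝ}
    (hM : ∀ x t, 0 ≤ t → t ≤ x → x ≤ π → |A x t| ≤ M)
    (hB : ∀ x ∈ Icc 0 π, |u x| ≤ B) {x : ℝ} (hx : x ∈ Icc 0 π) :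
    |volterra A u x| ≤ (1 + π * M) * B := by
  have hM0 : 0 ≤ M := (abs_nonneg _).trans (hM 0 0 le_rfl le_rfl Real.pi_pos.le)
  have hB0 : 0 ≤ B := (abs_nonneg _).trans (hB x hx)
  have h1 : ‖∫ s in (0 : ℝ)..x, A x s * u s‖ ≤ (M * B) * |x - 0| := by
    refine intervalIntegral.norm_integral_le_of_norm_le_const fun s hs => ?_
    rw [uIoc_of_le hx.1] at hs
    rw [norm_mul]
    exact mul_le_mul (hM x s hs.1.le hs.2 hx.2) (hB s ⟨hs.1.le, hs.2.trans hx.2⟩) (norm_nonneg _)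
      hM0
  rw [sub_zero, abs_of_nonneg hx.1, Real.norm_eq_abs] at h1
  have h2 : M * B * x ≤ M * B * π := mul_le_mul_of_nonneg_left hx.2 (by positivity)
  rw [volterra]
  calc _ ≤ |u x| + |∫ s in (0 : ℝ)..x, A x s * u s| := abs_add_le _ _
    _ ≤ B + M * B * π := add_le_add (hB x hx) (h1.trans h2)
    _ = _ := by ring

/-- Fubini's theorem on the triangle `0 < s ≤ ξ ≤ x`. -/
lemma integral_triangle_swap {F : ℝ → ℝ → ℝ} {x : ℝ} (hx : 0 ≤ x)
    (hF : Integrable (Function.uncurry F)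
      ((volume.restrict (Ioc 0 x)).prod (volume.restrict (Ioc 0 x)))) :
    ∫ ξ in (0 : ℝ)..x, ∫ s in (0 : ℝ)..ξ, F ξ s = ∫ s in (0 : ℝ)..x, ∫ ξ in s..x, F ξ s := by
  have hms : MeasurableSet {p : ℝ × ℝ | p.2 ≤ p.1} := measurableSet_le measurable_snd measurable_fst
  have hI : Integrable (Function.uncurry fun ξ s => {p : ℝ × ℝ | p.2 ≤ p.1}.indicator
      (Function.uncurry F) (ξ, s))
      ((volume.restrict (Ioc 0 x)).prod (volume.restrict (Ioc 0 x))) := hF.indicator hms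
  have h := integral_integral_swap hI
  rw [intervalIntegral.integral_of_le hx, intervalIntegral.integral_of_le hx]
  have e1 : ∀ ξ ∈ Ioc 0 x, ∫ s in (0 : ℝ)..ξ, F ξ s
      = ∫ s in Ioc 0 x, {p : ℝ × ℝ | p.2 ≤ p.1}.indicator (Function.uncurry F) (ξ, s) := by
    intro ξ hξ
    rw [intervalIntegral.integral_of_le hξ.1.le]
    have : (fun s => {p : ℝ × ℝ | p.2 ≤ p.1}.indicator (Function.uncurry F) (ξ, s))
        = (Iic ξ).indicator (fun s => F ξ s) := by
      funext s
      simp [indicator_apply, Function.uncurry]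
    rw [this, setIntegral_indicator measurableSet_Iic]
    congr 2
    ext s
    simp only [mem_Ioc, mem_inter_iff, mem_Iic]
    constructor
    · rintro ⟨h1, h2⟩; exact ⟨⟨h1, h2.trans hξ.2⟩, h2⟩
    · rintro ⟨⟨h1, _⟩, h2⟩; exact ⟨h1, h2⟩
  have e2 : ∀ s ∈ Ioc 0 x, ∫ ξ in s..x, F ξ s
      = ∫ ξ in Ioc 0 x, {p : ℝ × ℝ | p.2 ≤ p.1}.indicator (Function.uncurry F) (ξ, s) := by
    intro s hs
    rw [intervalIntegral.integral_of_le hs.2]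
    have : (fun ξ => {p : ℝ × ℝ | p.2 ≤ p.1}.indicator (Function.uncurry F) (ξ, s))
        = (Ici s).indicator (fun ξ => F ξ s) := by
      funext ξ
      simp [indicator_apply, Function.uncurry]
    rw [this, setIntegral_indicator measurableSet_Ici]
    have : (Ioc 0 x ∩ Ici s : Set ℝ) = Icc s x := by
      ext ξ
      simp only [mem_Ioc, mem_inter_iff, mem_Ici, mem_Icc]
      constructor
      · rintro ⟨⟨_, h1⟩, h2⟩; exact ⟨h2, h1⟩
      · rintro ⟨h1, h2⟩; exact ⟨⟨hs.1.trans_le h1, h2⟩, h1⟩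
    rw [this, integral_Icc_eq_integral_Ioc]
  rw [setIntegral_congr_fun measurableSet_Ioc e1, setIntegral_congr_fun measurableSet_Ioc e2]
  exact h

lemma integrable_mul_continuous_prod {q : ℝ → ℝ} {F : ℝ × ℝ → ℝ} {a b c d : ℝ}
    (hq : IntegrableOn q (Ioc c d)) (hF : Continuous F) :
    Integrable (fun p : ℝ × ℝ => q p.2 * F p)
      ((volume.restrict (Ioc a b)).prod (volume.restrict (Ioc c d))) := by
  obtain ⟨C, hC⟩ := (isCompact_Icc.prod isCompact_Icc).exists_bound_of_continuousOn
    (hF.continuousOn (s := Icc a b ×ˢ Icc c d))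
  have h1 : Integrable (fun p : ℝ × ℝ => q p.2)
      ((volume.restrict (Ioc a b)).prod (volume.restrict (Ioc c d))) :=
    Integrable.comp_snd hq (volume.restrict (Ioc a b))
  refine h1.mul_bdd (c := C) hF.aestronglyMeasurable ?_
  rw [Measure.prod_restrict, ae_restrict_iff' (measurableSet_Ioc.prod measurableSet_Ioc)]
  exact Eventually.of_forall fun p hp =>
    hC p ⟨Ioc_subset_Icc_self hp.1, Ioc_subset_Icc_self hp.2⟩

/-- The potential is only integrable, but in the Duhamel-type formulas it enters as a factor
depending on the inner variable alone. Against a continuous `F`, this is enough for integrability on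
the product and leaves `q` outside the new inner integral. -/
lemma integral_triangle_swap_mul {q : ℝ → ℝ} {F : ℝ → ℝ → ℝ} {x : ℝ} (hx : x ∈ Icc 0 π)
    (hq : IntervalIntegrable q volume 0 π) (hF : Continuous (Function.uncurry F)) :
    ∫ ξ in (0 : ℝ)..x, ∫ s in (0 : ℝ)..ξ, q s * F ξ s
      = ∫ s in (0 : ℝ)..x, q s * ∫ ξ in s..x, F ξ s := by
  have hq' : IntegrableOn q (Ioc 0 x) :=
    ((intervalIntegrable_iff_integrableOn_Ioc_of_le Real.pi_pos.le).1 hq).mono_set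
      (Ioc_subset_Ioc_right hx.2)
  rw [integral_triangle_swap (F := fun ξ s => q s * F ξ s) hx.1
    (integrable_mul_continuous_prod hq' hF)]
  simp only [intervalIntegral.integral_const_mul]

/-! ### Weighted fixed points and the Volterra resolvent -/

/-- A version of the contraction principle for weighted supremum norms. -/
lemma exists_fixedPoint_of_weight {X : Type*} [TopologicalSpace X] [CompactSpace X]
    (Φ : C(X, ℝ) → C(X, ℝ)) (w : C(X, ℝ)) (hw : ∀ p, 0 < w p) {θ : ℝ} (hθ0 : 0 ≤ θ) (hθ : θ < 1)
    (h : ∀ (f g : C(X, ℝ)) (M : ℝ), 0 ≤ M → (∀ p, |f p - g p| ≤ M * w p) →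
      ∀ p, |Φ f p - Φ g p| ≤ θ * M * w p) : ∃ a, Φ a = a := by
  let wi : C(X, ℝ) := ⟨fun p => (w p)⁻¹, w.continuous.inv₀ fun p => (hw p).ne'⟩
  -- Conjugation by the weight turns the weighted estimate for `Φ` into an ordinary contraction in
  -- the supremum norm.
  let Ψ : C(X, ℝ) → C(X, ℝ) := fun b => wi * Φ (w * b)
  have hc : ContractingWith θ.toNNReal Ψ := by
    refine ⟨by rw [← NNReal.coe_lt_coe, Real.coe_toNNReal _ hθ0]; simpa using hθ, ?_⟩
    refine LipschitzWith.of_dist_le_mul fun b b' => ?_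
    rw [Real.coe_toNNReal _ hθ0, ContinuousMap.dist_le (by positivity)]
    intro p
    have h1 := h (w * b) (w * b') (dist b b') dist_nonneg (fun p => by
      simp only [ContinuousMap.mul_apply]
      rw [← mul_sub, abs_mul, abs_of_pos (hw p), mul_comm]
      exact mul_le_mul_of_nonneg_right
        ((Real.dist_eq _ _).symm.trans_le (ContinuousMap.dist_apply_le_dist p)) (hw p).le) p
    simp only [Ψ, wi, ContinuousMap.mul_apply, ContinuousMap.coe_mk, Real.dist_eq]
    rw [← mul_sub, abs_mul, abs_of_pos (inv_pos.2 (hw p)), inv_mul_le_iff₀ (hw p)]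
    linarith
  refine ⟨w * hc.fixedPoint Ψ, ?_⟩
  have h1 : wi * Φ (w * hc.fixedPoint Ψ) = hc.fixedPoint Ψ := hc.fixedPoint_isFixedPt
  nth_rewrite 2 [← h1]
  ext p
  simp only [wi, ContinuousMap.mul_apply, ContinuousMap.coe_mk]
  rw [mul_inv_cancel_left₀ (ne_of_gt (hw p))]

/-- Extension of a function on `[0, π]²` to the plane. -/
def squareExtend (f : C(Icc (0 : ℝ) π × Icc (0 : ℝ) π, ℝ)) (x t : ℝ) : ℝ :=
  f (⟨clamp x, clamp_mem x⟩, ⟨clamp t, clamp_mem t⟩)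

lemma continuous_squareExtend (f : C(Icc (0 : ℝ) π × Icc (0 : ℝ) π, ℝ)) :
    Continuous (Function.uncurry (squareExtend f)) := by
  refine f.continuous.comp (Continuous.prodMk ?_ ?_)
  · exact (continuous_clamp.comp continuous_fst).subtype_mk _
  · exact (continuous_clamp.comp continuous_snd).subtype_mk _

lemma squareExtend_coe (f : C(Icc (0 : ℝ) π × Icc (0 : ℝ) π, ℝ)) (p) :
    squareExtend f p.1 p.2 = f p := by
  obtain ⟨⟨x, hx⟩, ⟨t, ht⟩⟩ := p
  simp only [squareExtend, clamp_of_mem hx, clamp_of_mem ht]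

lemma integral_exp_le {l : ℝ} (hl : 0 < l) {a b : ℝ} :
    ∫ s in a..b, Real.exp (l * s) ≤ Real.exp (l * b) / l := by
  rw [intervalIntegral.integral_comp_mul_left (fun x => Real.exp x) hl.ne', integral_exp,
    smul_eq_mul, div_eq_inv_mul]
  refine mul_le_mul_of_nonneg_left ?_ (inv_pos.2 hl).le
  linarith [Real.exp_pos (l * a)]

/-- The resolvent kernel of a Volterra kernel. -/
lemma exists_resolvent {G : ℝ → ℝ → ℝ} (hG : Continuous (Function.uncurry G)) :
    ∃ K : ℝ → ℝ → ℝ, Continuous (Function.uncurry K) ∧ ∀ x t, 0 ≤ t → t ≤ x → x ≤ π →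
      K x t = - G x t - ∫ s in t..x, G x s * K s t := by
  obtain ⟨C, hC⟩ := (isCompact_Icc.prod isCompact_Icc).exists_bound_of_continuousOn
    (hG.continuousOn (s := Icc 0 π ×ˢ Icc 0 π))
  have hC0 : 0 ≤ C := (norm_nonneg _).trans
    (hC (0, 0) ⟨left_mem_Icc.2 Real.pi_pos.le, left_mem_Icc.2 Real.pi_pos.le⟩)
  -- Integrating the weight `exp (l x)` gains a factor `1 / l`, so the Lipschitz constant `C / l`
  -- drops below `1/2`.
  set l := 2 * (C + 1) with hl
  have hl0 : 0 < l := by positivity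
  -- The lower limit `min t x` makes the map well behaved on the whole square; it equals `t` on the
  -- triangle, the only place where the equation matters.
  have hcont : ∀ f : C(Icc (0 : ℝ) π × Icc (0 : ℝ) π, ℝ),
      Continuous fun p : Icc (0 : ℝ) π × Icc (0 : ℝ) π =>
        - G p.1 p.2 - ∫ s in (min (p.2 : ℝ) p.1)..p.1, G p.1 s * squareExtend f s p.2 := by
    intro f
    have h1 : Continuous fun p : Icc (0 : ℝ) π × Icc (0 : ℝ) π => G p.1 p.2 :=
      hG.comp (f := fun p : Icc (0 : ℝ) π × Icc (0 : ℝ) π => ((p.1 : ℝ), (p.2 : ℝ)))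
        (by fun_prop)
    have h2 : Continuous (Function.uncurry fun (p : Icc (0 : ℝ) π × Icc (0 : ℝ) π) (s : ℝ) =>
        G p.1 s * squareExtend f s p.2) := by
      refine Continuous.mul ?_ ?_
      · exact hG.comp (f := fun z : (Icc (0 : ℝ) π × Icc (0 : ℝ) π) × ℝ => ((z.1.1 : ℝ), z.2))
          (by fun_prop)
      · exact (continuous_squareExtend f).comp
          (f := fun z : (Icc (0 : ℝ) π × Icc (0 : ℝ) π) × ℝ => (z.2, (z.1.2 : ℝ))) (by fun_prop)
    have h3 : ∀ p : Icc (0 : ℝ) π × Icc (0 : ℝ) π,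
        ∫ s in (min (p.2 : ℝ) p.1)..p.1, G p.1 s * squareExtend f s p.2
          = (∫ s in (0 : ℝ)..p.1, G p.1 s * squareExtend f s p.2)
            - ∫ s in (0 : ℝ)..(min (p.2 : ℝ) p.1), G p.1 s * squareExtend f s p.2 := by
      intro p
      have h4 : Continuous fun s => G p.1 s * squareExtend f s p.2 :=
        h2.comp (f := fun s : ℝ => (p, s)) (by fun_prop)
      rw [intervalIntegral.integral_interval_sub_left (h4.intervalIntegrable _ _)
        (h4.intervalIntegrable _ _)]
    simp only [h3]
    refine h1.neg.sub (Continuous.sub ?_ ?_)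
    · exact intervalIntegral.continuous_parametric_intervalIntegral_of_continuous h2 (by fun_prop)
    · exact intervalIntegral.continuous_parametric_intervalIntegral_of_continuous h2 (by fun_prop)
  let Φ : C(Icc (0 : ℝ) π × Icc (0 : ℝ) π, ℝ) → C(Icc (0 : ℝ) π × Icc (0 : ℝ) π, ℝ) :=
    fun f => ⟨_, hcont f⟩
  let w : C(Icc (0 : ℝ) π × Icc (0 : ℝ) π, ℝ) :=
    ⟨fun p => Real.exp (l * p.1), by fun_prop⟩
  obtain ⟨f, hf⟩ := exists_fixedPoint_of_weight Φ w (fun p => Real.exp_pos _) (θ := 1 / 2)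
    (by norm_num) (by norm_num) (by
      intro f g M hM hfg p
      have hfg' : ∀ s ∈ Icc 0 π, |squareExtend f s p.2 - squareExtend g s p.2|
          ≤ M * Real.exp (l * s) := by
        intro s hs
        have := hfg (⟨s, hs⟩, p.2)
        rw [← squareExtend_coe f, ← squareExtend_coe g] at this
        exact this
      have hcs : ∀ f : C(Icc (0 : ℝ) π × Icc (0 : ℝ) π, ℝ),
          Continuous fun s => G p.1 s * squareExtend f s p.2 := by
        intro f
        refine Continuous.mul (hG.comp (f := fun s : ℝ => ((p.1 : ℝ), s)) (by fun_prop)) ?_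
        exact (continuous_squareExtend f).comp (f := fun s : ℝ => (s, (p.2 : ℝ))) (by fun_prop)
      have e : Φ f p - Φ g p = - ∫ s in (min (p.2 : ℝ) p.1)..p.1,
          (G p.1 s * squareExtend f s p.2 - G p.1 s * squareExtend g s p.2) := by
        rw [intervalIntegral.integral_sub ((hcs f).intervalIntegrable _ _)
          ((hcs g).intervalIntegrable _ _)]
        simp only [Φ, ContinuousMap.coe_mk]
        ring
      rw [e, abs_neg]
      have hle : min (p.2 : ℝ) p.1 ≤ p.1 := min_le_right _ _
      have hb : ‖∫ s in (min (p.2 : ℝ) p.1)..p.1,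
          (G p.1 s * squareExtend f s p.2 - G p.1 s * squareExtend g s p.2)‖
          ≤ ∫ s in (min (p.2 : ℝ) p.1)..p.1, C * M * Real.exp (l * s) := by
        refine intervalIntegral.norm_integral_le_of_norm_le hle ?_
          (by apply Continuous.intervalIntegrable; fun_prop)
        refine Eventually.of_forall fun s hs => ?_
        have hs' : s ∈ Icc 0 π :=
          ⟨(le_min p.2.2.1 p.1.2.1).trans hs.1.le, hs.2.trans p.1.2.2⟩
        rw [← mul_sub, norm_mul, mul_assoc]
        exact mul_le_mul (hC ((p.1 : ℝ), s) ⟨p.1.2, hs'⟩) (hfg' s hs') (norm_nonneg _) hC0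
      rw [intervalIntegral.integral_const_mul] at hb
      have hb2 := mul_le_mul_of_nonneg_left
        (integral_exp_le hl0 (a := min (p.2 : ℝ) p.1) (b := p.1)) (mul_nonneg hC0 hM)
      refine (hb.trans hb2).trans ?_
      simp only [w, ContinuousMap.coe_mk]
      rw [mul_div_assoc', div_le_iff₀ hl0, hl]
      have : 0 ≤ M * Real.exp (l * p.1) := by positivity
      nlinarith)
  refine ⟨squareExtend f, continuous_squareExtend f, fun x t h0 h1 h2 => ?_⟩
  have h3 := DFunLike.congr_fun hf (⟨x, h0.trans h1, h2⟩, ⟨t, h0, h1.trans h2⟩)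
  rw [← squareExtend_coe f] at h3
  simp only [Φ, ContinuousMap.coe_mk] at h3
  rw [min_eq_left h1] at h3
  exact h3.symm

/-- A Volterra operator with continuous kernel is injective on `C[0, π]`. -/
lemma eqOn_zero_of_volterra_eq_zero {G : ℝ → ℝ → ℝ}
    (hG : ContinuousOn (fun p : ℝ × ℝ => G p.1 p.2) triangle) {u : ℝ → ℝ}
    (hu : ContinuousOn u (Icc 0 π)) (h : ∀ x ∈ Icc 0 π, volterra G u x = 0) :
    ∀ x ∈ Icc 0 π, u x = 0 := by
  obtain ⟨M, hM0, hM⟩ := exists_bound_triangle hG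
  have key := eq_zero_of_le_integral_mul (f := fun x => |u x|) (g := fun _ => M) hu.abs
    (fun x _ => abs_nonneg _) intervalIntegrable_const (fun _ => hM0.le) ?_
  · exact fun x hx => abs_eq_zero.1 (key x hx)
  intro x hx
  have h1 := h x hx
  rw [volterra] at h1
  have h2 : |u x| = ‖∫ s in (0 : ℝ)..x, G x s * u s‖ := by
    rw [eq_neg_of_add_eq_zero_left h1, abs_neg, Real.norm_eq_abs]
  rw [h2]
  refine intervalIntegral.norm_integral_le_of_norm_le hx.1 ?_ ?_
  · refine Eventually.of_forall fun s hs => ?_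
    rw [norm_mul]
    exact mul_le_mul_of_nonneg_right (hM x s hs.1.le hs.2 hx.2) (norm_nonneg _)
  · refine ContinuousOn.intervalIntegrable ?_
    rw [uIcc_of_le hx.1]
    exact continuousOn_const.mul (hu.abs.mono (Icc_subset_Icc_right hx.2))

/-- A Volterra operator with continuous kernel has an inverse of the same form. -/
lemma exists_isInverseKernel {G : ℝ → ℝ → ℝ}
    (hG : ContinuousOn (fun p : ℝ × ℝ => G p.1 p.2) triangle) : ∃ K, IsInverseKernel G K := by
  obtain ⟨G', hG', hGG⟩ := exists_continuous_extension_triangle hG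
  obtain ⟨K, hK, hKe⟩ := exists_resolvent hG'
  have hKt : ContinuousOn (fun p : ℝ × ℝ => K p.1 p.2) triangle := hK.continuousOn
  have hright : ∀ u : ℝ → ℝ, ContinuousOn u (Icc 0 π) → ∀ x ∈ Icc 0 π,
      volterra G (volterra K u) x = u x := by
    intro u hu x hx
    obtain ⟨u', hu', huu⟩ := exists_continuous_extension_Icc hu
    rw [← volterra_congr hGG (u' := volterra K u')
      (fun y hy => volterra_congr (fun _ _ _ _ _ => rfl) huu hy) hx, ← huu x hx]
    simp only [volterra, mul_add]
    have hGx : Continuous fun s => G' x s := hG'.comp (f := fun s : ℝ => (x, s)) (by fun_prop)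
    have hKx : Continuous fun s => K x s := hK.comp (f := fun s : ℝ => (x, s)) (by fun_prop)
    have hinner : Continuous fun s => ∫ t in (0 : ℝ)..s, K s t * u' t := by
      refine intervalIntegral.continuous_parametric_intervalIntegral_of_continuous
        (f := fun x s => K x s * u' s) ?_ continuous_id
      exact Continuous.mul (by exact hK) (by fun_prop)
    have hGu : Continuous fun s => G' x s * u' s := hGx.mul hu'
    have hKu : Continuous fun s => K x s * u' s := hKx.mul hu'
    have hGi : Continuous fun s => G' x s * ∫ t in (0 : ℝ)..s, K s t * u' t := hGx.mul hinner
    rw [intervalIntegral.integral_add (hGu.intervalIntegrable _ _) (hGi.intervalIntegrable _ _)]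
    have e1 : ∫ s in (0 : ℝ)..x, G' x s * ∫ t in (0 : ℝ)..s, K s t * u' t
        = ∫ t in (0 : ℝ)..x, u' t * ∫ s in t..x, G' x s * K s t := by
      rw [← integral_triangle_swap_mul (F := fun s t => G' x s * K s t) hx
        (hu'.intervalIntegrable _ _) ?_]
      · refine intervalIntegral.integral_congr fun s _ => ?_
        rw [← intervalIntegral.integral_const_mul]
        refine intervalIntegral.integral_congr fun t _ => ?_
        ring
      · exact Continuous.mul (hGx.comp continuous_fst) hK
    -- The resolvent equation says that `∫ G K` over `[t, x]` is `-G - K`, which cancels the two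
    -- single integrals of `T (T⁻¹ u)`.
    have e2 : ∫ t in (0 : ℝ)..x, u' t * ∫ s in t..x, G' x s * K s t
        = ∫ t in (0 : ℝ)..x, (- (K x t * u' t) - G' x t * u' t) := by
      refine intervalIntegral.integral_congr fun t ht => ?_
      rw [uIcc_of_le hx.1] at ht
      rw [hKe x t ht.1 ht.2 hx.2]
      ring
    rw [e1, e2, intervalIntegral.integral_sub (hKu.fun_neg.intervalIntegrable _ _)
      (hGu.intervalIntegrable _ _), intervalIntegral.integral_neg]
    ring
  refine ⟨K, hKt, fun u hu x hx => ⟨?_, hright u hu x hx⟩⟩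
  -- The left inverse follows from the right one: `T` maps `K T u - u` (with `K` read as its
  -- Volterra operator) to zero, and `T` is injective.
  have hTu := continuousOn_volterra hG hu
  have hKTu := continuousOn_volterra hKt hTu
  have := eqOn_zero_of_volterra_eq_zero hG (u := fun s => volterra K (volterra G u) s - u s)
    (hKTu.sub hu) (fun y hy => by
      rw [volterra_sub hG hKTu hu hy, hright _ hTu y hy, sub_self]) x hx
  exact sub_eq_zero.1 this

/-! ### The Goursat problem and the Duhamel formula -/

/-- The integral of `a α (s - α)` over all `α` with `0 ≤ α ≤ ξ` and `0 ≤ s - α ≤ η`. -/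
def sliceIntegral (a : ℝ → ℝ → ℝ) (s ξ η : ℝ) : ℝ :=
  ∫ α in (max 0 (s - η))..(max (max 0 (s - η)) (min ξ s)), a α (s - α)

/-- Grouping the double integral of `q(α + β) a(α, β)` by `s = α + β` leaves the rough `q` as a
factor in one variable and everything else in a continuous function. The outer `max` in the upper
limit collapses the interval when no `α` is admissible, so both limits stay continuous. -/
lemma continuous_sliceIntegral {a : ℝ → ℝ → ℝ} (ha : Continuous (Function.uncurry a)) :
    Continuous fun z : (ℝ × ℝ) × ℝ => sliceIntegral a z.2 z.1.1 z.1.2 := by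
  have h2 : Continuous (Function.uncurry fun (z : (ℝ × ℝ) × ℝ) (α : ℝ) => a α (z.2 - α)) :=
    ha.comp (f := fun w : ((ℝ × ℝ) × ℝ) × ℝ => (w.2, w.1.2 - w.2)) (by fun_prop)
  have h3 : ∀ z : (ℝ × ℝ) × ℝ, sliceIntegral a z.2 z.1.1 z.1.2
      = (∫ α in (0 : ℝ)..(max (max 0 (z.2 - z.1.2)) (min z.1.1 z.2)), a α (z.2 - α))
        - ∫ α in (0 : ℝ)..(max 0 (z.2 - z.1.2)), a α (z.2 - α) := by
    intro z
    have h4 : Continuous fun α => a α (z.2 - α) := h2.comp (f := fun α : ℝ => (z, α)) (by fun_prop)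
    rw [intervalIntegral.integral_interval_sub_left (h4.intervalIntegrable _ _)
      (h4.intervalIntegrable _ _), sliceIntegral]
  simp only [h3]
  refine Continuous.sub ?_ ?_
  · exact intervalIntegral.continuous_parametric_intervalIntegral_of_continuous h2 (by fun_prop)
  · exact intervalIntegral.continuous_parametric_intervalIntegral_of_continuous h2 (by fun_prop)

/-- The weight `exp (l α)` depends on the variable of integration, so one integration gains `1 / l`.
This is the contraction estimate for the Goursat equation, uniform in `s`. -/
lemma abs_sliceIntegral_sub_le {a b : ℝ → ℝ → ℝ} (ha : Continuous (Function.uncurry a))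
    (hb : Continuous (Function.uncurry b)) {M l : ℝ} (hM : 0 ≤ M) (hl : 0 < l)
    (hab : ∀ α ∈ Icc 0 π, ∀ β ∈ Icc 0 π, |a α β - b α β| ≤ M * Real.exp (l * α))
    {s ξ η : ℝ} (hs : s ∈ Icc 0 π) :
    |sliceIntegral a s ξ η - sliceIntegral b s ξ η| ≤ M * (Real.exp (l * ξ) / l) := by
  have hca : Continuous fun α => a α (s - α) := ha.comp (f := fun α : ℝ => (α, s - α)) (by fun_prop)
  have hcb : Continuous fun α => b α (s - α) := hb.comp (f := fun α : ℝ => (α, s - α)) (by fun_prop)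
  rw [sliceIntegral, sliceIntegral, ← intervalIntegral.integral_sub (hca.intervalIntegrable _ _)
    (hcb.intervalIntegrable _ _)]
  rcases le_total (min ξ s) (max 0 (s - η)) with h | h
  · rw [max_eq_left h, intervalIntegral.integral_same, abs_zero]
    positivity
  rw [max_eq_right h]
  have h1 : ‖∫ α in (max 0 (s - η))..(min ξ s), (a α (s - α) - b α (s - α))‖
      ≤ ∫ α in (max 0 (s - η))..(min ξ s), M * Real.exp (l * α) := by
    refine intervalIntegral.norm_integral_le_of_norm_le h ?_
      (by apply Continuous.intervalIntegrable; fun_prop)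
    refine Eventually.of_forall fun α hα => ?_
    have h0 : 0 ≤ α := (le_max_left _ _).trans hα.1.le
    have h2 : α ≤ s := hα.2.trans (min_le_right _ _)
    exact hab α ⟨h0, h2.trans hs.2⟩ (s - α) ⟨by linarith, by linarith [hs.2]⟩
  rw [intervalIntegral.integral_const_mul] at h1
  refine h1.trans (mul_le_mul_of_nonneg_left ((integral_exp_le hl).trans ?_) hM)
  gcongr
  exact min_le_left _ _

/-- The Goursat problem for the kernel of the transmutation operator, in characteristic
coordinates. -/
lemma exists_goursat {q : ℝ → ℝ} (hq : IntervalIntegrable q volume 0 π) {b : ℝ → ℝ → ℝ}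
    (hb : ContinuousOn (Function.uncurry b) (Icc 0 π ×ˢ Icc 0 π)) :
    ∃ a : ℝ → ℝ → ℝ, Continuous (Function.uncurry a) ∧ ∀ ξ ∈ Icc 0 π, ∀ η ∈ Icc 0 π,
      a ξ η = b ξ η + ∫ s in (0 : ℝ)..π, q s * sliceIntegral a s ξ η := by
  set Q := ∫ s in (0 : ℝ)..π, |q s|
  have hQ0 : 0 ≤ Q := intervalIntegral.integral_nonneg Real.pi_pos.le fun s _ => abs_nonneg _
  -- The slices gain `1 / l` and the integration against `q` costs `Q`, so the contraction constant
  -- `Q / l` is below `1/2`.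
  set l := 2 * (Q + 1) with hl
  have hl0 : 0 < l := by positivity
  have hslice : ∀ {a : ℝ → ℝ → ℝ}, Continuous (Function.uncurry a) → ∀ ξ η,
      IntervalIntegrable (fun s => q s * sliceIntegral a s ξ η) volume 0 π := by
    intro a ha ξ η
    refine hq.mul_continuousOn (Continuous.continuousOn ?_)
    exact (continuous_sliceIntegral ha).comp (f := fun s : ℝ => ((ξ, η), s)) (by fun_prop)
  have hcont : ∀ f : C(Icc (0 : ℝ) π × Icc (0 : ℝ) π, ℝ),
      Continuous fun p : Icc (0 : ℝ) π × Icc (0 : ℝ) π =>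
        b p.1 p.2 + ∫ s in (0 : ℝ)..π, q s * sliceIntegral (squareExtend f) s p.1 p.2 := by
    intro f
    have hsc := continuous_sliceIntegral (continuous_squareExtend f)
    obtain ⟨C, hC⟩ := ((isCompact_Icc.prod isCompact_Icc).prod isCompact_Icc).exists_bound_of_continuousOn
      (hsc.continuousOn (s := (Icc 0 π ×ˢ Icc 0 π) ×ˢ Icc 0 π))
    refine Continuous.add ?_ ?_
    · exact hb.comp_continuous
        (f := fun p : Icc (0 : ℝ) π × Icc (0 : ℝ) π => ((p.1 : ℝ), (p.2 : ℝ))) (by fun_prop)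
        fun p => ⟨p.1.2, p.2.2⟩
    · refine intervalIntegral.continuous_of_dominated_interval (bound := fun s => |q s| * C) ?_ ?_
        (hq.abs.mul_const C) ?_
      · intro p
        rw [uIoc_of_le Real.pi_pos.le]
        exact (hslice (continuous_squareExtend f) p.1 p.2).1.aestronglyMeasurable
      · intro p
        refine Eventually.of_forall fun s hs => ?_
        rw [uIoc_of_le Real.pi_pos.le] at hs
        rw [norm_mul]
        exact mul_le_mul_of_nonneg_left
          (hC ((p.1, p.2), s) ⟨⟨p.1.2, p.2.2⟩, Ioc_subset_Icc_self hs⟩) (norm_nonneg _)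
      · refine Eventually.of_forall fun s _ => continuous_const.mul ?_
        exact hsc.comp
          (f := fun p : Icc (0 : ℝ) π × Icc (0 : ℝ) π => (((p.1 : ℝ), (p.2 : ℝ)), s)) (by fun_prop)
  let Φ : C(Icc (0 : ℝ) π × Icc (0 : ℝ) π, ℝ) → C(Icc (0 : ℝ) π × Icc (0 : ℝ) π, ℝ) :=
    fun f => ⟨_, hcont f⟩
  let w : C(Icc (0 : ℝ) π × Icc (0 : ℝ) π, ℝ) :=
    ⟨fun p => Real.exp (l * p.1), by fun_prop⟩
  obtain ⟨f, hf⟩ := exists_fixedPoint_of_weight Φ w (fun p => Real.exp_pos _) (θ := 1 / 2)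
    (by norm_num) (by norm_num) (by
      intro f g M hM hfg p
      have hfg' : ∀ α ∈ Icc 0 π, ∀ β ∈ Icc 0 π, |squareExtend f α β - squareExtend g α β|
          ≤ M * Real.exp (l * α) := by
        intro α hα β hβ
        have := hfg (⟨α, hα⟩, ⟨β, hβ⟩)
        rw [← squareExtend_coe f, ← squareExtend_coe g] at this
        exact this
      have e : Φ f p - Φ g p = ∫ s in (0 : ℝ)..π, (q s * sliceIntegral (squareExtend f) s p.1 p.2
          - q s * sliceIntegral (squareExtend g) s p.1 p.2) := by
        rw [intervalIntegral.integral_sub (hslice (continuous_squareExtend f) _ _)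
          (hslice (continuous_squareExtend g) _ _)]
        simp only [Φ, ContinuousMap.coe_mk]
        ring
      rw [e]
      have hb : ‖∫ s in (0 : ℝ)..π, (q s * sliceIntegral (squareExtend f) s p.1 p.2
          - q s * sliceIntegral (squareExtend g) s p.1 p.2)‖
          ≤ ∫ s in (0 : ℝ)..π, |q s| * (M * (Real.exp (l * p.1) / l)) := by
        refine intervalIntegral.norm_integral_le_of_norm_le Real.pi_pos.le ?_ (hq.abs.mul_const _)
        refine Eventually.of_forall fun s hs => ?_
        rw [← mul_sub, norm_mul]
        exact mul_le_mul_of_nonneg_left (abs_sliceIntegral_sub_le (continuous_squareExtend f)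
          (continuous_squareExtend g) hM hl0 hfg' (Ioc_subset_Icc_self hs)) (norm_nonneg _)
      rw [intervalIntegral.integral_mul_const] at hb
      refine hb.trans ?_
      simp only [w, ContinuousMap.coe_mk]
      rw [mul_div_assoc', mul_div_assoc', div_le_iff₀ hl0, hl]
      have : 0 ≤ M * Real.exp (l * p.1) := by positivity
      nlinarith)
  refine ⟨squareExtend f, continuous_squareExtend f, fun ξ hξ η hη => ?_⟩
  have h3 := DFunLike.congr_fun hf (⟨ξ, hξ⟩, ⟨η, hη⟩)
  rw [← squareExtend_coe f] at h3
  exact h3.symm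

/-- Interchange of integrations over the parallelogram `0 ≤ α ≤ s`, `α ≤ ξ ≤ α + x - s`. -/
lemma integral_mul_sliceIntegral {a : ℝ → ℝ → ℝ} (ha : Continuous (Function.uncurry a))
    {C : ℝ → ℝ} (hC : Continuous C) {s x : ℝ} (hs : 0 ≤ s) (hsx : s ≤ x) :
    ∫ ξ in (0 : ℝ)..x, C ξ * sliceIntegral a s ξ (x - ξ)
      = ∫ α in (0 : ℝ)..s, a α (s - α) * ∫ ξ in α..(α + x - s), C ξ := by
  have hx : 0 ≤ x := hs.trans hsx
  have hca : Continuous fun α => a α (s - α) := ha.comp (f := fun α : ℝ => (α, s - α)) (by fun_prop)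
  -- With `η = x - ξ` the constraint `s - α ≤ η` reads `ξ ≤ α + x - s`, so for fixed `α` the
  -- variable `ξ` runs over an interval of length `x - s` independent of `α`.
  set S : Set (ℝ × ℝ) := {p | p.2 ≤ p.1 ∧ p.1 ≤ p.2 + x - s} with hS
  have hSm : MeasurableSet S := by
    refine MeasurableSet.inter ?_ ?_
    · exact measurableSet_le measurable_snd measurable_fst
    · exact measurableSet_le measurable_fst (by fun_prop)
  let F : ℝ → ℝ → ℝ := fun ξ α => S.indicator (fun p => C p.1 * a p.2 (s - p.2)) (ξ, α)
  have hI : Integrable (Function.uncurry F)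
      ((volume.restrict (Ioc 0 x)).prod (volume.restrict (Ioc 0 s))) := by
    have h1 : Continuous fun p : ℝ × ℝ => C p.1 * a p.2 (s - p.2) :=
      (hC.comp continuous_fst).mul (hca.comp continuous_snd)
    have h2 := integrable_mul_continuous_prod (q := fun _ => 1) (a := 0) (b := x) (c := 0) (d := s)
      (by simp) h1
    simp only [one_mul] at h2
    exact h2.indicator hSm
  have h := integral_integral_swap hI
  rw [intervalIntegral.integral_of_le hx, intervalIntegral.integral_of_le hs]
  have e1 : ∀ ξ ∈ Ioc 0 x, C ξ * sliceIntegral a s ξ (x - ξ) = ∫ α in Ioc 0 s, F ξ α := by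
    intro ξ hξ
    have hlo : max 0 (s - (x - ξ)) ≤ min ξ s := by
      refine max_le (le_min hξ.1.le hs) (le_min ?_ ?_)
      · linarith
      · linarith [hξ.2]
    rw [sliceIntegral, max_eq_right hlo, ← intervalIntegral.integral_const_mul,
      intervalIntegral.integral_of_le hlo, ← integral_Icc_eq_integral_Ioc,
      ← integral_Icc_eq_integral_Ioc]
    have : (fun α => F ξ α) = (Icc (s - (x - ξ)) ξ).indicator fun α => C ξ * a α (s - α) := by
      funext α
      simp only [F, indicator_apply, hS, mem_ofPred_eq, mem_Icc]
      congr 1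
      apply propext
      constructor
      · rintro ⟨h1, h2⟩; exact ⟨by linarith, h1⟩
      · rintro ⟨h1, h2⟩; exact ⟨h2, by linarith⟩
    rw [this, setIntegral_indicator measurableSet_Icc, Icc_inter_Icc, min_comm s ξ]
  have e2 : ∀ α ∈ Ioc 0 s, a α (s - α) * ∫ ξ in α..(α + x - s), C ξ = ∫ ξ in Ioc 0 x, F ξ α := by
    intro α hα
    have hle : α ≤ α + x - s := by linarith
    rw [← intervalIntegral.integral_const_mul, intervalIntegral.integral_of_le hle,
      ← integral_Icc_eq_integral_Ioc, ← integral_Icc_eq_integral_Ioc]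
    have : (fun ξ => F ξ α) = (Icc α (α + x - s)).indicator fun ξ => a α (s - α) * C ξ := by
      funext ξ
      simp only [F, indicator_apply, hS, mem_ofPred_eq, mem_Icc, mul_comm]
    rw [this, setIntegral_indicator measurableSet_Icc, Icc_inter_Icc, max_eq_right hα.1.le,
      min_eq_right (by linarith [hα.2])]
  rw [setIntegral_congr_fun measurableSet_Ioc e1, setIntegral_congr_fun measurableSet_Ioc e2]
  exact h

/-- From `α ≤ ξ` and `s - α ≤ x - ξ` follows `s ≤ x`. Hence the integral over `s` up to `π` in the
Goursat equation really stops at `x`. -/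
lemma sliceIntegral_eq_zero {a : ℝ → ℝ → ℝ} {s ξ x : ℝ} (h : x ≤ s) :
    sliceIntegral a s ξ (x - ξ) = 0 := by
  have h1 : min ξ s ≤ max 0 (s - (x - ξ)) :=
    (min_le_left _ _).trans ((by linarith : ξ ≤ s - (x - ξ)).trans (le_max_right _ _))
  rw [sliceIntegral, max_eq_left h1, intervalIntegral.integral_same]

/-- The action of the transmutation operator on `C` in characteristic coordinates. -/
def characteristicTransform (a : ℝ → ℝ → ℝ) (C : ℝ → ℝ) (x : ℝ) : ℝ :=
  C x + ∫ ξ in (0 : ℝ)..x, a ξ (x - ξ) * C (2 * ξ - x)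

lemma continuous_characteristicTransform {a : ℝ → ℝ → ℝ} (ha : Continuous (Function.uncurry a))
    {C : ℝ → ℝ} (hC : Continuous C) : Continuous (characteristicTransform a C) := by
  refine hC.add (intervalIntegral.continuous_parametric_intervalIntegral_of_continuous
    (f := fun x ξ => a ξ (x - ξ) * C (2 * ξ - x)) ?_ continuous_id)
  exact (ha.comp (f := fun p : ℝ × ℝ => (p.2, p.1 - p.2)) (by fun_prop)).mul
    (hC.comp (by fun_prop))

/-- Each part of the Goursat equation is integrated against `C (2ξ - x)`. The constant `h` yields `h
S(x)`; each boundary integral of `q` yields half of `∫ q(s) S(x - s) C(s)`; the double integral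
yields `∫ q(s) S(x - s)` times the integral part of the transform at `s`. The hypothesis `hCS` is
the sum-to-product identity that makes the `ξ`-integral factor. The pairs `(1, x)` and `(cos ρx, sin
ρx / ρ)` are the intended `(C, S)`. -/
lemma characteristicTransform_eq {q : ℝ → ℝ} (hq : IntervalIntegrable q volume 0 π) {h : ℝ}
    {a : ℝ → ℝ → ℝ} (ha : Continuous (Function.uncurry a))
    (hae : ∀ ξ ∈ Icc 0 π, ∀ η ∈ Icc 0 π,
      a ξ η = (h + (1 / 2) * (∫ s in (0 : ℝ)..ξ, q s) + (1 / 2) * ∫ s in (0 : ℝ)..η, q s)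
        + ∫ s in (0 : ℝ)..π, q s * sliceIntegral a s ξ η)
    {C S : ℝ → ℝ} (hC : Continuous C) (hS : Continuous S) (hCeven : ∀ x, C (-x) = C x) (hC0 : C 0 = 1)
    (hCS : ∀ a b x, ∫ ξ in a..b, C (2 * ξ - x) = S (b - a) * C (a + b - x))
    {x : ℝ} (hx : x ∈ Icc 0 π) :
    characteristicTransform a C x
      = C x + h * S x + ∫ s in (0 : ℝ)..x, q s * (S (x - s) * characteristicTransform a C s) := by
  have hqx : IntervalIntegrable q volume 0 x :=
    intervalIntegrable_mono_Icc hq (left_mem_Icc.2 Real.pi_pos.le) hx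
  have hCx : Continuous fun ξ => C (2 * ξ - x) := hC.comp (by fun_prop)
  have hprim : ContinuousOn (fun ξ => ∫ s in (0 : ℝ)..ξ, q s) (Icc 0 x) :=
    (continuousOn_primitive hq).mono (Icc_subset_Icc_right hx.2)
  have hprim' : ContinuousOn (fun ξ => ∫ s in (0 : ℝ)..(x - ξ), q s) (Icc 0 x) :=
    hprim.comp (f := fun ξ : ℝ => x - ξ) (by fun_prop)
      fun ξ hξ => ⟨by linarith [hξ.2], by linarith [hξ.1]⟩
  -- the three parts of the kernel
  have p0 : ∫ ξ in (0 : ℝ)..x, h * C (2 * ξ - x) = h * S x := by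
    rw [intervalIntegral.integral_const_mul, hCS, sub_zero, zero_add, sub_self, hC0, mul_one]
  have p1 : ∫ ξ in (0 : ℝ)..x, (∫ s in (0 : ℝ)..ξ, q s) * C (2 * ξ - x)
      = ∫ s in (0 : ℝ)..x, q s * (S (x - s) * C s) := by
    have := integral_triangle_swap_mul (F := fun ξ _ => C (2 * ξ - x)) hx hq
      (hCx.comp continuous_fst)
    simp only [intervalIntegral.integral_mul_const] at this
    rw [this]
    refine intervalIntegral.integral_congr fun s _ => ?_
    rw [hCS, add_sub_cancel_right]
  have p2 : ∫ ξ in (0 : ℝ)..x, (∫ s in (0 : ℝ)..(x - ξ), q s) * C (2 * ξ - x)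
      = ∫ s in (0 : ℝ)..x, q s * (S (x - s) * C s) := by
    rw [← p1]
    have := intervalIntegral.integral_comp_sub_left (a := 0) (b := x)
      (fun ξ => (∫ s in (0 : ℝ)..ξ, q s) * C (2 * ξ - x)) x
    rw [sub_zero, sub_self] at this
    rw [← this]
    refine intervalIntegral.integral_congr fun ξ _ => ?_
    rw [← hCeven (2 * ξ - x)]
    congr 2
    ring
  have hslc : Continuous fun p : ℝ × ℝ => C (2 * p.1 - x) * sliceIntegral a p.2 p.1 (x - p.1) :=
    (hCx.comp continuous_fst).mul ((continuous_sliceIntegral ha).comp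
      (f := fun p : ℝ × ℝ => ((p.1, x - p.1), p.2)) (by fun_prop))
  have hqI : IntegrableOn q (Ioc 0 π) :=
    (intervalIntegrable_iff_integrableOn_Ioc_of_le Real.pi_pos.le).1 hq
  have hprod := integrable_mul_continuous_prod (a := 0) (b := x) hqI hslc
  have p3 : ∫ ξ in (0 : ℝ)..x, (∫ s in (0 : ℝ)..π, q s * sliceIntegral a s ξ (x - ξ))
        * C (2 * ξ - x)
      = ∫ s in (0 : ℝ)..x, q s * (S (x - s) * ∫ α in (0 : ℝ)..s, a α (s - α) * C (2 * α - s)) := by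
    have e1 : ∫ ξ in (0 : ℝ)..x, (∫ s in (0 : ℝ)..π, q s * sliceIntegral a s ξ (x - ξ))
        * C (2 * ξ - x)
        = ∫ s in (0 : ℝ)..π, q s * ∫ ξ in (0 : ℝ)..x, C (2 * ξ - x) * sliceIntegral a s ξ (x - ξ) := by
      have h1 := integral_integral_swap
        (f := fun ξ s => q s * (C (2 * ξ - x) * sliceIntegral a s ξ (x - ξ))) hprod
      simp only [intervalIntegral.integral_of_le hx.1, intervalIntegral.integral_of_le
        Real.pi_pos.le, ← integral_const_mul, ← integral_mul_const]
      rw [← h1]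
      refine integral_congr_ae (Eventually.of_forall fun ξ => ?_)
      refine integral_congr_ae (Eventually.of_forall fun s => ?_)
      simp only
      ring
    have hint : IntervalIntegrable (fun s => q s *
        ∫ ξ in (0 : ℝ)..x, C (2 * ξ - x) * sliceIntegral a s ξ (x - ξ)) volume 0 π := by
      rw [intervalIntegrable_iff_integrableOn_Ioc_of_le Real.pi_pos.le]
      refine (hprod.integral_prod_right).congr (Eventually.of_forall fun s => ?_)
      simp only [integral_const_mul, intervalIntegral.integral_of_le hx.1]
    rw [e1, ← intervalIntegral.integral_add_adjacent_intervals
      (intervalIntegrable_mono_Icc hint (left_mem_Icc.2 Real.pi_pos.le) hx)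
      (intervalIntegrable_mono_Icc hint hx (right_mem_Icc.2 Real.pi_pos.le))]
    have e2 : ∫ s in x..π, q s * ∫ ξ in (0 : ℝ)..x, C (2 * ξ - x) * sliceIntegral a s ξ (x - ξ)
        = 0 := by
      rw [intervalIntegral.integral_congr (g := fun _ => 0), intervalIntegral.integral_zero]
      intro s hs
      rw [uIcc_of_le hx.2] at hs
      simp only [sliceIntegral_eq_zero hs.1, mul_zero, intervalIntegral.integral_zero]
    rw [e2, add_zero]
    refine intervalIntegral.integral_congr fun s hs => ?_
    rw [uIcc_of_le hx.1] at hs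
    rw [integral_mul_sliceIntegral ha hCx hs.1 hs.2, ← intervalIntegral.integral_const_mul (S (x - s))]
    congr 1
    refine intervalIntegral.integral_congr fun α _ => ?_
    rw [hCS, show α + x - s - α = x - s by ring, show α + (α + x - s) - x = 2 * α - s by ring]
    ring
  -- assembling
  have i0 : IntervalIntegrable (fun ξ => h * C (2 * ξ - x)) volume 0 x := by
    apply Continuous.intervalIntegrable; fun_prop
  have i1 : IntervalIntegrable (fun ξ => (∫ s in (0 : ℝ)..ξ, q s) * C (2 * ξ - x)) volume 0 x := by
    refine ContinuousOn.intervalIntegrable ?_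
    rw [uIcc_of_le hx.1]
    exact hprim.mul hCx.continuousOn
  have i2 : IntervalIntegrable (fun ξ => (∫ s in (0 : ℝ)..(x - ξ), q s) * C (2 * ξ - x))
      volume 0 x := by
    refine ContinuousOn.intervalIntegrable ?_
    rw [uIcc_of_le hx.1]
    exact hprim'.mul hCx.continuousOn
  have i3 : IntervalIntegrable (fun ξ => (∫ s in (0 : ℝ)..π, q s * sliceIntegral a s ξ (x - ξ))
        * C (2 * ξ - x)) volume 0 x := by
    rw [intervalIntegrable_iff_integrableOn_Ioc_of_le hx.1]
    refine (hprod.integral_prod_left).congr (Eventually.of_forall fun ξ => ?_)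
    simp only [intervalIntegral.integral_of_le Real.pi_pos.le, ← integral_mul_const]
    refine integral_congr_ae (Eventually.of_forall fun s => ?_)
    simp only
    ring
  have e : ∫ ξ in (0 : ℝ)..x, a ξ (x - ξ) * C (2 * ξ - x)
      = ∫ ξ in (0 : ℝ)..x, (h * C (2 * ξ - x)
        + (1 / 2) * ((∫ s in (0 : ℝ)..ξ, q s) * C (2 * ξ - x))
        + (1 / 2) * ((∫ s in (0 : ℝ)..(x - ξ), q s) * C (2 * ξ - x))
        + (∫ s in (0 : ℝ)..π, q s * sliceIntegral a s ξ (x - ξ)) * C (2 * ξ - x)) := by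
    refine intervalIntegral.integral_congr fun ξ hξ => ?_
    rw [uIcc_of_le hx.1] at hξ
    rw [hae ξ ⟨hξ.1, hξ.2.trans hx.2⟩ (x - ξ) ⟨by linarith [hξ.2], by linarith [hξ.1, hx.2]⟩]
    ring
  rw [characteristicTransform, e, intervalIntegral.integral_add
    ((i0.add (i1.const_mul _)).add (i2.const_mul _)) i3, intervalIntegral.integral_add
    (i0.add (i1.const_mul _)) (i2.const_mul _), intervalIntegral.integral_add i0 (i1.const_mul _),
    intervalIntegral.integral_const_mul (1 / 2 : ℝ), intervalIntegral.integral_const_mul (1 / 2 : ℝ),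
    p0, p1, p2, p3]
  simp only [characteristicTransform, mul_add]
  have hSx : Continuous fun s => S (x - s) := hS.comp (by fun_prop)
  have hInt : Continuous fun s => ∫ α in (0 : ℝ)..s, a α (s - α) * C (2 * α - s) := by
    have h1 := (continuous_characteristicTransform ha hC).sub hC
    refine h1.congr fun s => ?_
    simp [characteristicTransform]
  rw [intervalIntegral.integral_add (hqx.mul_continuousOn (by exact (hSx.mul hC).continuousOn))
    (hqx.mul_continuousOn (by exact (hSx.mul hInt).continuousOn))]
  ring

/-- The transmutation kernel obtained from the solution of the Goursat problem. -/
def goursatKernel (a : ℝ → ℝ → ℝ) (x t : ℝ) : ℝ :=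
  (1 / 2) * (a ((x + t) / 2) ((x - t) / 2) + a ((x - t) / 2) ((x + t) / 2))

lemma continuous_goursatKernel {a : ℝ → ℝ → ℝ} (ha : Continuous (Function.uncurry a)) :
    Continuous (Function.uncurry (goursatKernel a)) := by
  refine continuous_const.mul (Continuous.add ?_ ?_)
  · exact ha.comp (f := fun p : ℝ × ℝ => ((p.1 + p.2) / 2, (p.1 - p.2) / 2)) (by fun_prop)
  · exact ha.comp (f := fun p : ℝ × ℝ => ((p.1 - p.2) / 2, (p.1 + p.2) / 2)) (by fun_prop)

/-- The line `ξ + η = x` is folded at its midpoint by `t = |2ξ - x|`, which is harmless for an even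
`C`. Folding explains the symmetrisation in `goursatKernel`, and the Jacobian its factor `1/2`. -/
lemma volterra_goursatKernel {a : ℝ → ℝ → ℝ} (ha : Continuous (Function.uncurry a)) {C : ℝ → ℝ}
    (hC : Continuous C) (hCeven : ∀ x, C (-x) = C x) (x : ℝ) :
    volterra (goursatKernel a) C x = characteristicTransform a C x := by
  rw [volterra, characteristicTransform]
  congr 1
  have hc : Continuous fun ξ => a ξ (x - ξ) * C (2 * ξ - x) :=
    (ha.comp (f := fun ξ : ℝ => (ξ, x - ξ)) (by fun_prop)).mul (hC.comp (by fun_prop))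
  have h1 : ∫ ξ in (x / 2)..x, a ξ (x - ξ) * C (2 * ξ - x)
      = (1 / 2) * ∫ t in (0 : ℝ)..x, a ((x + t) / 2) ((x - t) / 2) * C t := by
    have := intervalIntegral.integral_comp_mul_sub (a := x / 2) (b := x)
      (fun t => a ((x + t) / 2) ((x - t) / 2) * C t) (two_ne_zero (α := ℝ)) x
    rw [show 2 * (x / 2) - x = 0 by ring, show 2 * x - x = x by ring, smul_eq_mul] at this
    rw [← inv_eq_one_div, ← this]
    refine intervalIntegral.integral_congr fun ξ _ => ?_
    ring_nf
  have h2 : ∫ ξ in (0 : ℝ)..(x / 2), a ξ (x - ξ) * C (2 * ξ - x)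
      = (1 / 2) * ∫ t in (0 : ℝ)..x, a ((x - t) / 2) ((x + t) / 2) * C t := by
    have := intervalIntegral.integral_comp_sub_mul (a := 0) (b := x / 2)
      (fun t => a ((x - t) / 2) ((x + t) / 2) * C t) (two_ne_zero (α := ℝ)) x
    rw [show x - 2 * (x / 2) = 0 by ring, mul_zero, sub_zero, smul_eq_mul] at this
    rw [← inv_eq_one_div, ← this]
    refine intervalIntegral.integral_congr fun ξ _ => ?_
    rw [← hCeven (2 * ξ - x)]
    ring_nf
  rw [← intervalIntegral.integral_add_adjacent_intervals (hc.intervalIntegrable 0 (x / 2))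
    (hc.intervalIntegrable (x / 2) x), h1, h2, ← mul_add, ← intervalIntegral.integral_add,
    ← intervalIntegral.integral_const_mul]
  · refine intervalIntegral.integral_congr fun t _ => ?_
    rw [goursatKernel]
    ring
  · apply Continuous.intervalIntegrable
    exact (ha.comp (f := fun t : ℝ => ((x - t) / 2, (x + t) / 2)) (by fun_prop)).mul hC
  · apply Continuous.intervalIntegrable
    exact (ha.comp (f := fun t : ℝ => ((x + t) / 2, (x - t) / 2)) (by fun_prop)).mul hC

lemma integral_integral_eq_integral_sub_mul {w : ℝ → ℝ} (hw : IntervalIntegrable w volume 0 π)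
    {x : ℝ} (hx : x ∈ Icc 0 π) :
    ∫ s in (0 : ℝ)..x, ∫ r in (0 : ℝ)..s, w r = ∫ s in (0 : ℝ)..x, (x - s) * w s := by
  have := integral_triangle_swap_mul (F := fun _ _ => 1) hx hw continuous_const
  simp only [mul_one, intervalIntegral.integral_const, smul_eq_mul] at this
  rw [this]
  simp only [mul_comm]

/-- Convolving the Duhamel formula with `x` and using `μ (x * S) = x - S` replaces the kernel `S(x -
s)` by `x - s`. The result is the twice integrated equation with data `1` and `h`, obtained without
differentiating an integral that contains the rough `q`. -/
lemma integral_sub_mul_eq_of_duhamel {q : ℝ → ℝ} (hq : IntervalIntegrable q volume 0 π)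
    {h μ : ℝ} {C S v : ℝ → ℝ} (hC : Continuous C) (hS : Continuous S)
    (hC2 : ∀ x, C x = 1 - μ * ∫ r in (0 : ℝ)..x, (x - r) * C r)
    (hS2 : ∀ x, S x = x - μ * ∫ r in (0 : ℝ)..x, (x - r) * S r)
    (hv : Continuous v)
    (hve : ∀ x ∈ Icc 0 π, v x = C x + h * S x + ∫ s in (0 : ℝ)..x, q s * (S (x - s) * v s))
    {x : ℝ} (hx : x ∈ Icc 0 π) :
    v x = 1 + h * x + ∫ s in (0 : ℝ)..x, (x - s) * (q s * v s - μ * v s) := by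
  have hqv : IntervalIntegrable (fun s => q s * v s) volume 0 π :=
    hq.mul_continuousOn hv.continuousOn
  have h0 : (0 : ℝ) ∈ Icc 0 π := left_mem_Icc.2 Real.pi_pos.le
  have hqvx := intervalIntegrable_mono_Icc hqv h0 hx
  have hJ : ∫ r in (0 : ℝ)..x, (x - r) * ∫ s in (0 : ℝ)..r, q s * (S (r - s) * v s)
      = ∫ s in (0 : ℝ)..x, q s * v s * ∫ r in s..x, (x - r) * S (r - s) := by
    rw [← integral_triangle_swap_mul (F := fun r s => (x - r) * S (r - s)) hx hqv ?_]
    · refine intervalIntegral.integral_congr fun r _ => ?_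
      rw [← intervalIntegral.integral_const_mul]
      refine intervalIntegral.integral_congr fun s _ => ?_
      ring
    · have : Continuous fun p : ℝ × ℝ => S (p.1 - p.2) := hS.comp (by fun_prop)
      exact Continuous.mul (by fun_prop) this
  have hin : ∀ s, μ * ∫ r in s..x, (x - r) * S (r - s) = (x - s) - S (x - s) := by
    intro s
    have := intervalIntegral.integral_comp_sub_right (a := s) (b := x)
      (fun r => (x - s - r) * S r) s
    rw [sub_self] at this
    rw [hS2 (x - s), ← this]
    simp only [sub_sub_sub_cancel_right]
    ring
  have hJ2 : μ * ∫ r in (0 : ℝ)..x, (x - r) * ∫ s in (0 : ℝ)..r, q s * (S (r - s) * v s)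
      = (∫ s in (0 : ℝ)..x, (x - s) * (q s * v s)) - ∫ s in (0 : ℝ)..x, q s * (S (x - s) * v s) := by
    rw [hJ, ← intervalIntegral.integral_const_mul, ← intervalIntegral.integral_sub]
    · refine intervalIntegral.integral_congr fun s _ => ?_
      rw [mul_left_comm, hin]
      ring
    · exact hqvx.continuousOn_mul (by fun_prop)
    · have : Continuous fun s => S (x - s) := hS.comp (by fun_prop)
      exact (intervalIntegrable_mono_Icc hq h0 hx).mul_continuousOn
        (by exact (this.mul hv).continuousOn)
  have hcontI : IntervalIntegrable
      (fun r => (x - r) * ∫ s in (0 : ℝ)..r, q s * (S (r - s) * v s)) volume 0 x := by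
    refine ContinuousOn.intervalIntegrable ?_
    rw [uIcc_of_le hx.1]
    have : ContinuousOn (fun r => (x - r) * (v r - C r - h * S r)) (Icc 0 x) := by fun_prop
    refine this.congr fun r hr => ?_
    simp only
    rw [hve r ⟨hr.1, hr.2.trans hx.2⟩]
    ring
  have hvint : ∫ r in (0 : ℝ)..x, (x - r) * v r
      = (∫ r in (0 : ℝ)..x, (x - r) * C r) + h * (∫ r in (0 : ℝ)..x, (x - r) * S r)
        + ∫ r in (0 : ℝ)..x, (x - r) * ∫ s in (0 : ℝ)..r, q s * (S (r - s) * v s) := by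
    rw [← intervalIntegral.integral_const_mul, ← intervalIntegral.integral_add,
      ← intervalIntegral.integral_add]
    · refine intervalIntegral.integral_congr fun r hr => ?_
      rw [uIcc_of_le hx.1] at hr
      rw [hve r ⟨hr.1, hr.2.trans hx.2⟩]
      ring
    · apply Continuous.intervalIntegrable; fun_prop
    · exact hcontI
    · apply Continuous.intervalIntegrable; fun_prop
    · apply Continuous.intervalIntegrable; fun_prop
  have e : ∫ s in (0 : ℝ)..x, (x - s) * (q s * v s - μ * v s)
      = (∫ s in (0 : ℝ)..x, (x - s) * (q s * v s)) - μ * ∫ s in (0 : ℝ)..x, (x - s) * v s := by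
    rw [← intervalIntegral.integral_const_mul, ← intervalIntegral.integral_sub]
    · refine intervalIntegral.integral_congr fun s _ => ?_
      ring
    · exact hqvx.continuousOn_mul (by fun_prop)
    · apply Continuous.intervalIntegrable; fun_prop
  rw [e, hvint, mul_add, mul_add, hJ2, hve x hx]
  have e1 := hC2 x
  have e2 := hS2 x
  linear_combination e1 + h * e2

lemma integral_sub_mul_cos {ρ : ℝ} (hρ : ρ ≠ 0) (x : ℝ) :
    ∫ r in (0 : ℝ)..x, (x - r) * Real.cos (ρ * r) = (1 - Real.cos (ρ * x)) / ρ ^ 2 := by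
  have hd : ∀ r ∈ uIcc 0 x, HasDerivAt
      (fun r => (x - r) * (Real.sin (ρ * r) / ρ) - Real.cos (ρ * r) / ρ ^ 2)
      ((x - r) * Real.cos (ρ * r)) r := by
    intro r _
    have h1 : HasDerivAt (fun r => ρ * r) ρ r := by simpa using (hasDerivAt_id r).const_mul ρ
    have h2 := ((hasDerivAt_id r).const_sub x).mul (h1.sin.div_const ρ)
    have h3 := h2.sub (h1.cos.div_const (ρ ^ 2))
    convert! h3 using 1
    simp only [id]
    field_simp
    ring
  rw [intervalIntegral.integral_eq_sub_of_hasDerivAt hd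
    (by apply Continuous.intervalIntegrable; fun_prop)]
  simp
  ring

lemma integral_sub_mul_sin {ρ : ℝ} (hρ : ρ ≠ 0) (x : ℝ) :
    ∫ r in (0 : ℝ)..x, (x - r) * (Real.sin (ρ * r) / ρ) = (x - Real.sin (ρ * x) / ρ) / ρ ^ 2 := by
  have hd : ∀ r ∈ uIcc 0 x, HasDerivAt
      (fun r => - (x - r) * (Real.cos (ρ * r) / ρ ^ 2) - Real.sin (ρ * r) / ρ ^ 3)
      ((x - r) * (Real.sin (ρ * r) / ρ)) r := by
    intro r _
    have h1 : HasDerivAt (fun r => ρ * r) ρ r := by simpa using (hasDerivAt_id r).const_mul ρ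
    have h2 := (((hasDerivAt_id r).const_sub x).neg).mul (h1.cos.div_const (ρ ^ 2))
    have h3 := h2.sub (h1.sin.div_const (ρ ^ 3))
    convert! h3 using 1
    simp only [Pi.neg_apply, id]
    field_simp
    ring
  rw [intervalIntegral.integral_eq_sub_of_hasDerivAt hd
    (by apply Continuous.intervalIntegrable; fun_prop)]
  simp
  field_simp
  ring

lemma integral_cos_two_mul_sub {ρ : ℝ} (hρ : ρ ≠ 0) (a b x : ℝ) :
    ∫ ξ in a..b, Real.cos (ρ * (2 * ξ - x))
      = Real.sin (ρ * (b - a)) / ρ * Real.cos (ρ * (a + b - x)) := by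
  have hd : ∀ r ∈ uIcc a b, HasDerivAt (fun ξ => Real.sin (ρ * (2 * ξ - x)) / (2 * ρ))
      (Real.cos (ρ * (2 * r - x))) r := by
    intro r _
    have h1 : HasDerivAt (fun r => ρ * (2 * r - x)) (ρ * 2) r := by
      simpa using (((hasDerivAt_id r).const_mul 2).sub_const x).const_mul ρ
    convert! h1.sin.div_const (2 * ρ) using 1
    field_simp
  rw [intervalIntegral.integral_eq_sub_of_hasDerivAt hd
    (by apply Continuous.intervalIntegrable; fun_prop), ← sub_div, Real.sin_sub_sin,
    show (ρ * (2 * b - x) - ρ * (2 * a - x)) / 2 = ρ * (b - a) by ring,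
    show (ρ * (2 * b - x) + ρ * (2 * a - x)) / 2 = ρ * (a + b - x) by ring]
  field_simp

/-! ### The transmutation property for all `C²` functions -/

/-- The double primitive of `w`. -/
def doublePrimitive (w : ℝ → ℝ) (x : ℝ) : ℝ := ∫ s in (0 : ℝ)..x, (x - s) * w s

lemma continuousOn_doublePrimitive {w : ℝ → ℝ} (hw : ContinuousOn w (Icc 0 π)) :
    ContinuousOn (doublePrimitive w) (Icc 0 π) := by
  obtain ⟨w', hw', hww⟩ := exists_continuous_extension_Icc hw
  have h1 : Continuous (doublePrimitive w') := by
    refine intervalIntegral.continuous_parametric_intervalIntegral_of_continuous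
      (f := fun x s => (x - s) * w' s) ?_ continuous_id
    fun_prop
  refine h1.continuousOn.congr fun x hx => ?_
  refine intervalIntegral.integral_congr fun s hs => ?_
  rw [uIcc_of_le hx.1] at hs
  rw [hww s ⟨hs.1, hs.2.trans hx.2⟩]

lemma abs_doublePrimitive_le {w : ℝ → ℝ} {B : ℝ} (hB : ∀ x ∈ Icc 0 π, |w x| ≤ B) {x : ℝ}
    (hx : x ∈ Icc 0 π) : |doublePrimitive w x| ≤ π ^ 2 * B := by
  have hB0 : 0 ≤ B := (abs_nonneg _).trans (hB x hx)
  have h1 : ‖∫ s in (0 : ℝ)..x, (x - s) * w s‖ ≤ (π * B) * |x - 0| := by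
    refine intervalIntegral.norm_integral_le_of_norm_le_const fun s hs => ?_
    rw [uIoc_of_le hx.1] at hs
    rw [norm_mul]
    refine mul_le_mul ?_ (hB s ⟨hs.1.le, hs.2.trans hx.2⟩) (norm_nonneg _) Real.pi_pos.le
    rw [Real.norm_eq_abs, abs_of_nonneg (by linarith [hs.2])]
    linarith [hs.1, hx.2]
  rw [sub_zero, abs_of_nonneg hx.1] at h1
  refine h1.trans ?_
  have := mul_le_mul_of_nonneg_left hx.2 (mul_nonneg Real.pi_pos.le hB0)
  linarith [this, show π * B * π = π ^ 2 * B by ring]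

section Transmutation

variable {q : ℝ → ℝ} {G : ℝ → ℝ → ℝ}

/-- The defect in the transmutation identity for a function with second derivative `w`. -/
def transmutationDefect (q : ℝ → ℝ) (G : ℝ → ℝ → ℝ) (w : ℝ → ℝ) (x : ℝ) : ℝ :=
  volterra G (doublePrimitive w) x - ∫ s in (0 : ℝ)..x,
    (x - s) * (q s * volterra G (doublePrimitive w) s + volterra G w s)

lemma intervalIntegrable_transmutation (hq : IntervalIntegrable q volume 0 π)
    (hG : ContinuousOn (fun p : ℝ × ℝ => G p.1 p.2) triangle) {u w : ℝ → ℝ}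
    (hu : ContinuousOn u (Icc 0 π)) (hw : ContinuousOn w (Icc 0 π)) :
    IntervalIntegrable (fun s => q s * volterra G u s + volterra G w s) volume 0 π := by
  refine (hq.mul_continuousOn ?_).add (ContinuousOn.intervalIntegrable ?_)
  · rw [uIcc_of_le Real.pi_pos.le]; exact continuousOn_volterra hG hu
  · rw [uIcc_of_le Real.pi_pos.le]; exact continuousOn_volterra hG hw

lemma intervalIntegrable_transmutation_mul (hq : IntervalIntegrable q volume 0 π)
    (hG : ContinuousOn (fun p : ℝ × ℝ => G p.1 p.2) triangle) {u w : ℝ → ℝ}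
    (hu : ContinuousOn u (Icc 0 π)) (hw : ContinuousOn w (Icc 0 π)) {x : ℝ} (hx : x ∈ Icc 0 π) :
    IntervalIntegrable (fun s => (x - s) * (q s * volterra G u s + volterra G w s)) volume 0 x :=
  (intervalIntegrable_mono_Icc (intervalIntegrable_transmutation hq hG hu hw)
    (left_mem_Icc.2 Real.pi_pos.le) hx).continuousOn_mul (by fun_prop)

lemma doublePrimitive_add {u w : ℝ → ℝ} (hu : ContinuousOn u (Icc 0 π))
    (hw : ContinuousOn w (Icc 0 π)) {x : ℝ} (hx : x ∈ Icc 0 π) :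
    doublePrimitive (fun s => u s + w s) x = doublePrimitive u x + doublePrimitive w x := by
  have h : ∀ {u : ℝ → ℝ}, ContinuousOn u (Icc 0 π) →
      IntervalIntegrable (fun s => (x - s) * u s) volume 0 x := fun hu => by
    refine ContinuousOn.intervalIntegrable ?_
    rw [uIcc_of_le hx.1]
    exact ContinuousOn.mul (by fun_prop) (hu.mono (Icc_subset_Icc_right hx.2))
  simp only [doublePrimitive, mul_add]
  rw [intervalIntegral.integral_add (h hu) (h hw)]

lemma doublePrimitive_const_mul {u : ℝ → ℝ} (a x : ℝ) :
    doublePrimitive (fun s => a * u s) x = a * doublePrimitive u x := by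
  simp only [doublePrimitive, mul_left_comm _ a, intervalIntegral.integral_const_mul]

lemma transmutationDefect_add (hq : IntervalIntegrable q volume 0 π)
    (hG : ContinuousOn (fun p : ℝ × ℝ => G p.1 p.2) triangle) {u w : ℝ → ℝ}
    (hu : ContinuousOn u (Icc 0 π)) (hw : ContinuousOn w (Icc 0 π)) {x : ℝ} (hx : x ∈ Icc 0 π) :
    transmutationDefect q G (fun s => u s + w s) x
      = transmutationDefect q G u x + transmutationDefect q G w x := by
  have hdu := continuousOn_doublePrimitive hu
  have hdw := continuousOn_doublePrimitive hw
  have e : ∀ y ∈ Icc 0 π, volterra G (doublePrimitive fun s => u s + w s) y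
      = volterra G (doublePrimitive u) y + volterra G (doublePrimitive w) y := by
    intro y hy
    rw [← volterra_add hG hdu hdw hy]
    exact volterra_congr (fun _ _ _ _ _ => rfl) (fun z hz => doublePrimitive_add hu hw hz) hy
  have hint : ∫ s in (0 : ℝ)..x, (x - s) * (q s * volterra G (doublePrimitive fun s => u s + w s) s
        + volterra G (fun s => u s + w s) s)
      = (∫ s in (0 : ℝ)..x, (x - s) * (q s * volterra G (doublePrimitive u) s + volterra G u s))
        + ∫ s in (0 : ℝ)..x, (x - s) * (q s * volterra G (doublePrimitive w) s + volterra G w s) := by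
    rw [← intervalIntegral.integral_add (intervalIntegrable_transmutation_mul hq hG hdu hu hx)
      (intervalIntegrable_transmutation_mul hq hG hdw hw hx)]
    refine intervalIntegral.integral_congr fun s hs => ?_
    rw [uIcc_of_le hx.1] at hs
    have hs' : s ∈ Icc 0 π := ⟨hs.1, hs.2.trans hx.2⟩
    rw [e s hs', volterra_add hG hu hw hs']
    ring
  rw [transmutationDefect, transmutationDefect, transmutationDefect, hint, e x hx]
  ring

lemma transmutationDefect_const_mul {w : ℝ → ℝ} (a x : ℝ) :
    transmutationDefect q G (fun s => a * w s) x = a * transmutationDefect q G w x := by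
  have e : (doublePrimitive fun s => a * w s) = fun x => a * doublePrimitive w x :=
    funext fun x => doublePrimitive_const_mul a x
  rw [transmutationDefect, transmutationDefect, e, volterra_const_mul, mul_sub,
    ← intervalIntegral.integral_const_mul]
  congr 1
  refine intervalIntegral.integral_congr fun s _ => ?_
  simp only [volterra_const_mul]
  ring

lemma exists_abs_transmutationDefect_le (hq : IntervalIntegrable q volume 0 π)
    (hG : ContinuousOn (fun p : ℝ × ℝ => G p.1 p.2) triangle) :
    ∃ D, 0 < D ∧ ∀ (w : ℝ → ℝ) (B : ℝ), ContinuousOn w (Icc 0 π) → (∀ x ∈ Icc 0 π, |w x| ≤ B) →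
      ∀ x ∈ Icc 0 π, |transmutationDefect q G w x| ≤ D * B := by
  obtain ⟨M, hM0, hM⟩ := exists_bound_triangle hG
  set Q := ∫ s in (0 : ℝ)..π, |q s| with hQ
  have hQ0 : 0 ≤ Q := intervalIntegral.integral_nonneg Real.pi_pos.le fun s _ => abs_nonneg _
  have hπ := Real.pi_pos
  refine ⟨(1 + π * M) * π ^ 2 + π * (Q * ((1 + π * M) * π ^ 2) + π * (1 + π * M)), by positivity, ?_⟩
  intro w B hw hB x hx
  have hB0 : 0 ≤ B := (abs_nonneg _).trans (hB x hx)
  have h1 : ∀ y ∈ Icc 0 π, |volterra G (doublePrimitive w) y| ≤ (1 + π * M) * (π ^ 2 * B) :=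
    fun y hy => abs_volterra_le hM (fun z hz => abs_doublePrimitive_le hB hz) hy
  have h2 : ∀ y ∈ Icc 0 π, |volterra G w y| ≤ (1 + π * M) * B :=
    fun y hy => abs_volterra_le hM hB hy
  have hbi : IntervalIntegrable (fun s => π * (|q s| * ((1 + π * M) * (π ^ 2 * B))
      + (1 + π * M) * B)) volume 0 π :=
    ((hq.abs.mul_const _).add intervalIntegrable_const).const_mul _
  have h3 : ‖∫ s in (0 : ℝ)..x, (x - s) * (q s * volterra G (doublePrimitive w) s + volterra G w s)‖
      ≤ ∫ s in (0 : ℝ)..x, π * (|q s| * ((1 + π * M) * (π ^ 2 * B)) + (1 + π * M) * B) := by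
    refine intervalIntegral.norm_integral_le_of_norm_le hx.1 ?_
      (intervalIntegrable_mono_Icc hbi (left_mem_Icc.2 hπ.le) hx)
    refine Eventually.of_forall fun s hs => ?_
    have hs' : s ∈ Icc 0 π := ⟨hs.1.le, hs.2.trans hx.2⟩
    rw [norm_mul]
    refine mul_le_mul ?_ ?_ (norm_nonneg _) hπ.le
    · rw [Real.norm_eq_abs, abs_of_nonneg (by linarith [hs.2])]
      linarith [hs.1, hx.2]
    · refine (norm_add_le _ _).trans (add_le_add ?_ (h2 s hs'))
      rw [norm_mul]
      exact mul_le_mul_of_nonneg_left (h1 s hs') (norm_nonneg _)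
  have h4 : ∫ s in (0 : ℝ)..x, π * (|q s| * ((1 + π * M) * (π ^ 2 * B)) + (1 + π * M) * B)
      ≤ ∫ s in (0 : ℝ)..π, π * (|q s| * ((1 + π * M) * (π ^ 2 * B)) + (1 + π * M) * B) :=
    intervalIntegral.integral_mono_interval le_rfl hx.1 hx.2
      (Eventually.of_forall fun s => by simp only [Pi.zero_apply]; positivity) hbi
  have h5 : ∫ s in (0 : ℝ)..π, π * (|q s| * ((1 + π * M) * (π ^ 2 * B)) + (1 + π * M) * B)
      = π * (Q * ((1 + π * M) * (π ^ 2 * B)) + π * ((1 + π * M) * B)) := by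
    rw [intervalIntegral.integral_const_mul, intervalIntegral.integral_add (hq.abs.mul_const _)
      intervalIntegrable_const, intervalIntegral.integral_mul_const, intervalIntegral.integral_const,
      smul_eq_mul, sub_zero]
  rw [transmutationDefect]
  refine (abs_sub _ _).trans ?_
  have h6 := (h3.trans h4).trans_eq h5
  rw [Real.norm_eq_abs] at h6
  have h7 := h1 x hx
  calc _ ≤ _ := add_le_add h7 h6
    _ = _ := by ring

/-- The defect is linear and bounded by a constant times the supremum of `w`, so its zero set is
closed under uniform limits. -/
lemma transmutationDefect_eq_zero_of_approx (hq : IntervalIntegrable q volume 0 π)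
    (hG : ContinuousOn (fun p : ℝ × ℝ => G p.1 p.2) triangle) {w : ℝ → ℝ}
    (hw : ContinuousOn w (Icc 0 π))
    (h : ∀ ε > 0, ∃ p : ℝ → ℝ, ContinuousOn p (Icc 0 π) ∧ (∀ t ∈ Icc 0 π, |w t - p t| ≤ ε) ∧
      ∀ x ∈ Icc 0 π, transmutationDefect q G p x = 0) :
    ∀ x ∈ Icc 0 π, transmutationDefect q G w x = 0 := by
  obtain ⟨D, hD, hDw⟩ := exists_abs_transmutationDefect_le hq hG
  intro x hx
  by_contra hne
  have hpos := abs_pos.2 hne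
  obtain ⟨p, hp, hwp, hp0⟩ := h (|transmutationDefect q G w x| / (2 * D)) (by positivity)
  have hd : ContinuousOn (fun t => w t - p t) (Icc 0 π) := hw.sub hp
  have h1 := hDw _ _ hd hwp x hx
  have h2 := transmutationDefect_add hq hG hd hp hx
  simp only [sub_add_cancel] at h2
  rw [hp0 x hx, add_zero] at h2
  rw [← h2] at h1
  have h3 : D * (|transmutationDefect q G w x| / (2 * D)) = |transmutationDefect q G w x| / 2 := by
    field_simp
  linarith

/-- Cosine polynomials are dense, so it suffices to treat frequencies `n`. The hypothesis excludes
frequency `0`; the constant `1` is recovered as the uniform limit of `cos (ρ t)` for `ρ → 0`. -/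
lemma transmutationDefect_eq_zero (hq : IntervalIntegrable q volume 0 π)
    (hG : ContinuousOn (fun p : ℝ × ℝ => G p.1 p.2) triangle)
    (hcos : ∀ ρ : ℝ, ρ ≠ 0 → ∀ x ∈ Icc 0 π,
      transmutationDefect q G (fun t => Real.cos (ρ * t)) x = 0) {w : ℝ → ℝ}
    (hw : ContinuousOn w (Icc 0 π)) : ∀ x ∈ Icc 0 π, transmutationDefect q G w x = 0 := by
  have h1 : ∀ x ∈ Icc 0 π, transmutationDefect q G (fun _ => 1) x = 0 := by
    refine transmutationDefect_eq_zero_of_approx hq hG continuousOn_const fun ε hε => ?_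
    have hπ := Real.pi_pos
    -- Then `ρ² ≤ ρ`, and `1 - cos (ρ t) ≤ ρ² π² / 2 ≤ ε / 2` on `[0, π]`.
    set ρ := min 1 (ε / π ^ 2) with hρ
    have hρ0 : 0 < ρ := lt_min one_pos (by positivity)
    refine ⟨fun t => Real.cos (ρ * t), by fun_prop, fun t ht => ?_, hcos ρ hρ0.ne'⟩
    have h2 := Real.one_sub_sq_div_two_le_cos (x := ρ * t)
    rw [abs_of_nonneg (by linarith [Real.cos_le_one (ρ * t)])]
    have h3 : (ρ * t) ^ 2 ≤ ρ * π ^ 2 := by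
      rw [mul_pow]
      have : ρ ^ 2 ≤ ρ := by nlinarith [min_le_left 1 (ε / π ^ 2)]
      have : t ^ 2 ≤ π ^ 2 := by nlinarith [ht.1, ht.2]
      exact mul_le_mul ‹_› ‹_› (sq_nonneg _) hρ0.le
    have h4 : ρ * π ^ 2 ≤ ε := by
      have := min_le_right 1 (ε / π ^ 2)
      rwa [← hρ, le_div_iff₀ (by positivity)] at this
    linarith
  have hspan : ∀ p ∈ cosSpan, ∀ x ∈ Icc 0 π, transmutationDefect q G p x = 0 := by
    intro p hp x hx
    induction hp using Submodule.span_induction with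
    | zero =>
      have := transmutationDefect_const_mul (q := q) (G := G) (w := fun _ => 1) 0 x
      simp only [zero_mul] at this
      exact this
    | add a b ha hb iha ihb =>
      have := transmutationDefect_add hq hG (continuous_of_mem_cosSpan ha).continuousOn
        (continuous_of_mem_cosSpan hb).continuousOn hx
      rw [iha, ihb, add_zero] at this
      exact this
    | smul c a _ iha =>
      have := transmutationDefect_const_mul (q := q) (G := G) (w := a) c x
      rw [iha, mul_zero] at this
      exact this
    | mem a ha =>
      obtain ⟨n, rfl⟩ := ha
      rcases Nat.eq_zero_or_pos n with rfl | hn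
      · simpa using h1 x hx
      · exact hcos n (by exact_mod_cast hn.ne') x hx
  refine transmutationDefect_eq_zero_of_approx hq hG hw fun ε hε => ?_
  obtain ⟨p, hp, hwp⟩ := exists_cosSpan_near hw hε
  exact ⟨p, (continuous_of_mem_cosSpan hp).continuousOn, fun t ht => (hwp t ht).le, hspan p hp⟩

/-- When `u'(0) = 0`, `u` is `u(0)` plus the double primitive of `u''`, so the twice integrated
identity splits into the one for the constant `1` and the vanishing of the defect at `u''`. For `u''
= cos ρt` the double primitive is `(1 - cos ρt) / ρ²`, hence the two hypotheses; density does the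
rest. -/
lemma isTransmutationKernel_of_cos (hq : IntervalIntegrable q volume 0 π) {h : ℝ}
    (hG : ContinuousOn (fun p : ℝ × ℝ => G p.1 p.2) triangle)
    (hone : ∀ x ∈ Icc 0 π, volterra G (fun _ => 1) x
      = 1 + h * x + ∫ s in (0 : ℝ)..x, (x - s) * (q s * volterra G (fun _ => 1) s))
    (hcos : ∀ ρ : ℝ, ρ ≠ 0 → ∀ x ∈ Icc 0 π, volterra G (fun t => Real.cos (ρ * t)) x
      = 1 + h * x + ∫ s in (0 : ℝ)..x, (x - s) * (q s * volterra G (fun t => Real.cos (ρ * t)) s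
        - ρ ^ 2 * volterra G (fun t => Real.cos (ρ * t)) s)) :
    IsTransmutationKernel q h G := by
  have hone' : ContinuousOn (fun _ : ℝ => (1 : ℝ)) (Icc 0 π) := continuousOn_const
  have hcos0 : ∀ ρ : ℝ, ρ ≠ 0 → ∀ x ∈ Icc 0 π,
      transmutationDefect q G (fun t => Real.cos (ρ * t)) x = 0 := by
    intro ρ hρ x hx
    have hcc : ContinuousOn (fun t => Real.cos (ρ * t)) (Icc 0 π) := by fun_prop
    have e : ∀ y ∈ Icc 0 π, volterra G (doublePrimitive fun t => Real.cos (ρ * t)) y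
        = (1 / ρ ^ 2) * (volterra G (fun _ => 1) y - volterra G (fun t => Real.cos (ρ * t)) y) := by
      intro y hy
      rw [← volterra_sub hG hone' hcc hy, ← volterra_const_mul]
      refine volterra_congr (fun _ _ _ _ _ => rfl) (fun z _ => ?_) hy
      rw [doublePrimitive, integral_sub_mul_cos hρ]
      ring
    have i1 := intervalIntegrable_transmutation_mul hq hG hone'
      (continuousOn_const (c := (0 : ℝ))) hx
    have hz : ∀ s, volterra G (fun _ => 0) s = 0 := fun s => by simp [volterra]
    simp only [hz, add_zero] at i1
    have i2 : IntervalIntegrable (fun s => (x - s) * (q s * volterra G (fun t => Real.cos (ρ * t)) s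
        - ρ ^ 2 * volterra G (fun t => Real.cos (ρ * t)) s)) volume 0 x := by
      have := intervalIntegrable_transmutation_mul hq hG hcc
        (w := fun t => - ρ ^ 2 * Real.cos (ρ * t)) (by fun_prop) hx
      simp only [volterra_const_mul] at this
      refine this.congr fun s _ => ?_
      ring
    have hint : ∫ s in (0 : ℝ)..x, (x - s) * (q s *
          volterra G (doublePrimitive fun t => Real.cos (ρ * t)) s
          + volterra G (fun t => Real.cos (ρ * t)) s)
        = (1 / ρ ^ 2) * ((∫ s in (0 : ℝ)..x, (x - s) * (q s * volterra G (fun _ => 1) s))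
          - ∫ s in (0 : ℝ)..x, (x - s) * (q s * volterra G (fun t => Real.cos (ρ * t)) s
            - ρ ^ 2 * volterra G (fun t => Real.cos (ρ * t)) s)) := by
      rw [← intervalIntegral.integral_sub i1 i2, ← intervalIntegral.integral_const_mul]
      refine intervalIntegral.integral_congr fun s hs => ?_
      rw [uIcc_of_le hx.1] at hs
      rw [e s ⟨hs.1, hs.2.trans hx.2⟩]
      field_simp
      ring
    rw [transmutationDefect, hint, e x hx, ← mul_sub]
    have h1 := hone x hx
    have h2 := hcos ρ hρ x hx
    rw [mul_eq_zero]
    right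
    linarith
  refine ⟨hG, fun u u₁ u₂ hu hu1 hu2 h0 => ?_⟩
  have h0π : (0 : ℝ) ∈ Icc 0 π := left_mem_Icc.2 Real.pi_pos.le
  have hu1c : ContinuousOn u₁ (Icc 0 π) := fun x hx => (hu1 x hx).continuousWithinAt
  have huc : ContinuousOn u (Icc 0 π) := fun x hx => (hu x hx).continuousWithinAt
  have hu2i : IntervalIntegrable u₂ volume 0 π :=
    ContinuousOn.intervalIntegrable (by rwa [uIcc_of_le Real.pi_pos.le])
  have ftc : ∀ {f f₁ : ℝ → ℝ}, (∀ x ∈ Icc 0 π, HasDerivWithinAt f (f₁ x) (Icc 0 π) x) →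
      ContinuousOn f₁ (Icc 0 π) → ∀ x ∈ Icc 0 π, ∫ s in (0 : ℝ)..x, f₁ s = f x - f 0 := by
    intro f f₁ hf hf₁ x hx
    have hss : Icc 0 x ⊆ Icc 0 π := Icc_subset_Icc_right hx.2
    refine intervalIntegral.integral_eq_sub_of_hasDerivAt_of_le hx.1
      (fun y hy => ((hf y (hss hy)).mono hss).continuousWithinAt) ?_ ?_
    · intro y hy
      exact (hf y (hss (Ioo_subset_Icc_self hy))).hasDerivAt
        (Icc_mem_nhds hy.1 (hy.2.trans_le hx.2))
    · refine ContinuousOn.intervalIntegrable ?_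
      rw [uIcc_of_le hx.1]
      exact hf₁.mono hss
  have hu_eq : ∀ x ∈ Icc 0 π, u 0 * 1 + doublePrimitive u₂ x = u x := by
    intro x hx
    have e1 := ftc hu hu1c x hx
    have e2 : ∫ s in (0 : ℝ)..x, u₁ s = doublePrimitive u₂ x := by
      rw [doublePrimitive, ← integral_integral_eq_integral_sub_mul hu2i hx]
      refine intervalIntegral.integral_congr fun s hs => ?_
      rw [uIcc_of_le hx.1] at hs
      rw [ftc hu1 hu2 s ⟨hs.1, hs.2.trans hx.2⟩, h0, sub_zero]
    rw [← e2, e1]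
    ring
  have hdp := continuousOn_doublePrimitive hu2
  have hTu : ∀ x ∈ Icc 0 π, volterra G u x
      = u 0 * volterra G (fun _ => 1) x + volterra G (doublePrimitive u₂) x := by
    intro x hx
    rw [← volterra_const_mul, ← volterra_add hG (by fun_prop) hdp hx]
    exact (volterra_congr (fun _ _ _ _ _ => rfl) hu_eq hx).symm
  have hgi := intervalIntegrable_transmutation hq hG huc hu2
  refine ⟨fun x => h * u 0 + ∫ r in (0 : ℝ)..x, (q r * volterra G u r + volterra G u₂ r),
    hasSecondDeriv_of_integral (a := u 0) hgi fun x hx => ?_, ?_⟩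
  · have hci : IntervalIntegrable (fun s => ∫ r in (0 : ℝ)..s,
        (q r * volterra G u r + volterra G u₂ r)) volume 0 x := by
      refine ContinuousOn.intervalIntegrable ?_
      rw [uIcc_of_le hx.1]
      exact (continuousOn_primitive hgi).mono (Icc_subset_Icc_right hx.2)
    rw [intervalIntegral.integral_add intervalIntegrable_const hci,
      integral_integral_eq_integral_sub_mul hgi hx, intervalIntegral.integral_const, smul_eq_mul,
      sub_zero]
    have hdef := transmutationDefect_eq_zero hq hG hcos0 hu2 x hx
    rw [transmutationDefect, sub_eq_zero] at hdef
    have i1 := intervalIntegrable_transmutation_mul hq hG hone'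
      (continuousOn_const (c := (0 : ℝ))) hx
    have hz : ∀ s, volterra G (fun _ => 0) s = 0 := fun s => by simp [volterra]
    simp only [hz, add_zero] at i1
    have hsum : ∫ s in (0 : ℝ)..x, (x - s) * (q s * volterra G u s + volterra G u₂ s)
        = u 0 * (∫ s in (0 : ℝ)..x, (x - s) * (q s * volterra G (fun _ => 1) s))
          + ∫ s in (0 : ℝ)..x, (x - s) * (q s * volterra G (doublePrimitive u₂) s
            + volterra G u₂ s) := by
      rw [← intervalIntegral.integral_const_mul, ← intervalIntegral.integral_add (i1.const_mul _)
        (intervalIntegrable_transmutation_mul hq hG hdp hu2 hx)]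
      refine intervalIntegral.integral_congr fun s hs => ?_
      rw [uIcc_of_le hx.1] at hs
      rw [hTu s ⟨hs.1, hs.2.trans hx.2⟩]
      ring
    rw [hsum, hTu x hx, ← hdef, hone x hx]
    ring
  · simp [volterra]

end Transmutation

/-- The boundary values `h + ½ ∫₀^ξ q + ½ ∫₀^η q` of the Goursat problem are the ones for which the
Duhamel formula holds, both for `(1, x)` with `μ = 0` and for `(cos ρx, sin ρx / ρ)` with `μ = ρ²`.
-/
theorem exists_isTransmutationKernel {q : ℝ → ℝ} (hq : IntervalIntegrable q volume 0 π) (h : ℝ) :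
    ∃ G, IsTransmutationKernel q h G := by
  have hb : ContinuousOn (Function.uncurry fun ξ η => h + (1 / 2) * (∫ s in (0 : ℝ)..ξ, q s)
      + (1 / 2) * ∫ s in (0 : ℝ)..η, q s) (Icc 0 π ×ˢ Icc 0 π) := by
    have hp := continuousOn_primitive hq
    refine ((continuousOn_const.add (continuousOn_const.mul ?_)).add (continuousOn_const.mul ?_))
    · exact hp.comp continuousOn_fst fun p hp => hp.1
    · exact hp.comp continuousOn_snd fun p hp => hp.2
  obtain ⟨a, ha, hae⟩ := exists_goursat hq hb
  have hGc := continuous_goursatKernel ha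
  refine ⟨goursatKernel a, isTransmutationKernel_of_cos hq hGc.continuousOn ?_ ?_⟩
  · intro x hx
    have := integral_sub_mul_eq_of_duhamel (h := h) (μ := 0) (C := fun _ => 1) (S := fun x => x) hq
      (by fun_prop) (by fun_prop) (by simp) (by simp)
      (continuous_volterra hGc (u := fun _ => 1) (by fun_prop))
      (fun y hy => by
        have h1 := characteristicTransform_eq (C := fun _ => 1) (S := fun x => x) hq ha hae
          (by fun_prop) (by fun_prop) (by simp) rfl (by simp) hy
        simp only [volterra_goursatKernel ha (C := fun _ => 1) (by fun_prop) (by simp)]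
        exact h1) hx
    simpa using this
  · intro ρ hρ x hx
    have hev : ∀ x, Real.cos (ρ * -x) = Real.cos (ρ * x) := fun x => by
      rw [mul_neg, Real.cos_neg]
    refine integral_sub_mul_eq_of_duhamel (h := h) (μ := ρ ^ 2) (C := fun t => Real.cos (ρ * t))
      (S := fun t => Real.sin (ρ * t) / ρ) hq (by fun_prop) (by fun_prop) ?_ ?_
      (continuous_volterra hGc (u := fun t => Real.cos (ρ * t)) (by fun_prop))
      (fun y hy => ?_) hx
    · intro x
      rw [integral_sub_mul_cos hρ]
      field_simp
      ring
    · intro x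
      rw [integral_sub_mul_sin hρ]
      field_simp
      ring
    · have h1 := characteristicTransform_eq (C := fun t => Real.cos (ρ * t))
        (S := fun t => Real.sin (ρ * t) / ρ) hq ha hae
        (by fun_prop) (by fun_prop) hev (by simp) (fun a b x => integral_cos_two_mul_sub hρ a b x) hy
      simp only [volterra_goursatKernel ha (C := fun t => Real.cos (ρ * t)) (by fun_prop) hev]
      exact h1

/-! ### The solutions `c(ρ, x)` and their bounds -/

/-- Differentiating the real part of `cos (z x)` along the real axis treats both signs of `μ` at
once; the only property of the root used is `z² = μ`. -/
lemma exists_hasDerivAt_cosRoot (μ : ℝ) : ∃ d : ℝ → ℝ, (∀ x, HasDerivAt (cosRoot μ) (d x) x) ∧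
    (∀ x, HasDerivAt d (-μ * cosRoot μ x) x) ∧ d 0 = 0 := by
  set z : ℂ := (μ : ℂ) ^ (1 / 2 : ℂ) with hz
  have hz2 : z ^ 2 = μ := by
    have := Complex.cpow_nat_inv_pow (μ : ℂ) two_ne_zero
    rw [hz, one_div]
    exact_mod_cast this
  have hlin : ∀ w : ℂ, HasDerivAt (fun w : ℂ => z * w) z w := fun w => by
    simpa using (hasDerivAt_id w).const_mul z
  refine ⟨fun x => (-Complex.sin (z * x) * z).re, fun x => ?_, fun x => ?_, by simp⟩
  · exact ((hlin x).ccos).real_of_complex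
  · have h1 := (((hlin x).csin).neg.mul_const z).real_of_complex
    convert! h1 using 1
    have e : -(Complex.cos (z * x) * z) * z = ((-μ : ℝ) : ℂ) * Complex.cos (z * x) := by
      push_cast
      rw [← hz2]
      ring
    rw [e, Complex.re_ofReal_mul, cosRoot]

lemma continuous_cosRoot (μ : ℝ) : Continuous (cosRoot μ) := by
  obtain ⟨d, hd, _⟩ := exists_hasDerivAt_cosRoot μ
  exact continuous_iff_continuousAt.2 fun x => (hd x).continuousAt

lemma cosRoot_zero_right (μ : ℝ) : cosRoot μ 0 = 1 := by simp [cosRoot]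

lemma cosRoot_sq (ρ x : ℝ) : cosRoot (ρ ^ 2) x = Real.cos (ρ * x) := by
  have h1 : (((ρ ^ 2 : ℝ) : ℂ)) ^ (1 / 2 : ℂ) = ((|ρ| : ℝ) : ℂ) := by
    rw [show (1 / 2 : ℂ) = ((1 / 2 : ℝ) : ℂ) by push_cast; ring,
      ← Complex.ofReal_cpow (sq_nonneg ρ), ← Real.sqrt_eq_rpow, Real.sqrt_sq_eq_abs]
  rw [cosRoot, h1, ← Complex.ofReal_mul, Complex.cos_ofReal_re]
  rcases abs_choice ρ with h | h <;> rw [h]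
  rw [neg_mul, Real.cos_neg]

/-- For every `μ`, `c μ` is the solution of `-y'' + q y = μ y` with `y(0) = 1`, `y'(0) = h`,
and `c₁ μ` is its derivative. -/
structure IsCauchyPair (q : ℝ → ℝ) (h : ℝ) (c c₁ : ℝ → ℝ → ℝ) : Prop where
  isSolution : ∀ μ, IsSolution q μ (c μ) (c₁ μ)
  apply_zero : ∀ μ, c μ 0 = 1
  deriv_zero : ∀ μ, c₁ μ 0 = h

lemma IsCauchyFamily.exists_pair {q : ℝ → ℝ} {h : ℝ} {c : ℝ → ℝ → ℝ} (hc : IsCauchyFamily q h c) :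
    ∃ c₁, IsCauchyPair q h c c₁ := by
  choose c₁ hc₁ using hc
  exact ⟨c₁, fun μ => (hc₁ μ).1, fun μ => (hc₁ μ).2.1, fun μ => (hc₁ μ).2.2⟩

/-- Intertwining turns `u'' = -μ u` into `v'' - q v = -μ v` for `v = T u`. With `u = cos √μ x` the
Cauchy data come out as `1` and `h`, so `T` supplies the solutions and, by uniqueness, the
representation `c = T cos`. -/
lemma IsTransmutationKernel.exists_isSolution {q : ℝ → ℝ} {h : ℝ} {G : ℝ → ℝ → ℝ}
    (hG : IsTransmutationKernel q h G) (μ : ℝ) : ∃ v₁ : ℝ → ℝ,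
      IsSolution q μ (volterra G (cosRoot μ)) v₁ ∧ volterra G (cosRoot μ) 0 = 1 ∧ v₁ 0 = h := by
  obtain ⟨d, hd, hd2, hd0⟩ := exists_hasDerivAt_cosRoot μ
  obtain ⟨v₁, hv, hv0⟩ := hG.2 (cosRoot μ) d (fun x => -μ * cosRoot μ x)
    (fun x _ => (hd x).hasDerivWithinAt) (fun x _ => (hd2 x).hasDerivWithinAt)
    (continuous_const.mul (continuous_cosRoot μ)).continuousOn hd0
  have h0 : volterra G (cosRoot μ) 0 = 1 := by simp [volterra, cosRoot_zero_right]
  refine ⟨v₁, ?_, h0, by rw [hv0, h0, mul_one]⟩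
  refine HasSecondDeriv.congr_ae hv (Eventually.of_forall fun x _ => ?_)
  rw [volterra_const_mul]
  ring

lemma IsTransmutationKernel.isCauchyFamily {q : ℝ → ℝ} {h : ℝ} {G : ℝ → ℝ → ℝ}
    (hG : IsTransmutationKernel q h G) : IsCauchyFamily q h fun μ => volterra G (cosRoot μ) :=
  fun μ => hG.exists_isSolution μ

lemma hasSecondDeriv_of_hasDerivAt {w w₁ k : ℝ → ℝ} (hw : ∀ x, HasDerivAt w (w₁ x) x)
    (hw₁ : ∀ x, HasDerivAt w₁ (k x) x) (hk : Continuous k) : HasSecondDeriv w w₁ k where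
  hasDeriv x _ := (hw x).hasDerivWithinAt
  absCont := absCont_of_hasDerivWithinAt Real.pi_pos.le (fun x _ => (hw₁ x).hasDerivWithinAt)
    hk.continuousOn
  deriv_ae := Eventually.of_forall fun x _ => hw₁ x

lemma hasDerivAt_mul_sub (ρ x s : ℝ) : HasDerivAt (fun s => ρ * (x - s)) (-ρ) s := by
  have := ((hasDerivAt_id s).const_sub x).const_mul ρ
  convert! this using 1
  ring

section Cauchy

variable {q : ℝ → ℝ} {h : ℝ} {c c₁ G : ℝ → ℝ → ℝ}

lemma IsCauchyPair.eq_volterra (hc : IsCauchyPair q h c c₁) (hq : IntervalIntegrable q volume 0 π)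
    (hG : IsTransmutationKernel q h G) (μ : ℝ) :
    ∀ x ∈ Icc 0 π, c μ x = volterra G (cosRoot μ) x := by
  obtain ⟨v₁, hv, hv0, hv1⟩ := hG.exists_isSolution μ
  exact (hc.isSolution μ).eqOn hq hv ((hc.apply_zero μ).trans hv0.symm)
    ((hc.deriv_zero μ).trans hv1.symm)

lemma IsCauchyPair.continuousOn (hc : IsCauchyPair q h c c₁) (μ : ℝ) :
    ContinuousOn (c μ) (Icc 0 π) := HasSecondDeriv.continuousOn (hc.isSolution μ)

/-- Variation of constants for `c`. -/
lemma IsCauchyPair.eq_cos_add (hc : IsCauchyPair q h c c₁) {ρ : ℝ} (hρ : ρ ≠ 0) {x : ℝ}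
    (hx : x ∈ Icc 0 π) :
    c (ρ ^ 2) x = Real.cos (ρ * x) + (h * Real.sin (ρ * x)
      + ∫ s in (0 : ℝ)..x, Real.sin (ρ * (x - s)) * (q s * c (ρ ^ 2) s)) / ρ := by
  have hw : HasSecondDeriv (fun s => Real.sin (ρ * (x - s)) / ρ) (fun s => -Real.cos (ρ * (x - s)))
      (fun s => -(ρ * Real.sin (ρ * (x - s)))) := by
    refine hasSecondDeriv_of_hasDerivAt (fun s => ?_) (fun s => ?_) (by fun_prop)
    · convert! (hasDerivAt_mul_sub ρ x s).sin.div_const ρ using 1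
      field_simp
    · convert! (hasDerivAt_mul_sub ρ x s).cos.neg using 1
      ring
  have hg := HasSecondDeriv.green (hc.isSolution (ρ ^ 2)) hw hx
  rw [hc.apply_zero, hc.deriv_zero] at hg
  have e : ∫ s in (0 : ℝ)..x, ((q s * c (ρ ^ 2) s - ρ ^ 2 * c (ρ ^ 2) s)
      * (Real.sin (ρ * (x - s)) / ρ) - c (ρ ^ 2) s * -(ρ * Real.sin (ρ * (x - s))))
      = (1 / ρ) * ∫ s in (0 : ℝ)..x, Real.sin (ρ * (x - s)) * (q s * c (ρ ^ 2) s) := by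
    rw [← intervalIntegral.integral_const_mul]
    refine intervalIntegral.integral_congr fun s _ => ?_
    field_simp
    ring
  rw [e] at hg
  simp only [sub_self, mul_zero, Real.sin_zero, zero_div, Real.cos_zero, sub_zero] at hg
  rw [add_div]
  field_simp at hg ⊢
  linear_combination -hg

/-- Variation of constants for the derivative of `c`. -/
lemma IsCauchyPair.deriv_eq (hc : IsCauchyPair q h c c₁) (ρ : ℝ) {x : ℝ} (hx : x ∈ Icc 0 π) :
    c₁ (ρ ^ 2) x = -(ρ * Real.sin (ρ * x)) + h * Real.cos (ρ * x)
      + ∫ s in (0 : ℝ)..x, Real.cos (ρ * (x - s)) * (q s * c (ρ ^ 2) s) := by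
  have hw : HasSecondDeriv (fun s => Real.cos (ρ * (x - s))) (fun s => ρ * Real.sin (ρ * (x - s)))
      (fun s => -(ρ ^ 2 * Real.cos (ρ * (x - s)))) := by
    refine hasSecondDeriv_of_hasDerivAt (fun s => ?_) (fun s => ?_) (by fun_prop)
    · convert! (hasDerivAt_mul_sub ρ x s).cos using 1
      ring
    · convert! (hasDerivAt_mul_sub ρ x s).sin.const_mul ρ using 1
      ring
  have hg := HasSecondDeriv.green (hc.isSolution (ρ ^ 2)) hw hx
  rw [hc.apply_zero, hc.deriv_zero] at hg
  have e : ∫ s in (0 : ℝ)..x, ((q s * c (ρ ^ 2) s - ρ ^ 2 * c (ρ ^ 2) s)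
      * Real.cos (ρ * (x - s)) - c (ρ ^ 2) s * -(ρ ^ 2 * Real.cos (ρ * (x - s))))
      = ∫ s in (0 : ℝ)..x, Real.cos (ρ * (x - s)) * (q s * c (ρ ^ 2) s) := by
    refine intervalIntegral.integral_congr fun s _ => ?_
    ring
  rw [e] at hg
  simp only [sub_self, mul_zero, Real.sin_zero, Real.cos_zero, sub_zero] at hg
  linear_combination -hg

lemma abs_cos_sub_cos_le (a b : ℝ) : |Real.cos a - Real.cos b| ≤ |a - b| := by
  have := Real.lipschitzWith_cos.dist_le_mul a b
  simpa [Real.dist_eq] using this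

lemma abs_sin_sub_sin_le (a b : ℝ) : |Real.sin a - Real.sin b| ≤ |a - b| := by
  have := Real.lipschitzWith_sin.dist_le_mul a b
  simpa [Real.dist_eq] using this

/-- Uniform bounds for `c (ρ²)` and for its dependence on `ρ`. -/
lemma IsCauchyPair.exists_bound (hc : IsCauchyPair q h c c₁) (hq : IntervalIntegrable q volume 0 π) :
    ∃ B, 0 < B ∧ (∀ ρ, ∀ x ∈ Icc 0 π, |c (ρ ^ 2) x| ≤ B) ∧
      ∀ ρ σ, ∀ x ∈ Icc 0 π, |c (ρ ^ 2) x - c (σ ^ 2) x| ≤ B * |ρ - σ| := by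
  obtain ⟨G, hG⟩ := exists_isTransmutationKernel hq h
  obtain ⟨M, hM0, hM⟩ := exists_bound_triangle hG.1
  have hπ := Real.pi_pos
  refine ⟨(1 + π * M) * (1 + π), by positivity, fun ρ x hx => ?_, fun ρ σ x hx => ?_⟩
  · rw [hc.eq_volterra hq hG _ x hx]
    refine (abs_volterra_le hM (B := 1) (fun y _ => ?_) hx).trans ?_
    · rw [cosRoot_sq]; exact Real.abs_cos_le_one _
    · have : 0 ≤ 1 + π * M := by positivity
      nlinarith
  · rw [hc.eq_volterra hq hG _ x hx, hc.eq_volterra hq hG _ x hx,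
      ← volterra_sub hG.1 (continuous_cosRoot _).continuousOn (continuous_cosRoot _).continuousOn hx]
    refine (abs_volterra_le hM (B := π * |ρ - σ|) (fun y hy => ?_) hx).trans ?_
    · rw [cosRoot_sq, cosRoot_sq]
      refine (abs_cos_sub_cos_le _ _).trans ?_
      rw [← sub_mul, abs_mul, abs_of_nonneg hy.1, mul_comm]
      exact mul_le_mul_of_nonneg_right hy.2 (abs_nonneg _)
    · have h1 : 0 ≤ (1 + π * M) * |ρ - σ| := by positivity
      nlinarith

lemma integral_mul_bound {F : ℝ → ℝ} {B x : ℝ} (hq : IntervalIntegrable q volume 0 π)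
    (hx : x ∈ Icc 0 π) (hB : 0 ≤ B) (hF : ∀ s ∈ Icc 0 x, |F s| ≤ B) :
    |∫ s in (0 : ℝ)..x, q s * F s| ≤ (∫ s in (0 : ℝ)..π, |q s|) * B := by
  have h1 : ‖∫ s in (0 : ℝ)..x, q s * F s‖ ≤ ∫ s in (0 : ℝ)..x, |q s| * B := by
    refine intervalIntegral.norm_integral_le_of_norm_le hx.1 ?_
      ((intervalIntegrable_mono_Icc hq.abs (left_mem_Icc.2 Real.pi_pos.le) hx).mul_const B)
    refine Eventually.of_forall fun s hs => ?_
    rw [norm_mul]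
    exact mul_le_mul_of_nonneg_left (hF s (Ioc_subset_Icc_self hs)) (norm_nonneg _)
  refine h1.trans ?_
  rw [intervalIntegral.integral_mul_const]
  refine mul_le_mul_of_nonneg_right ?_ hB
  exact intervalIntegral.integral_mono_interval le_rfl hx.1 hx.2
    (Eventually.of_forall fun s => abs_nonneg _) hq.abs

lemma IsCauchyPair.exists_abs_sub_cos_le (hc : IsCauchyPair q h c c₁)
    (hq : IntervalIntegrable q volume 0 π) :
    ∃ B, 0 < B ∧ ∀ ρ, 0 < ρ → ∀ x ∈ Icc 0 π, |c (ρ ^ 2) x - Real.cos (ρ * x)| ≤ B / ρ := by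
  obtain ⟨B, hB0, hB, -⟩ := hc.exists_bound hq
  have hQ0 : 0 ≤ ∫ s in (0 : ℝ)..π, |q s| :=
    intervalIntegral.integral_nonneg Real.pi_pos.le fun s _ => abs_nonneg _
  refine ⟨|h| + (∫ s in (0 : ℝ)..π, |q s|) * B + 1, by positivity, fun ρ hρ x hx => ?_⟩
  rw [hc.eq_cos_add hρ.ne' hx, add_sub_cancel_left, abs_div, abs_of_pos hρ]
  gcongr
  refine (abs_add_le _ _).trans ?_
  have h1 : |h * Real.sin (ρ * x)| ≤ |h| := by
    rw [abs_mul]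
    exact mul_le_of_le_one_right (abs_nonneg _) (Real.abs_sin_le_one _)
  have h2 : |∫ s in (0 : ℝ)..x, Real.sin (ρ * (x - s)) * (q s * c (ρ ^ 2) s)|
      ≤ (∫ s in (0 : ℝ)..π, |q s|) * B := by
    have := integral_mul_bound (F := fun s => Real.sin (ρ * (x - s)) * c (ρ ^ 2) s) hq hx hB0.le
      (fun s hs => by
        rw [abs_mul]
        refine (mul_le_of_le_one_left (abs_nonneg _) (Real.abs_sin_le_one _)).trans ?_
        exact hB ρ s ⟨hs.1, hs.2.trans hx.2⟩)
    simpa only [mul_left_comm] using this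
  linarith

/-! ### The characteristic function and roots near the integers -/

/-- The characteristic function of the boundary value problem. -/
def charFun (H : ℝ) (c c₁ : ℝ → ℝ → ℝ) (μ : ℝ) : ℝ := c₁ μ π + H * c μ π

lemma isEigenvalue_iff (hc : IsCauchyPair q h c c₁) (hq : IntervalIntegrable q volume 0 π)
    {H μ : ℝ} : IsEigenvalue q h H μ ↔ charFun H c c₁ μ = 0 := by
  constructor
  · rintro ⟨y, y₁, hy, h0, h1, x, hx, hyx⟩
    have hs : IsSolution q μ (fun x => y 0 * c μ x) (fun x => y 0 * c₁ μ x) :=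
      (HasSecondDeriv.const_mul (hc.isSolution μ) (y 0)).congr_ae
        (Eventually.of_forall fun x _ => by ring)
    have hd : IsSolution q μ (fun x => y x - y 0 * c μ x) (fun x => y₁ x - y 0 * c₁ μ x) :=
      (HasSecondDeriv.sub hy hs).congr_ae (Eventually.of_forall fun x _ => by ring)
    have hz := eqOn_zero_of_isSolution hq hd (by simp [hc.apply_zero])
      (by rw [hc.deriv_zero]; linarith)
    have hπ : π ∈ Icc 0 π := right_mem_Icc.2 Real.pi_pos.le
    -- Uniqueness only controls the values of the difference; its derivative at `π` vanishes because
    -- its second derivative integrates to zero.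
    have hz1 : y₁ π - y 0 * c₁ μ π = 0 := by
      have e := HasSecondDeriv.integral_eq_sub hd hπ
      rw [intervalIntegral.integral_congr (g := fun _ => 0)] at e
      · rw [intervalIntegral.integral_zero, hc.deriv_zero] at e
        linarith
      · intro s hs
        rw [uIcc_of_le Real.pi_pos.le] at hs
        have := hz s hs
        simp only
        rw [this]
        ring
    have hy0 : y 0 ≠ 0 := by
      intro h
      apply hyx
      have := hz x hx
      rw [h] at this
      linarith
    have := hz π hπ
    have h2 : y 0 * charFun H c c₁ μ = 0 := by
      rw [charFun]
      linear_combination h1 - hz1 - H * this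
    exact (mul_eq_zero.1 h2).resolve_left hy0
  · intro h1
    refine ⟨c μ, c₁ μ, hc.isSolution μ, ?_, h1, 0, left_mem_Icc.2 Real.pi_pos.le, ?_⟩
    · rw [hc.apply_zero, hc.deriv_zero]; ring
    · rw [hc.apply_zero]; exact one_ne_zero

lemma continuous_charFun_sq (hc : IsCauchyPair q h c c₁) (hq : IntervalIntegrable q volume 0 π)
    (H : ℝ) : Continuous fun ρ => charFun H c c₁ (ρ ^ 2) := by
  obtain ⟨B, hB0, hB, hL⟩ := hc.exists_bound hq
  have hπ : π ∈ Icc 0 π := right_mem_Icc.2 Real.pi_pos.le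
  have hcc : ∀ x ∈ Icc 0 π, Continuous fun ρ => c (ρ ^ 2) x := by
    intro x hx
    refine (LipschitzWith.of_dist_le_mul (K := B.toNNReal) fun ρ σ => ?_).continuous
    rw [Real.dist_eq, Real.dist_eq, Real.coe_toNNReal _ hB0.le]
    exact hL ρ σ x hx
  simp only [charFun, hc.deriv_eq _ hπ]
  refine ((Continuous.add (by fun_prop) (by fun_prop)).add ?_).add
    (continuous_const.mul (hcc π hπ))
  refine intervalIntegral.continuous_of_dominated_interval (bound := fun s => |q s| * B) ?_ ?_
    (hq.abs.mul_const B) ?_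
  · intro ρ
    rw [uIoc_of_le Real.pi_pos.le]
    have h1 : IntervalIntegrable (fun s => Real.cos (ρ * (π - s)) * (q s * c (ρ ^ 2) s)) volume 0 π := by
      refine (hq.mul_continuousOn ?_).continuousOn_mul (by fun_prop)
      rw [uIcc_of_le Real.pi_pos.le]
      exact hc.continuousOn _
    exact h1.1.aestronglyMeasurable
  · intro ρ
    refine Eventually.of_forall fun s hs => ?_
    rw [uIoc_of_le Real.pi_pos.le] at hs
    rw [norm_mul, norm_mul]
    calc _ ≤ 1 * (‖q s‖ * ‖c (ρ ^ 2) s‖) :=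
          mul_le_mul_of_nonneg_right (Real.abs_cos_le_one _) (by positivity)
      _ ≤ _ := by
          rw [one_mul]
          exact mul_le_mul_of_nonneg_left (hB ρ s (Ioc_subset_Icc_self hs)) (norm_nonneg _)
  · refine Eventually.of_forall fun s hs => ?_
    rw [uIoc_of_le Real.pi_pos.le] at hs
    exact Continuous.mul (by fun_prop)
      (continuous_const.mul (hcc s (Ioc_subset_Icc_self hs)))

/-- In the variation of constants formula for `c'(π)` only the term `-ρ sin ρπ` grows. A bounded
remainder is enough to produce sign changes near large integers and to exhibit a point where the
characteristic function does not vanish. -/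
lemma exists_abs_charFun_le (hc : IsCauchyPair q h c c₁) (hq : IntervalIntegrable q volume 0 π)
    (H : ℝ) : ∃ C, 0 < C ∧ ∀ ρ, |charFun H c c₁ (ρ ^ 2) + ρ * Real.sin (ρ * π)| ≤ C := by
  obtain ⟨B, hB0, hB, -⟩ := hc.exists_bound hq
  have hQ0 : 0 ≤ ∫ s in (0 : ℝ)..π, |q s| :=
    intervalIntegral.integral_nonneg Real.pi_pos.le fun s _ => abs_nonneg _
  have hπ : π ∈ Icc 0 π := right_mem_Icc.2 Real.pi_pos.le
  refine ⟨|h| + (∫ s in (0 : ℝ)..π, |q s|) * B + |H| * B + 1, by positivity, fun ρ => ?_⟩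
  rw [charFun, hc.deriv_eq _ hπ]
  have h1 : |h * Real.cos (ρ * π)| ≤ |h| := by
    rw [abs_mul]
    exact mul_le_of_le_one_right (abs_nonneg _) (Real.abs_cos_le_one _)
  have h2 : |∫ s in (0 : ℝ)..π, Real.cos (ρ * (π - s)) * (q s * c (ρ ^ 2) s)|
      ≤ (∫ s in (0 : ℝ)..π, |q s|) * B := by
    have := integral_mul_bound (F := fun s => Real.cos (ρ * (π - s)) * c (ρ ^ 2) s) hq hπ hB0.le
      (fun s hs => by
        rw [abs_mul]
        refine (mul_le_of_le_one_left (abs_nonneg _) (Real.abs_cos_le_one _)).trans ?_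
        exact hB ρ s hs)
    simpa only [mul_left_comm] using this
  have h3 : |H * c (ρ ^ 2) π| ≤ |H| * B := by
    rw [abs_mul]
    exact mul_le_mul_of_nonneg_left (hB ρ π hπ) (abs_nonneg _)
  rw [show -(ρ * Real.sin (ρ * π)) + h * Real.cos (ρ * π)
      + (∫ s in (0 : ℝ)..π, Real.cos (ρ * (π - s)) * (q s * c (ρ ^ 2) s)) + H * c (ρ ^ 2) π
      + ρ * Real.sin (ρ * π) = h * Real.cos (ρ * π)
      + (∫ s in (0 : ℝ)..π, Real.cos (ρ * (π - s)) * (q s * c (ρ ^ 2) s)) + H * c (ρ ^ 2) π by ring]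
  refine (abs_add_le _ _).trans ?_
  have := abs_add_le (h * Real.cos (ρ * π))
    (∫ s in (0 : ℝ)..π, Real.cos (ρ * (π - s)) * (q s * c (ρ ^ 2) s))
  linarith

lemma sin_nat_mul_pi_add (n : ℕ) (d : ℝ) :
    Real.sin ((n + d) * π) = (-1) ^ n * Real.sin (d * π) := by
  rw [add_mul, add_comm, Real.sin_add_nat_mul_pi]

lemma cos_nat_mul_pi_add (n : ℕ) (d : ℝ) :
    Real.cos ((n + d) * π) = (-1) ^ n * Real.cos (d * π) := by
  rw [add_mul, add_comm, Real.cos_add_nat_mul_pi]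

/-- Existence of a square root of an eigenvalue near every large integer. -/
lemma exists_root_near_nat (hc : IsCauchyPair q h c c₁) (hq : IntervalIntegrable q volume 0 π)
    (H : ℝ) : ∃ A : ℝ, ∃ N : ℕ, 0 < A ∧ 1 ≤ N ∧ ∃ r : ℕ → ℝ, ∀ n, N ≤ n →
      charFun H c c₁ (r n ^ 2) = 0 ∧ |r n - n| ≤ A / n ∧ A / n ≤ 1 / 4 := by
  obtain ⟨C, hC0, hC⟩ := exists_abs_charFun_le hc hq H
  have hcont := continuous_charFun_sq hc hq H
  -- For `n ≥ 4C + 1` the radius `d = C / n` is at most `1/4`, and the leading term at `n ± d` is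
  -- larger than the bound `C` of the remainder.
  obtain ⟨N, hN⟩ := exists_nat_ge (4 * C + 1)
  have hN1 : 1 ≤ N := by
    have : (1 : ℝ) ≤ N := by linarith
    exact_mod_cast this
  have key : ∀ n : ℕ, N ≤ n → ∃ r : ℝ, charFun H c c₁ (r ^ 2) = 0 ∧ |r - n| ≤ C / n := by
    intro n hn
    have hnN : (N : ℝ) ≤ n := by exact_mod_cast hn
    have hn0 : (0 : ℝ) < n := by linarith
    set d := C / n with hd
    have hd0 : 0 < d := by positivity
    have hd4 : d ≤ 1 / 4 := by
      rw [hd, div_le_iff₀ hn0]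
      linarith
    -- Jordan's inequality `sin y ≥ 2y / π` on `[0, π/2]`.
    have hsin : 2 * d ≤ Real.sin (d * π) := by
      have := Real.mul_le_sin (x := d * π) (by positivity) (by nlinarith [Real.pi_pos])
      have e : 2 / π * (d * π) = 2 * d := by field_simp
      rwa [e] at this
    have hnd : C < (n - d) * (2 * d) := by
      have h1 : (n : ℝ) * d = C := by rw [hd]; field_simp
      have h2 : d * d ≤ d / 4 := by nlinarith
      have h3 : 4 * C + 1 ≤ n := by linarith
      have h4 : d * (4 * C + 1) ≤ d * n := mul_le_mul_of_nonneg_left h3 hd0.le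
      have h5 : 0 < C * d := by positivity
      have h6 : d ≤ C := by linarith
      linarith
    have hpl : ∀ ρ : ℝ, (n - d) ≤ ρ → C < ρ * Real.sin (d * π) := by
      intro ρ hρ
      refine hnd.trans_le (mul_le_mul hρ hsin (by positivity) ?_)
      linarith
    have hp := hC (n + d)
    have hm := hC (n - d)
    rw [sin_nat_mul_pi_add] at hp
    rw [sub_eq_add_neg, sin_nat_mul_pi_add, ← sub_eq_add_neg, neg_mul, Real.sin_neg] at hm
    have hp2 := hpl (n + d) (by linarith)
    have hm2 := hpl (n - d) le_rfl
    rw [abs_le] at hp hm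
    have hle : (n : ℝ) - d ≤ n + d := by linarith
    have hex : ∃ r ∈ Icc ((n : ℝ) - d) (n + d), charFun H c c₁ (r ^ 2) = 0 := by
      -- The parity of `n` decides whether the characteristic function passes from positive to
      -- negative or the other way.
      rcases neg_one_pow_eq_or ℝ n with h1 | h1
      · rw [h1] at hp hm
        have := intermediate_value_Icc' hle hcont.continuousOn
        have h0 : (0 : ℝ) ∈ Icc (charFun H c c₁ ((n + d : ℝ) ^ 2)) (charFun H c c₁ ((n - d : ℝ) ^ 2)) :=
          ⟨by linarith [hp.2], by linarith [hm.1]⟩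
        obtain ⟨r, hr, hr0⟩ := this h0
        exact ⟨r, hr, hr0⟩
      · rw [h1] at hp hm
        have := intermediate_value_Icc hle hcont.continuousOn
        have h0 : (0 : ℝ) ∈ Icc (charFun H c c₁ ((n - d : ℝ) ^ 2)) (charFun H c c₁ ((n + d : ℝ) ^ 2)) :=
          ⟨by linarith [hm.2], by linarith [hp.1]⟩
        obtain ⟨r, hr, hr0⟩ := this h0
        exact ⟨r, hr, hr0⟩
    obtain ⟨r, hr, hr0⟩ := hex
    exact ⟨r, hr0, abs_le.2 ⟨by linarith [hr.1], by linarith [hr.2]⟩⟩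
  refine ⟨C, N, hC0, hN1, fun n => if hn : N ≤ n then (key n hn).choose else 0, fun n hn => ?_⟩
  simp only [hn, dif_pos]
  refine ⟨(key n hn).choose_spec.1, (key n hn).choose_spec.2, ?_⟩
  have hnN : (N : ℝ) ≤ n := by exact_mod_cast hn
  rw [div_le_iff₀ (by linarith)]
  linarith

end Cauchy

/-! ### Asymptotics of the roots and of the weight numbers -/

section Asymptotics

variable {q : ℝ → ℝ} {h : ℝ} {c c₁ : ℝ → ℝ → ℝ}

lemma IsCauchyPair.intervalIntegrable_mul (hc : IsCauchyPair q h c c₁)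
    (hq : IntervalIntegrable q volume 0 π) (μ : ℝ) :
    IntervalIntegrable (fun s => q s * c μ s) volume 0 π :=
  hq.mul_continuousOn (by rw [uIcc_of_le Real.pi_pos.le]; exact hc.continuousOn μ)

/-- Replacing `c` by the cosine in the variation of constants formula costs `O(1/ρ)`. The product
`cos ρ(π - s) cos ρs` is then half of `cos ρπ`, whose integral against `q` is absorbed into `ω`,
plus half of `cos ρ(π - 2s)`, which at an integer is a Fourier coefficient of `q` up to sign. -/
lemma exists_charFun_asymptotics (hc : IsCauchyPair q h c c₁)
    (hq : IntervalIntegrable q volume 0 π) (H : ℝ) :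
    ∃ C, 0 < C ∧ ∀ ρ, 0 < ρ → |charFun H c c₁ (ρ ^ 2) + ρ * Real.sin (ρ * π)
      - omega q h H * Real.cos (ρ * π)
      - (1 / 2) * ∫ s in (0 : ℝ)..π, q s * Real.cos (ρ * (π - 2 * s))| ≤ C / ρ := by
  obtain ⟨B, hB0, hB⟩ := hc.exists_abs_sub_cos_le hq
  have hQ0 : 0 ≤ ∫ s in (0 : ℝ)..π, |q s| :=
    intervalIntegral.integral_nonneg Real.pi_pos.le fun s _ => abs_nonneg _
  have hπ : π ∈ Icc 0 π := right_mem_Icc.2 Real.pi_pos.le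
  refine ⟨(∫ s in (0 : ℝ)..π, |q s|) * B + |H| * B + 1, by positivity, fun ρ hρ => ?_⟩
  have i1 : IntervalIntegrable (fun s => q s * Real.cos (ρ * (π - 2 * s))) volume 0 π :=
    hq.mul_continuousOn (by fun_prop)
  have i2 : IntervalIntegrable (fun s => Real.cos (ρ * (π - s)) * (q s * c (ρ ^ 2) s)) volume 0 π :=
    (hc.intervalIntegrable_mul hq _).continuousOn_mul (by fun_prop)
  have e : (∫ s in (0 : ℝ)..π, Real.cos (ρ * (π - s)) * (q s * c (ρ ^ 2) s))
      - ((1 / 2) * Real.cos (ρ * π) * ∫ s in (0 : ℝ)..π, q s)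
      - (1 / 2) * ∫ s in (0 : ℝ)..π, q s * Real.cos (ρ * (π - 2 * s))
      = ∫ s in (0 : ℝ)..π, q s * (Real.cos (ρ * (π - s)) * (c (ρ ^ 2) s - Real.cos (ρ * s))) := by
    rw [← intervalIntegral.integral_const_mul, ← intervalIntegral.integral_const_mul,
      ← intervalIntegral.integral_sub i2 (hq.const_mul _),
      ← intervalIntegral.integral_sub (i2.sub (hq.const_mul _)) (i1.const_mul _)]
    refine intervalIntegral.integral_congr fun s _ => ?_
    have h1 : Real.cos (ρ * (π - s)) * Real.cos (ρ * s)
        = (1 / 2) * Real.cos (ρ * π) + (1 / 2) * Real.cos (ρ * (π - 2 * s)) := by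
      rw [show ρ * π = ρ * (π - s) + ρ * s by ring,
        show ρ * (π - 2 * s) = ρ * (π - s) - ρ * s by ring, Real.cos_add, Real.cos_sub]
      ring
    linear_combination (q s) * h1
  have h1 := integral_mul_bound (F := fun s => Real.cos (ρ * (π - s))
      * (c (ρ ^ 2) s - Real.cos (ρ * s))) hq hπ (B := B / ρ) (by positivity) (fun s hs => by
    rw [abs_mul]
    exact (mul_le_of_le_one_left (abs_nonneg _) (Real.abs_cos_le_one _)).trans (hB ρ hρ s hs))
  rw [← e] at h1
  have h2 : |H * (c (ρ ^ 2) π - Real.cos (ρ * π))| ≤ |H| * (B / ρ) := by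
    rw [abs_mul]
    exact mul_le_mul_of_nonneg_left (hB ρ hρ π hπ) (abs_nonneg _)
  rw [charFun, hc.deriv_eq _ hπ, omega]
  have h3 := (abs_add_le _ _).trans (add_le_add h1 h2)
  have h4 : (∫ s in (0 : ℝ)..π, |q s|) * (B / ρ) + |H| * (B / ρ)
      ≤ ((∫ s in (0 : ℝ)..π, |q s|) * B + |H| * B + 1) / ρ := by
    rw [add_div, add_div, mul_div_assoc', mul_div_assoc']
    have : 0 < 1 / ρ := by positivity
    linarith
  refine le_trans (le_of_eq ?_) (h3.trans h4)
  congr 1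
  ring

lemma abs_sin_sub_self_le {x : ℝ} (hx : |x| ≤ 1) : |Real.sin x - x| ≤ |x| ^ 3 := by
  have h1 := Real.sin_bound hx
  have h2 : |x ^ 3 / 6| = |x| ^ 3 / 6 := by rw [abs_div, abs_pow]; norm_num
  have h3 : |x| ^ 5 ≤ |x| ^ 3 := pow_le_pow_of_le_one (abs_nonneg _) hx (by norm_num)
  have h4 : |Real.sin x - x| ≤ |Real.sin x - (x - x ^ 3 / 6)| + |x ^ 3 / 6| := by
    have := abs_sub (Real.sin x - (x - x ^ 3 / 6)) (x ^ 3 / 6)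
    refine le_trans (le_of_eq ?_) this
    congr 1
    ring
  have h5 : 0 ≤ |x| ^ 3 := by positivity
  linarith

lemma abs_cos_sub_one_le (x : ℝ) : |Real.cos x - 1| ≤ x ^ 2 / 2 := by
  rw [abs_sub_comm, abs_of_nonneg (by linarith [Real.cos_le_one x])]
  linarith [Real.one_sub_sq_div_two_le_cos (x := x)]

set_option maxHeartbeats 1000000 in
/-- Asymptotics of the square roots of the eigenvalues. -/
lemma exists_root_asymptotics (hc : IsCauchyPair q h c c₁) (hq : IntervalIntegrable q volume 0 π)
    (H : ℝ) {A : ℝ} (hA : 0 < A) :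
    ∃ C, 0 < C ∧ ∀ (n : ℕ) (r : ℝ), 1 ≤ n → charFun H c c₁ (r ^ 2) = 0 → |r - n| ≤ A / n →
      A / n ≤ 1 / 4 → |r - n - omega q h H / (π * n)|
        ≤ C / n * (|∫ s in (0 : ℝ)..π, q s * Real.cos ((2 * n : ℕ) * s)| + 1 / n) := by
  obtain ⟨C, hC0, hC⟩ := exists_charFun_asymptotics hc hq H
  set Q := ∫ s in (0 : ℝ)..π, |q s| with hQ
  have hQ0 : 0 ≤ Q := intervalIntegral.integral_nonneg Real.pi_pos.le fun s _ => abs_nonneg _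
  have hπ := Real.pi_pos
  have hπm : π ∈ Icc 0 π := right_mem_Icc.2 Real.pi_pos.le
  set ω := omega q h H
  set D := 2 * C + π * A ^ 2 + π ^ 3 * A ^ 3 + |ω| * (π ^ 2 * A ^ 2) + Q * (π * A) with hD
  have hD0 : 0 < D := by positivity
  refine ⟨1 + D, by positivity, fun n r hn hr hrn hA4 => ?_⟩
  have hn1 : (1 : ℝ) ≤ n := by exact_mod_cast hn
  have hn0 : (0 : ℝ) < n := by linarith
  set e := r - n with he
  have hre : r = n + e := by rw [he]; ring
  have he4 : |e| ≤ 1 / 4 := hrn.trans hA4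
  have hr2 : (n : ℝ) / 2 ≤ r := by
    have := (abs_le.1 he4).1
    rw [hre]
    linarith
  have hr0 : 0 < r := by linarith
  set a := ∫ s in (0 : ℝ)..π, q s * Real.cos ((2 * n : ℕ) * s) with ha
  have h0 := hC r hr0
  rw [hr, zero_add] at h0
  have hinv : C / r ≤ 2 * C / n := by
    rw [div_le_div_iff₀ hr0 hn0]
    nlinarith
  set σ : ℝ := (-1) ^ n with hσ
  have hσσ : σ * σ = 1 := by rw [hσ, ← mul_pow]; norm_num
  have hσa : |σ| = 1 := by rw [hσ, abs_pow, abs_neg, abs_one, one_pow]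
  have hs1 : Real.sin (r * π) = σ * Real.sin (e * π) := by rw [hre, sin_nat_mul_pi_add]
  have hc1 : Real.cos (r * π) = σ * Real.cos (e * π) := by rw [hre, cos_nat_mul_pi_add]
  -- the Fourier coefficient
  have hf : |(∫ s in (0 : ℝ)..π, q s * Real.cos (r * (π - 2 * s))) - σ * a| ≤ Q * (π * (A / n)) := by
    have e1 : (∫ s in (0 : ℝ)..π, q s * Real.cos (r * (π - 2 * s))) - σ * a
        = ∫ s in (0 : ℝ)..π, q s * (Real.cos (r * (π - 2 * s)) - Real.cos (n * (π - 2 * s))) := by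
      rw [ha, ← intervalIntegral.integral_const_mul, ← intervalIntegral.integral_sub]
      · refine intervalIntegral.integral_congr fun s _ => ?_
        have : Real.cos (n * (π - 2 * s)) = σ * Real.cos ((2 * n : ℕ) * s) := by
          rw [show (n : ℝ) * (π - 2 * s) = -((2 * n : ℕ) * s) + n * π by push_cast; ring,
            Real.cos_add_nat_mul_pi, Real.cos_neg]
        simp only [this]
        ring
      · exact hq.mul_continuousOn (by fun_prop)
      · exact (hq.mul_continuousOn (by fun_prop)).const_mul _
    rw [e1]
    refine integral_mul_bound hq hπm (by positivity) fun s hs => ?_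
    refine (abs_cos_sub_cos_le _ _).trans ?_
    rw [← sub_mul, abs_mul, mul_comm]
    refine mul_le_mul ?_ hrn (abs_nonneg _) hπ.le
    exact abs_le.2 ⟨by linarith [hs.2], by linarith [hs.1]⟩
  -- everything multiplied by `σ`
  have h1 : |r * Real.sin (e * π) - ω * Real.cos (e * π) - (1 / 2) * a|
      ≤ 2 * C / n + (1 / 2) * (Q * (π * (A / n))) := by
    have e2 : r * Real.sin (e * π) - ω * Real.cos (e * π) - (1 / 2) * a
        = σ * (r * Real.sin (r * π) - ω * Real.cos (r * π)
          - (1 / 2) * ∫ s in (0 : ℝ)..π, q s * Real.cos (r * (π - 2 * s)))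
          + σ * ((1 / 2) * ((∫ s in (0 : ℝ)..π, q s * Real.cos (r * (π - 2 * s))) - σ * a)) := by
      rw [hs1, hc1]
      linear_combination (-(r * Real.sin (e * π) - ω * Real.cos (e * π)) + a / 2) * hσσ
    rw [e2]
    refine (abs_add_le _ _).trans (add_le_add ?_ ?_)
    · rw [abs_mul, hσa, one_mul]
      exact h0.trans hinv
    · rw [abs_mul, hσa, one_mul, abs_mul, abs_of_pos (by norm_num : (0 : ℝ) < 1 / 2)]
      exact mul_le_mul_of_nonneg_left hf (by norm_num)
  have hnn : 1 / (n : ℝ) ^ 2 ≤ 1 / n := by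
    rw [div_le_div_iff₀ (by positivity) hn0]
    nlinarith
  have hee : e ^ 2 ≤ A ^ 2 * (1 / n) := by
    have : |e| ^ 2 ≤ (A / n) ^ 2 := pow_le_pow_left₀ (abs_nonneg _) hrn 2
    rw [sq_abs] at this
    refine this.trans ?_
    rw [div_pow, div_eq_mul_one_div]
    exact mul_le_mul_of_nonneg_left hnn (by positivity)
  have hex : |e * π| ≤ 1 := by
    rw [abs_mul, abs_of_pos hπ]
    nlinarith [Real.pi_lt_four, abs_nonneg e]
  -- Writing `r = n + e`, the errors are of order `e²` and `n |e|³`, both `O(1/n)` because `|e| ≤ A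
  -- / n`.
  have h2 : |r * Real.sin (e * π) - n * π * e| ≤ π * A ^ 2 * (1 / n) + π ^ 3 * A ^ 3 * (1 / n) := by
    have e3 : r * Real.sin (e * π) - n * π * e
        = e * Real.sin (e * π) + n * (Real.sin (e * π) - e * π) := by rw [hre]; ring
    rw [e3]
    refine (abs_add_le _ _).trans (add_le_add ?_ ?_)
    · rw [abs_mul]
      have h3 : |Real.sin (e * π)| ≤ |e * π| := Real.abs_sin_le_abs
      calc |e| * |Real.sin (e * π)| ≤ |e| * |e * π| :=
            mul_le_mul_of_nonneg_left h3 (abs_nonneg _)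
        _ = π * e ^ 2 := by rw [abs_mul, abs_of_pos hπ, ← sq_abs e]; ring
        _ ≤ π * (A ^ 2 * (1 / n)) := mul_le_mul_of_nonneg_left hee hπ.le
        _ = _ := by ring
    · rw [abs_mul, abs_of_pos hn0]
      have h3 := abs_sin_sub_self_le hex
      calc (n : ℝ) * |Real.sin (e * π) - e * π| ≤ n * |e * π| ^ 3 :=
            mul_le_mul_of_nonneg_left h3 hn0.le
        _ = n * π ^ 3 * |e| ^ 3 := by rw [abs_mul, abs_of_pos hπ]; ring
        _ ≤ n * π ^ 3 * (A / n) ^ 3 := by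
            refine mul_le_mul_of_nonneg_left (pow_le_pow_left₀ (abs_nonneg _) hrn 3) (by positivity)
        _ = π ^ 3 * A ^ 3 * (1 / n ^ 2) := by field_simp
        _ ≤ _ := mul_le_mul_of_nonneg_left hnn (by positivity)
  have h3 : |ω * Real.cos (e * π) - ω| ≤ |ω| * (π ^ 2 * A ^ 2) * (1 / n) := by
    rw [show ω * Real.cos (e * π) - ω = ω * (Real.cos (e * π) - 1) by ring, abs_mul, mul_assoc]
    refine mul_le_mul_of_nonneg_left ((abs_cos_sub_one_le _).trans ?_) (abs_nonneg _)
    have h4 : 0 ≤ π ^ 2 * e ^ 2 := by positivity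
    have h5 := mul_le_mul_of_nonneg_left hee (sq_nonneg π)
    rw [mul_pow, mul_comm, mul_assoc]
    linarith
  have h4 : |n * π * e - ω| ≤ |a| + D / n := by
    have e4 : n * π * e - ω = (1 / 2) * a
        + ((r * Real.sin (e * π) - ω * Real.cos (e * π) - (1 / 2) * a)
        - (r * Real.sin (e * π) - n * π * e) + (ω * Real.cos (e * π) - ω)) := by ring
    rw [e4]
    refine (abs_add_le _ _).trans (add_le_add ?_ ?_)
    · rw [abs_mul, abs_of_pos (by norm_num : (0 : ℝ) < 1 / 2)]
      linarith [abs_nonneg a]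
    · refine (abs_add_le _ _).trans ((add_le_add ((abs_sub _ _).trans (add_le_add h1 h2)) h3).trans ?_)
      have : D / n = 2 * C / n + Q * (π * (A / n)) + (π * A ^ 2 * (1 / n) + π ^ 3 * A ^ 3 * (1 / n))
          + |ω| * (π ^ 2 * A ^ 2) * (1 / n) := by
        rw [hD]; ring
      rw [this]
      have : 0 ≤ Q * (π * (A / n)) := by positivity
      linarith
  have e5 : e - ω / (π * n) = (n * π * e - ω) / (π * n) := by field_simp
  rw [e5, abs_div, abs_of_pos (by positivity : (0 : ℝ) < π * n), div_le_iff₀ (by positivity)]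
  refine h4.trans ?_
  have e6 : (1 + D) / n * (|a| + 1 / n) * (π * n) = (1 + D) * (|a| + 1 / n) * π := by
    field_simp
  rw [e6]
  have h5 : 0 ≤ |a| := abs_nonneg a
  have h6 : 0 < 1 / (n : ℝ) := by positivity
  have h7 : D / n = D * (1 / n) := by ring
  rw [h7]
  have h8 : |a| + D * (1 / n) ≤ (1 + D) * (|a| + 1 / n) := by
    rw [show (1 + D) * (|a| + 1 / n) = |a| + D * (1 / n) + (D * |a| + 1 / n) by ring]
    exact le_add_of_nonneg_right (by positivity)
  have h9 : 0 ≤ (1 + D) * (|a| + 1 / n) := by positivity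
  exact h8.trans (le_mul_of_one_le_right h9 (by linarith [Real.pi_gt_three]))

lemma integral_cos_mul_sin_sub {ρ : ℝ} (hρ : ρ ≠ 0) (s : ℝ) :
    ∫ x in s..π, Real.cos (ρ * x) * Real.sin (ρ * (x - s))
      = (Real.cos (ρ * s) - Real.cos (ρ * (2 * π - s))) / (4 * ρ)
        - (π - s) * Real.sin (ρ * s) / 2 := by
  have hd : ∀ x ∈ uIcc s π, HasDerivAt
      (fun x => -(Real.cos (ρ * (2 * x - s)) / (4 * ρ)) - x * (Real.sin (ρ * s) / 2))
      (Real.cos (ρ * x) * Real.sin (ρ * (x - s))) x := by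
    intro x _
    have h1 : HasDerivAt (fun x => ρ * (2 * x - s)) (ρ * 2) x := by
      simpa using (((hasDerivAt_id x).const_mul 2).sub_const s).const_mul ρ
    have h2 := (h1.cos.div_const (4 * ρ)).neg.sub ((hasDerivAt_id x).mul_const (Real.sin (ρ * s) / 2))
    convert! h2 using 1
    rw [show ρ * (2 * x - s) = ρ * x + ρ * (x - s) by ring,
      show ρ * s = ρ * x - ρ * (x - s) by ring, Real.sin_add, Real.sin_sub]
    field_simp
    ring
  rw [intervalIntegral.integral_eq_sub_of_hasDerivAt hd
    (by apply Continuous.intervalIntegrable; fun_prop)]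
  rw [show 2 * s - s = s by ring]
  ring

lemma abs_integral_cos_mul_sin_le {ρ : ℝ} (hρ : 0 < ρ) :
    |∫ x in (0 : ℝ)..π, Real.cos (ρ * x) * Real.sin (ρ * x)| ≤ 1 / ρ := by
  have := integral_cos_mul_sin_sub hρ.ne' 0
  simp only [sub_zero, mul_zero, Real.sin_zero, zero_div, Real.cos_zero] at this
  rw [this, abs_div, abs_of_pos (by positivity : (0 : ℝ) < 4 * ρ), div_le_div_iff₀ (by positivity) hρ]
  have h1 := Real.cos_le_one (ρ * (2 * π))
  have h2 := Real.neg_one_le_cos (ρ * (2 * π))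
  rw [abs_of_nonneg (by linarith)]
  nlinarith

/-- Write `c² - cos² = 2 cos · (c - cos) + (c - cos)²`. The square is `O(ρ⁻²)`. In the cross term
variation of constants and Fubini bring `q` outside; replacing the remaining `c` by the cosine
leaves, to first order, the sine coefficient of `(π - s) q(s)`. -/
lemma exists_weight_asymptotics_real (hc : IsCauchyPair q h c c₁)
    (hq : IntervalIntegrable q volume 0 π) :
    ∃ C, 0 < C ∧ ∀ ρ, (1 / 2 : ℝ) ≤ ρ → |(∫ x in (0 : ℝ)..π, c (ρ ^ 2) x ^ 2)
      - (∫ x in (0 : ℝ)..π, Real.cos (ρ * x) ^ 2)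
      + 1 / (2 * ρ) * ∫ s in (0 : ℝ)..π, q s * ((π - s) * Real.sin (2 * ρ * s))| ≤ C / ρ ^ 2 := by
  obtain ⟨B, hB0, hB⟩ := hc.exists_abs_sub_cos_le hq
  set Q := ∫ s in (0 : ℝ)..π, |q s| with hQ
  have hQ0 : 0 ≤ Q := intervalIntegral.integral_nonneg Real.pi_pos.le fun s _ => abs_nonneg _
  have hπ := Real.pi_pos
  have hπm : π ∈ Icc 0 π := right_mem_Icc.2 Real.pi_pos.le
  refine ⟨2 * (|h| + Q + Q * (3 * B)) + π * B ^ 2 + 1, by positivity, fun ρ hρ2 => ?_⟩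
  have hρ : 0 < ρ := by linarith
  set y := c (ρ ^ 2) with hy
  have hyc : ContinuousOn y (Icc 0 π) := hc.continuousOn _
  have hyc' : ContinuousOn y (uIcc 0 π) := by rwa [uIcc_of_le hπ.le]
  set b := ∫ s in (0 : ℝ)..π, q s * ((π - s) * Real.sin (2 * ρ * s)) with hb
  -- The value of `∫ cos ρx sin ρ(x - s) dx` over `[s, π]`. Its first summand is `O(1/ρ)`; the
  -- second one produces the main term.
  set inner : ℝ → ℝ := fun s => (Real.cos (ρ * s) - Real.cos (ρ * (2 * π - s))) / (4 * ρ)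
        - (π - s) * Real.sin (ρ * s) / 2 with hinner
  have hR : ∀ s, |(Real.cos (ρ * s) - Real.cos (ρ * (2 * π - s))) / (4 * ρ)| ≤ 1 / (2 * ρ) := by
    intro s
    rw [abs_div, abs_of_pos (by positivity : (0 : ℝ) < 4 * ρ), div_le_div_iff₀ (by positivity)
      (by positivity)]
    have := abs_sub (Real.cos (ρ * s)) (Real.cos (ρ * (2 * π - s)))
    have h1 := Real.abs_cos_le_one (ρ * s)
    have h2 := Real.abs_cos_le_one (ρ * (2 * π - s))
    nlinarith
  have hinner3 : ∀ s ∈ Icc 0 π, |inner s| ≤ 3 := by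
    intro s hs
    refine (abs_sub _ _).trans ?_
    have h1 : 1 / (2 * ρ) ≤ 1 := by rw [div_le_one (by positivity)]; linarith
    have h2 : |(π - s) * Real.sin (ρ * s) / 2| ≤ 2 := by
      rw [abs_div, abs_mul, abs_of_nonneg (by linarith [hs.2] : 0 ≤ π - s),
        abs_of_pos (by norm_num : (0 : ℝ) < 2), div_le_iff₀ (by norm_num)]
      have h3 := Real.abs_sin_le_one (ρ * s)
      nlinarith [Real.pi_lt_four, hs.1, hs.2, abs_nonneg (Real.sin (ρ * s))]
    linarith [hR s]
  have hinnerc : Continuous inner := by rw [hinner]; fun_prop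
  have hqy := hc.intervalIntegrable_mul hq (ρ ^ 2)
  -- the inner product of `cos` with the correction
  have hswap : ∫ x in (0 : ℝ)..π, Real.cos (ρ * x)
        * ∫ s in (0 : ℝ)..x, Real.sin (ρ * (x - s)) * (q s * y s)
      = ∫ s in (0 : ℝ)..π, q s * (y s * inner s) := by
    have := integral_triangle_swap_mul (F := fun x s => Real.cos (ρ * x) * Real.sin (ρ * (x - s)))
      hπm hqy (by unfold Function.uncurry; fun_prop)
    rw [show (∫ s in (0 : ℝ)..π, q s * (y s * inner s)) = ∫ s in (0 : ℝ)..π, q s * c (ρ ^ 2) s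
      * ∫ ξ in s..π, Real.cos (ρ * ξ) * Real.sin (ρ * (ξ - s)) by
        refine intervalIntegral.integral_congr fun s _ => ?_
        simp only [integral_cos_mul_sin_sub hρ.ne']
        ring, ← this]
    refine intervalIntegral.integral_congr fun x _ => ?_
    rw [← intervalIntegral.integral_const_mul]
    refine intervalIntegral.integral_congr fun s _ => ?_
    ring
  have hcosinner : |(∫ s in (0 : ℝ)..π, q s * (Real.cos (ρ * s) * inner s)) + (1 / 4) * b|
      ≤ Q * (1 / (2 * ρ)) := by
    have e1 : (∫ s in (0 : ℝ)..π, q s * (Real.cos (ρ * s) * inner s)) + (1 / 4) * b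
        = ∫ s in (0 : ℝ)..π, q s * (Real.cos (ρ * s)
          * ((Real.cos (ρ * s) - Real.cos (ρ * (2 * π - s))) / (4 * ρ))) := by
      rw [hb, ← intervalIntegral.integral_const_mul, ← intervalIntegral.integral_add]
      · refine intervalIntegral.integral_congr fun s _ => ?_
        simp only [hinner]
        rw [show 2 * ρ * s = 2 * (ρ * s) by ring, Real.sin_two_mul]
        ring
      · exact hq.mul_continuousOn (by fun_prop)
      · exact (hq.mul_continuousOn (by fun_prop)).const_mul _
    rw [e1]
    refine integral_mul_bound hq hπm (by positivity) fun s _ => ?_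
    rw [abs_mul]
    exact (mul_le_of_le_one_left (abs_nonneg _) (Real.abs_cos_le_one _)).trans (hR s)
  have hdiff : |(∫ s in (0 : ℝ)..π, q s * (y s * inner s))
      - ∫ s in (0 : ℝ)..π, q s * (Real.cos (ρ * s) * inner s)| ≤ Q * (B / ρ * 3) := by
    rw [← intervalIntegral.integral_sub]
    · rw [intervalIntegral.integral_congr (g := fun s => q s * ((y s - Real.cos (ρ * s)) * inner s))
        (fun s _ => by ring)]
      refine integral_mul_bound hq hπm (by positivity) fun s hs => ?_
      rw [abs_mul]
      exact mul_le_mul (hB ρ hρ s hs) (hinner3 s hs) (abs_nonneg _) (by positivity)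
    · exact hq.mul_continuousOn (hyc'.mul hinnerc.continuousOn)
    · exact hq.mul_continuousOn (by fun_prop)
  have hcd : |ρ * (∫ x in (0 : ℝ)..π, Real.cos (ρ * x) * (y x - Real.cos (ρ * x))) + (1 / 4) * b|
      ≤ (|h| + Q + Q * (3 * B)) / ρ := by
    have hJ : ContinuousOn (fun x => ∫ s in (0 : ℝ)..x, Real.sin (ρ * (x - s)) * (q s * y s))
        (Icc 0 π) := by
      have : ContinuousOn (fun x => ρ * (y x - Real.cos (ρ * x)) - h * Real.sin (ρ * x))
          (Icc 0 π) := by fun_prop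
      refine this.congr fun x hx => ?_
      simp only
      rw [hy, hc.eq_cos_add hρ.ne' hx]
      field_simp
      ring
    have e2 : ρ * (∫ x in (0 : ℝ)..π, Real.cos (ρ * x) * (y x - Real.cos (ρ * x)))
        = h * (∫ x in (0 : ℝ)..π, Real.cos (ρ * x) * Real.sin (ρ * x))
          + ∫ x in (0 : ℝ)..π, Real.cos (ρ * x)
            * ∫ s in (0 : ℝ)..x, Real.sin (ρ * (x - s)) * (q s * y s) := by
      rw [← intervalIntegral.integral_const_mul, ← intervalIntegral.integral_const_mul,
        ← intervalIntegral.integral_add]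
      · refine intervalIntegral.integral_congr fun x hx => ?_
        rw [uIcc_of_le hπ.le] at hx
        simp only [hy]
        rw [hc.eq_cos_add hρ.ne' hx]
        field_simp
        ring
      · apply Continuous.intervalIntegrable; fun_prop
      · refine ContinuousOn.intervalIntegrable ?_
        rw [uIcc_of_le hπ.le]
        exact ContinuousOn.mul (by fun_prop) hJ
    rw [e2, hswap]
    have h1 : |h * (∫ x in (0 : ℝ)..π, Real.cos (ρ * x) * Real.sin (ρ * x))| ≤ |h| * (1 / ρ) := by
      rw [abs_mul]
      exact mul_le_mul_of_nonneg_left (abs_integral_cos_mul_sin_le hρ) (abs_nonneg _)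
    have h2 := (abs_add_le _ _).trans (add_le_add h1 ((abs_add_le _ _).trans
      (add_le_add hdiff hcosinner)))
    refine le_trans (le_of_eq ?_) (h2.trans ?_)
    · congr 1
      ring
    · have : Q * (1 / (2 * ρ)) = Q / ρ / 2 := by field_simp
      rw [this]
      have h3 : 0 ≤ Q / ρ := by positivity
      have h4 : (|h| + Q + Q * (3 * B)) / ρ = |h| * (1 / ρ) + Q / ρ + Q * (B / ρ * 3) := by ring
      rw [h4]
      linarith
  have hsq : |∫ x in (0 : ℝ)..π, (y x - Real.cos (ρ * x)) ^ 2| ≤ π * (B / ρ) ^ 2 := by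
    have := intervalIntegral.norm_integral_le_of_norm_le_const (a := 0) (b := π)
      (f := fun x => (y x - Real.cos (ρ * x)) ^ 2) (C := (B / ρ) ^ 2) (fun x hx => by
        rw [uIoc_of_le hπ.le] at hx
        rw [norm_pow]
        exact pow_le_pow_left₀ (norm_nonneg _) (hB ρ hρ x (Ioc_subset_Icc_self hx)) 2)
    rw [sub_zero, abs_of_pos hπ, Real.norm_eq_abs] at this
    linarith
  have e3 : (∫ x in (0 : ℝ)..π, y x ^ 2) - (∫ x in (0 : ℝ)..π, Real.cos (ρ * x) ^ 2)
      = 2 * (∫ x in (0 : ℝ)..π, Real.cos (ρ * x) * (y x - Real.cos (ρ * x)))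
        + ∫ x in (0 : ℝ)..π, (y x - Real.cos (ρ * x)) ^ 2 := by
    have c1 : ContinuousOn (fun x => Real.cos (ρ * x)) (uIcc 0 π) := by fun_prop
    have c2 : ContinuousOn (fun x => y x ^ 2) (uIcc 0 π) := hyc'.pow 2
    have c3 : ContinuousOn (fun x => Real.cos (ρ * x) ^ 2) (uIcc 0 π) := c1.pow 2
    rw [← intervalIntegral.integral_sub c2.intervalIntegrable c3.intervalIntegrable, ← intervalIntegral.integral_const_mul,
      ← intervalIntegral.integral_add]
    · refine intervalIntegral.integral_congr fun x _ => ?_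
      ring
    · exact ((c1.mul (hyc'.sub c1)).intervalIntegrable).const_mul 2
    · exact ((hyc'.sub c1).pow 2).intervalIntegrable
  have e4 : (∫ x in (0 : ℝ)..π, y x ^ 2) - (∫ x in (0 : ℝ)..π, Real.cos (ρ * x) ^ 2)
      + 1 / (2 * ρ) * b
      = (2 / ρ) * (ρ * (∫ x in (0 : ℝ)..π, Real.cos (ρ * x) * (y x - Real.cos (ρ * x)))
        + (1 / 4) * b) + ∫ x in (0 : ℝ)..π, (y x - Real.cos (ρ * x)) ^ 2 := by
    rw [e3]
    field_simp
    ring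
  rw [e4]
  refine (abs_add_le _ _).trans ?_
  rw [abs_mul, abs_of_pos (by positivity : (0 : ℝ) < 2 / ρ)]
  have h5 := mul_le_mul_of_nonneg_left hcd (by positivity : (0 : ℝ) ≤ 2 / ρ)
  have e5 : (2 * (|h| + Q + Q * (3 * B)) + π * B ^ 2 + 1) / ρ ^ 2
      = 2 / ρ * ((|h| + Q + Q * (3 * B)) / ρ) + π * (B / ρ) ^ 2 + 1 / ρ ^ 2 := by
    field_simp
  rw [e5]
  have : 0 < 1 / ρ ^ 2 := by positivity
  linarith

/-- Asymptotics of the weight numbers. -/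
lemma exists_weight_asymptotics (hc : IsCauchyPair q h c c₁)
    (hq : IntervalIntegrable q volume 0 π) {A : ℝ} (hA : 0 < A) :
    ∃ C, 0 < C ∧ ∀ (n : ℕ) (r : ℝ), 1 ≤ n → |r - n| ≤ A / n → A / n ≤ 1 / 4 →
      |(∫ x in (0 : ℝ)..π, c (r ^ 2) x ^ 2) - π / 2|
        ≤ C / n * (|∫ s in (0 : ℝ)..π, q s * (π - s) * Real.sin ((2 * n : ℕ) * s)| + 1 / n) := by
  obtain ⟨C, hC0, hC⟩ := exists_weight_asymptotics_real hc hq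
  set Q := ∫ s in (0 : ℝ)..π, |q s| with hQ
  have hQ0 : 0 ≤ Q := intervalIntegral.integral_nonneg Real.pi_pos.le fun s _ => abs_nonneg _
  have hπ := Real.pi_pos
  have hπm : π ∈ Icc 0 π := right_mem_Icc.2 Real.pi_pos.le
  refine ⟨4 * C + 1 + 2 * π ^ 2 * Q * A + π * A, by positivity, fun n r hn hrn hA4 => ?_⟩
  have hn1 : (1 : ℝ) ≤ n := by exact_mod_cast hn
  have hn0 : (0 : ℝ) < n := by linarith
  have he4 := abs_le.1 (hrn.trans hA4)
  have hr2 : (n : ℝ) / 2 ≤ r := by linarith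
  have hr0 : 0 < r := by linarith
  have h1 := hC r (by linarith)
  set a := ∫ s in (0 : ℝ)..π, q s * (π - s) * Real.sin ((2 * n : ℕ) * s) with ha
  set b := ∫ s in (0 : ℝ)..π, q s * ((π - s) * Real.sin (2 * r * s)) with hb
  have hab : |b - a| ≤ Q * (2 * π ^ 2 * (A / n)) := by
    rw [hb, ha, ← intervalIntegral.integral_sub]
    · rw [intervalIntegral.integral_congr (g := fun s => q s * ((π - s)
        * (Real.sin (2 * r * s) - Real.sin ((2 * n : ℕ) * s)))) (fun s _ => by ring)]
      refine integral_mul_bound hq hπm (by positivity) fun s hs => ?_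
      rw [abs_mul, abs_of_nonneg (by linarith [hs.2] : 0 ≤ π - s)]
      have h2 : |Real.sin (2 * r * s) - Real.sin ((2 * n : ℕ) * s)| ≤ 2 * π * (A / n) := by
        refine (abs_sin_sub_sin_le _ _).trans ?_
        rw [show 2 * r * s - ((2 * n : ℕ) : ℝ) * s = 2 * s * (r - n) by push_cast; ring, abs_mul,
          abs_of_nonneg (by linarith [hs.1] : 0 ≤ 2 * s)]
        exact mul_le_mul (by linarith [hs.2]) hrn (abs_nonneg _) (by positivity)
      calc (π - s) * |Real.sin (2 * r * s) - Real.sin ((2 * n : ℕ) * s)|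
          ≤ π * (2 * π * (A / n)) := mul_le_mul (by linarith [hs.1]) h2 (abs_nonneg _) hπ.le
        _ = _ := by ring
    · exact hq.mul_continuousOn (by fun_prop)
    · exact (hq.mul_continuousOn (by fun_prop)).mul_continuousOn (by fun_prop)
  have hcos : |(∫ x in (0 : ℝ)..π, Real.cos (r * x) ^ 2) - π / 2| ≤ π * A / n ^ 2 := by
    have e1 : (∫ x in (0 : ℝ)..π, Real.cos (r * x) ^ 2) - π / 2
        = Real.sin (r * π) * Real.cos (r * π) / (2 * r) := by
      rw [intervalIntegral.integral_comp_mul_left (fun x => Real.cos x ^ 2) hr0.ne', _root_.integral_cos_sq]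
      simp
      field_simp
      ring
    have hs : |Real.sin (r * π)| ≤ π * (A / n) := by
      rw [show r = n + (r - n) by ring, sin_nat_mul_pi_add, abs_mul, abs_pow, abs_neg, abs_one,
        one_pow, one_mul]
      refine Real.abs_sin_le_abs.trans ?_
      rw [abs_mul, abs_of_pos hπ, mul_comm]
      exact mul_le_mul_of_nonneg_left hrn hπ.le
    rw [e1, abs_div, abs_mul, abs_of_pos (by positivity : (0 : ℝ) < 2 * r)]
    have h3 : |Real.sin (r * π)| * |Real.cos (r * π)| ≤ π * (A / n) :=
      (mul_le_of_le_one_right (abs_nonneg _) (Real.abs_cos_le_one _)).trans hs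
    calc _ ≤ π * (A / n) / n := div_le_div₀ (by positivity) h3 hn0 (by linarith)
      _ = _ := by field_simp
  have hb2 : |1 / (2 * r) * b| ≤ 1 / n * (|a| + Q * (2 * π ^ 2 * (A / n))) := by
    rw [abs_mul, abs_of_pos (by positivity : (0 : ℝ) < 1 / (2 * r))]
    refine mul_le_mul ?_ ?_ (abs_nonneg _) (by positivity)
    · rw [div_le_div_iff₀ (by positivity) hn0]; linarith
    · calc |b| = |a + (b - a)| := by congr 1; ring
        _ ≤ _ := (abs_add_le _ _).trans (add_le_add le_rfl hab)
  have hCr : C / r ^ 2 ≤ 4 * C / n ^ 2 := by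
    have : (n : ℝ) ^ 2 ≤ 4 * r ^ 2 := by nlinarith
    rw [div_le_div_iff₀ (by positivity) (by positivity)]
    calc C * n ^ 2 ≤ C * (4 * r ^ 2) := mul_le_mul_of_nonneg_left this hC0.le
      _ = _ := by ring
  have e2 : (∫ x in (0 : ℝ)..π, c (r ^ 2) x ^ 2) - π / 2
      = ((∫ x in (0 : ℝ)..π, c (r ^ 2) x ^ 2) - (∫ x in (0 : ℝ)..π, Real.cos (r * x) ^ 2)
        + 1 / (2 * r) * b) - 1 / (2 * r) * b
        + ((∫ x in (0 : ℝ)..π, Real.cos (r * x) ^ 2) - π / 2) := by ring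
  rw [e2]
  refine (abs_add_le _ _).trans ((add_le_add ((abs_sub _ _).trans (add_le_add (h1.trans hCr) hb2))
    hcos).trans ?_)
  have e3 : (4 * C + 1 + 2 * π ^ 2 * Q * A + π * A) / n * (|a| + 1 / n)
      = (4 * C / n ^ 2 + 1 / n * (|a| + Q * (2 * π ^ 2 * (A / n))) + π * A / n ^ 2)
        + 1 / n ^ 2 + (4 * C + 2 * π ^ 2 * Q * A + π * A) / n * |a| := by
    field_simp
    ring
  rw [e3]
  have h4 : 0 ≤ 1 / (n : ℝ) ^ 2 := by positivity
  have h5 : 0 ≤ (4 * C + 2 * π ^ 2 * Q * A + π * A) / n * |a| := by positivity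
  linarith

end Asymptotics

/-! ### The inhomogeneous boundary value problem -/

/-- Variation of constants yields combinations whose derivative is known only almost everywhere.
Absolute continuity recovers them as integrals of that derivative, and since `y₁` is itself
absolutely continuous the first derivative exists everywhere. -/
lemma hasSecondDeriv_of_absCont {y y₁ g : ℝ → ℝ} (hy : AbsolutelyContinuousOnInterval y 0 π)
    (hy₁ : AbsolutelyContinuousOnInterval y₁ 0 π)
    (hd : ∀ᵐ x, x ∈ Ioo 0 π → HasDerivAt y (y₁ x) x)
    (hd₁ : ∀ᵐ x, x ∈ Ioo 0 π → HasDerivAt y₁ (g x) x) :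
    ∃ z₁, HasSecondDeriv y z₁ g ∧ ∀ x ∈ Icc 0 π, z₁ x = y₁ x := by
  have hsub : ∀ x ∈ Icc 0 π, uIcc 0 x ⊆ uIcc 0 π := by
    intro x hx
    rw [uIcc_of_le hx.1, uIcc_of_le Real.pi_pos.le]
    exact Icc_subset_Icc_right hx.2
  have h1 : ∀ x ∈ Icc 0 π, y₁ 0 + ∫ s in (0 : ℝ)..x, g s = y₁ x := by
    intro x hx
    rw [(integral_eq_sub_of_absCont hx.1 (hy₁.mono (hsub x hx)) ?_).2]
    · ring
    · filter_upwards [hd₁] with s hs hm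
      exact hs ⟨hm.1, hm.2.trans_le hx.2⟩
  have h2 : ∀ x ∈ Icc 0 π, ∫ s in (0 : ℝ)..x, y₁ s = y x - y 0 := by
    intro x hx
    refine (integral_eq_sub_of_absCont hx.1 (hy.mono (hsub x hx)) ?_).2
    filter_upwards [hd] with s hs hm
    exact hs ⟨hm.1, hm.2.trans_le hx.2⟩
  refine ⟨_, hasSecondDeriv_of_integral (a := y 0) (b := y₁ 0)
    (integral_eq_sub_of_absCont Real.pi_pos.le hy₁ hd₁).1 fun x hx => ?_, h1⟩
  rw [intervalIntegral.integral_congr (g := y₁), h2 x hx]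
  · ring
  · intro s hs
    rw [uIcc_of_le hx.1] at hs
    exact h1 s ⟨hs.1, hs.2.trans hx.2⟩

/-- `y` solves the boundary value problem `y'' = q y - μ y + v`, `y'(0) - h y(0) = 0`,
`y'(π) + H y(π) = 0`. -/
structure IsBVPSolution (q : ℝ → ℝ) (h H μ : ℝ) (v y y₁ : ℝ → ℝ) : Prop where
  hasSecondDeriv : HasSecondDeriv y y₁ (fun x => q x * y x - μ * y x + v x)
  left : y₁ 0 = h * y 0
  right : y₁ π + H * y π = 0

namespace IsBVPSolution

variable {q v w y y₁ z z₁ : ℝ → ℝ} {h H μ : ℝ}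

lemma add (hy : IsBVPSolution q h H μ v y y₁) (hz : IsBVPSolution q h H μ w z z₁) :
    IsBVPSolution q h H μ (fun x => v x + w x) (fun x => y x + z x) (fun x => y₁ x + z₁ x) where
  hasSecondDeriv := (hy.hasSecondDeriv.add hz.hasSecondDeriv).congr_ae
    (Eventually.of_forall fun x _ => by ring)
  left := by rw [hy.left, hz.left]; ring
  right := by linear_combination hy.right + hz.right

lemma const_mul (hy : IsBVPSolution q h H μ v y y₁) (a : ℝ) :
    IsBVPSolution q h H μ (fun x => a * v x) (fun x => a * y x) (fun x => a * y₁ x) where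
  hasSecondDeriv := (hy.hasSecondDeriv.const_mul a).congr_ae
    (Eventually.of_forall fun x _ => by ring)
  left := by rw [hy.left]; ring
  right := by linear_combination a * hy.right

lemma congr_ae (hy : IsBVPSolution q h H μ v y y₁) (hvw : v =ᵐ[volume.restrict (Ioc 0 π)] w) :
    IsBVPSolution q h H μ w y y₁ where
  hasSecondDeriv := hy.hasSecondDeriv.congr_ae <| by
    rw [EventuallyEq, ae_restrict_iff' measurableSet_Ioc] at hvw
    filter_upwards [hvw] with x hx hm
    rw [hx (Ioo_subset_Ioc_self hm)]
  left := hy.left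
  right := hy.right

lemma continuousOn (hy : IsBVPSolution q h H μ v y y₁) : ContinuousOn y (Icc 0 π) :=
  hy.hasSecondDeriv.continuousOn

/-- The solution operator is symmetric. -/
lemma symm (hy : IsBVPSolution q h H μ v y y₁) (hz : IsBVPSolution q h H μ w z z₁)
    (hv : IntervalIntegrable v volume 0 π) (hw : IntervalIntegrable w volume 0 π) :
    ∫ x in (0 : ℝ)..π, y x * w x = ∫ x in (0 : ℝ)..π, v x * z x := by
  have hg := hy.hasSecondDeriv.green hz.hasSecondDeriv (right_mem_Icc.2 Real.pi_pos.le)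
  have e : ∀ s, (q s * y s - μ * y s + v s) * z s - y s * (q s * z s - μ * z s + w s)
      = v s * z s - y s * w s := fun s => by ring
  simp only [e] at hg
  rw [intervalIntegral.integral_sub] at hg
  · rw [hy.left, hz.left] at hg
    have h1 := hy.right
    have h2 := hz.right
    linear_combination -z π * h1 + y π * h2 - hg
  · refine hv.mul_continuousOn ?_
    rw [uIcc_of_le Real.pi_pos.le]
    exact hz.continuousOn
  · refine hw.continuousOn_mul ?_
    rw [uIcc_of_le Real.pi_pos.le]
    exact hy.continuousOn

end IsBVPSolution

section Resolvent

variable {q : ℝ → ℝ} {h H : ℝ} {c c₁ : ℝ → ℝ → ℝ}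

lemma IsCauchyPair.isBVPSolution (hc : IsCauchyPair q h c c₁) {μ : ℝ} (hμ : charFun H c c₁ μ = 0)
    (κ : ℝ) : IsBVPSolution q h H κ (fun x => (κ - μ) * c μ x) (c μ) (c₁ μ) where
  hasSecondDeriv := (hc.isSolution μ).congr_ae (Eventually.of_forall fun x _ => by ring)
  left := by rw [hc.apply_zero, hc.deriv_zero, mul_one]
  right := hμ

lemma IsBVPSolution.eqOn_zero (hc : IsCauchyPair q h c c₁) (hq : IntervalIntegrable q volume 0 π)
    {μ : ℝ} (hμ : charFun H c c₁ μ ≠ 0) {y y₁ : ℝ → ℝ}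
    (hy : IsBVPSolution q h H μ 0 y y₁) : ∀ x ∈ Icc 0 π, y x = 0 := by
  by_contra! hne
  refine hμ ((isEigenvalue_iff hc hq).1 ⟨y, y₁, ?_, by rw [hy.left, sub_self], hy.right, hne⟩)
  exact hy.hasSecondDeriv.congr_ae (Eventually.of_forall fun x _ => by simp)

lemma IsBVPSolution.eqOn (hc : IsCauchyPair q h c c₁) (hq : IntervalIntegrable q volume 0 π)
    {μ : ℝ} (hμ : charFun H c c₁ μ ≠ 0) {v w y y₁ z z₁ : ℝ → ℝ}
    (hy : IsBVPSolution q h H μ v y y₁) (hz : IsBVPSolution q h H μ w z z₁)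
    (hvw : v =ᵐ[volume.restrict (Ioc 0 π)] w) : ∀ x ∈ Icc 0 π, y x = z x := by
  intro x hx
  have := IsBVPSolution.eqOn_zero hc hq hμ ((hy.add (hz.const_mul (-1))).congr_ae (w := 0)
    (by filter_upwards [hvw] with x hx; simp [hx])) x hx
  linarith

/-- Variation of constants. -/
lemma exists_isBVPSolution (hc : IsCauchyPair q h c c₁) (hq : IntervalIntegrable q volume 0 π)
    {μ : ℝ} (hμ : charFun H c c₁ μ ≠ 0) {v : ℝ → ℝ} (hv : IntervalIntegrable v volume 0 π) :
    ∃ y y₁, IsBVPSolution q h H μ v y y₁ := by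
  -- A second solution comes from the same existence theorem: the solutions with initial slopes `h +
  -- 1` and `h` differ by `ψ` with `ψ(0) = 0`, `ψ'(0) = 1`.
  obtain ⟨G, hG⟩ := exists_isTransmutationKernel hq (h + 1)
  obtain ⟨d₁, hd, hd0, hd1⟩ := hG.exists_isSolution μ
  set d := volterra G (cosRoot μ)
  set ψ : ℝ → ℝ := fun x => d x - c μ x with hψ
  set ψ₁ : ℝ → ℝ := fun x => d₁ x - c₁ μ x with hψ₁
  have hsψ : HasSecondDeriv ψ ψ₁ (fun x => q x * ψ x - μ * ψ x) :=
    (HasSecondDeriv.sub hd (hc.isSolution μ)).congr_ae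
      (Eventually.of_forall fun x _ => by simp only [hψ]; ring)
  have hsφ : HasSecondDeriv (c μ) (c₁ μ) (fun x => q x * c μ x - μ * c μ x) := hc.isSolution μ
  have hψ0 : ψ 0 = 0 := by simp [hψ, hd0, hc.apply_zero]
  have hψ10 : ψ₁ 0 = 1 := by simp [hψ₁, hd1, hc.deriv_zero]
  have hwr : ∀ x ∈ Icc 0 π, ψ₁ x * c μ x - ψ x * c₁ μ x = 1 := by
    intro x hx
    have hg := hsψ.green hsφ hx
    have e : ∀ s, (q s * ψ s - μ * ψ s) * c μ s - ψ s * (q s * c μ s - μ * c μ s) = 0 :=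
      fun s => by ring
    simp only [e, intervalIntegral.integral_zero, hψ0, hψ10, hc.apply_zero] at hg
    linarith
  have iA : IntervalIntegrable (fun x => c μ x * v x) volume 0 π :=
    hv.continuousOn_mul (by rw [uIcc_of_le Real.pi_pos.le]; exact hsφ.continuousOn)
  have iB : IntervalIntegrable (fun x => ψ x * v x) volume 0 π :=
    hv.continuousOn_mul (by rw [uIcc_of_le Real.pi_pos.le]; exact hsψ.continuousOn)
  set A : ℝ → ℝ := fun x => ∫ s in (0 : ℝ)..x, c μ s * v s with hA
  set B : ℝ → ℝ := fun x => ∫ s in (0 : ℝ)..x, ψ s * v s with hB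
  have acA : AbsolutelyContinuousOnInterval A 0 π :=
    iA.absolutelyContinuousOnInterval_intervalIntegral (c := 0) left_mem_uIcc
  have acB : AbsolutelyContinuousOnInterval B 0 π :=
    iB.absolutelyContinuousOnInterval_intervalIntegral (c := 0) left_mem_uIcc
  have dA : ∀ᵐ x, x ∈ Ioo 0 π → HasDerivAt A (c μ x * v x) x := by
    filter_upwards [iA.ae_hasDerivAt_integral] with x hx hm
    exact hx (by rw [uIcc_of_le Real.pi_pos.le]; exact Ioo_subset_Icc_self hm) 0 left_mem_uIcc
  have dB : ∀ᵐ x, x ∈ Ioo 0 π → HasDerivAt B (ψ x * v x) x := by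
    filter_upwards [iB.ae_hasDerivAt_integral] with x hx hm
    exact hx (by rw [uIcc_of_le Real.pi_pos.le]; exact Ioo_subset_Icc_self hm) 0 left_mem_uIcc
  have d1 : ∀ᵐ x, x ∈ Ioo 0 π → HasDerivAt (fun x => ψ x * A x - c μ x * B x)
      (ψ₁ x * A x - c₁ μ x * B x) x := by
    filter_upwards [dA, dB] with x h1 h2 hm
    convert! ((hsψ.hasDerivAt hm).mul (h1 hm)).sub ((hsφ.hasDerivAt hm).mul (h2 hm)) using 1
    ring
  have d2 : ∀ᵐ x, x ∈ Ioo 0 π → HasDerivAt (fun x => ψ₁ x * A x - c₁ μ x * B x)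
      (q x * (ψ x * A x - c μ x * B x) - μ * (ψ x * A x - c μ x * B x) + v x) x := by
    filter_upwards [dA, dB, hsψ.deriv_ae, hsφ.deriv_ae] with x h1 h2 h3 h4 hm
    convert! ((h3 hm).mul (h1 hm)).sub ((h4 hm).mul (h2 hm)) using 1
    linear_combination (-v x) * hwr x (Ioo_subset_Icc_self hm)
  obtain ⟨z₁, hz, hz1⟩ := hasSecondDeriv_of_absCont
    ((hsψ.absCont_left.fun_mul acA).fun_sub (hsφ.absCont_left.fun_mul acB))
    ((hsψ.absCont.fun_mul acA).fun_sub (hsφ.absCont.fun_mul acB)) d1 d2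
  have hA0 : A 0 = 0 := by simp [hA]
  have hB0 : B 0 = 0 := by simp [hB]
  have hz0 := hz1 0 (left_mem_Icc.2 Real.pi_pos.le)
  rw [hA0, hB0] at hz0
  -- The particular solution meets the condition at `0`; adding a multiple of `c μ` preserves it and
  -- adjusts the condition at `π`, which is possible since `charFun` does not vanish.
  set a := -(z₁ π + H * (ψ π * A π - c μ π * B π)) / charFun H c c₁ μ with ha
  have ha' : a * charFun H c c₁ μ = -(z₁ π + H * (ψ π * A π - c μ π * B π)) := by
    rw [ha, div_mul_cancel₀ _ hμ]
  refine ⟨_, _, (hz.add (hsφ.const_mul a)).congr_ae (Eventually.of_forall fun x _ => by ring), ?_, ?_⟩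
  · simp only [hz0, hA0, hB0, hc.apply_zero, hc.deriv_zero]
    ring
  · rw [charFun] at ha'
    linear_combination ha'

lemma integral_mul_eq_zero_of_charFun (hc : IsCauchyPair q h c c₁) {μ κ : ℝ}
    (hμ : charFun H c c₁ μ = 0) (hκ : charFun H c c₁ κ = 0) (hne : μ ≠ κ) :
    ∫ x in (0 : ℝ)..π, c μ x * c κ x = 0 := by
  have hi : ∀ ν, IntervalIntegrable (c ν) volume 0 π := fun ν => by
    refine ContinuousOn.intervalIntegrable ?_
    rw [uIcc_of_le Real.pi_pos.le]
    exact hc.continuousOn ν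
  have := (hc.isBVPSolution hμ κ).symm (hc.isBVPSolution hκ κ) ((hi μ).const_mul _)
    ((hi κ).const_mul _)
  simp only [sub_self, zero_mul, mul_zero, intervalIntegral.integral_zero, mul_assoc,
    intervalIntegral.integral_const_mul] at this
  exact (mul_eq_zero.1 this.symm).resolve_left (sub_ne_zero.2 hne.symm)

lemma IsCauchyPair.integral_sq_pos (hc : IsCauchyPair q h c c₁) (μ : ℝ) :
    0 < ∫ x in (0 : ℝ)..π, c μ x ^ 2 := by
  refine intervalIntegral.integral_pos Real.pi_pos ((hc.continuousOn μ).pow 2)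
    (fun x _ => sq_nonneg _) ⟨0, left_mem_Icc.2 Real.pi_pos.le, ?_⟩
  simp [hc.apply_zero]

/-- There is a real number that is not an eigenvalue. -/
lemma exists_charFun_ne_zero (hc : IsCauchyPair q h c c₁) (hq : IntervalIntegrable q volume 0 π)
    (H : ℝ) : ∃ μ, charFun H c c₁ μ ≠ 0 := by
  obtain ⟨C, hC0, hC⟩ := exists_abs_charFun_le hc hq H
  obtain ⟨n, hn⟩ := exists_nat_gt C
  refine ⟨((n : ℝ) + 1 / 2) ^ 2, fun h0 => ?_⟩
  have h1 := hC (n + 1 / 2)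
  rw [h0, zero_add, sin_nat_mul_pi_add, one_div_mul_eq_div, Real.sin_pi_div_two, mul_one, abs_mul,
    abs_pow, abs_neg, abs_one, one_pow, mul_one, abs_of_nonneg (by positivity)] at h1
  linarith

end Resolvent

/-! ### Comparison with the cosine basis and completeness -/

section Near

variable {E : Type*} [NormedAddCommGroup E] [InnerProductSpace ℝ E]

/-- If all but finitely many elements of a Hilbert basis are close to vectors orthogonal to a
subspace, then the dimension of that subspace is at most the number of exceptions. -/
lemma finrank_le_of_near {ι : Type*} (b : HilbertBasis ι ℝ E) {j : ℕ → ι}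
    (hj : Function.Injective j) {F : Finset ι} (hF : ∀ i ∉ F, i ∈ range j) {u : ℕ → E}
    (hs : Summable fun n => ‖b (j n) - u n‖ ^ 2) (hlt : ∑' n, ‖b (j n) - u n‖ ^ 2 < 1)
    {V : Submodule ℝ E} (hV : ∀ v ∈ V, ∀ n, inner ℝ (u n) v = 0) :
    FiniteDimensional ℝ V ∧ Module.finrank ℝ V ≤ F.card := by
  -- The coefficients at the exceptional indices determine a vector of `V`: injectivity of this map
  -- is the whole claim.
  let Φ : V →ₗ[ℝ] (F → ℝ) :=
    LinearMap.pi fun i => (innerSL ℝ (b i)).toLinearMap ∘ₗ V.subtype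
  have hΦ : Function.Injective Φ := by
    rw [← LinearMap.ker_eq_bot, Submodule.eq_bot_iff]
    intro v hv
    rw [LinearMap.mem_ker] at hv
    have h0 : ∀ i ∈ F, inner ℝ (b i) (v : E) = 0 := fun i hi => congrFun hv ⟨i, hi⟩
    have h1 := b.hasSum_inner_mul_inner (v : E) (v : E)
    rw [← hj.hasSum_iff (fun i hi => ?_)] at h1
    swap
    · rw [h0 i (by by_contra h; exact hi (hF i h)), mul_zero]
    -- Orthogonality to `u n` replaces `b (j n)` by `b (j n) - u n` in the coefficient. If the
    -- exceptional coefficients vanish, Parseval then bounds `‖v‖²` by `‖v‖²` times a number below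
    -- `1`.
    have h2 : ∀ n, inner ℝ (v : E) (b (j n)) * inner ℝ (b (j n)) (v : E)
        ≤ ‖(v : E)‖ ^ 2 * ‖b (j n) - u n‖ ^ 2 := by
      intro n
      have e : inner ℝ (b (j n)) (v : E) = inner ℝ (b (j n) - u n) (v : E) := by
        rw [inner_sub_left, hV v v.2 n, sub_zero]
      rw [real_inner_comm, e, ← sq, ← sq_abs, ← mul_pow]
      refine pow_le_pow_left₀ (abs_nonneg _) ?_ 2
      rw [mul_comm]
      exact abs_real_inner_le_norm _ _
    have h3 := hasSum_le h2 h1 (hs.hasSum.mul_left _)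
    rw [real_inner_self_eq_norm_sq] at h3
    have h4 : ‖(v : E)‖ ^ 2 = 0 := by nlinarith [sq_nonneg ‖(v : E)‖]
    have h5 : (v : E) = 0 := by simpa using h4
    exact Subtype.ext h5
  refine ⟨FiniteDimensional.of_injective Φ hΦ, ?_⟩
  have := LinearMap.finrank_le_finrank_of_injective hΦ
  simpa using this

lemma norm_normalize_sub_le {a b : E} (ha : 0 < ‖a‖) (hb : 0 < ‖b‖) :
    ‖‖a‖⁻¹ • a - ‖b‖⁻¹ • b‖ ≤ 2 * ‖a - b‖ / ‖a‖ := by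
  have e : ‖a‖⁻¹ • a - ‖b‖⁻¹ • b = ‖a‖⁻¹ • (a - b) + (‖a‖⁻¹ - ‖b‖⁻¹) • b := by
    rw [smul_sub, sub_smul]; abel
  rw [e]
  refine (norm_add_le _ _).trans ?_
  rw [norm_smul, norm_smul, Real.norm_eq_abs, Real.norm_eq_abs, abs_of_pos (inv_pos.2 ha)]
  have h1 : |‖a‖⁻¹ - ‖b‖⁻¹| * ‖b‖ = |‖b‖ - ‖a‖| / ‖a‖ := by
    rw [inv_sub_inv ha.ne' hb.ne', abs_div, abs_mul, abs_of_pos ha, abs_of_pos hb]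
    field_simp
  have h2 : |‖b‖ - ‖a‖| ≤ ‖a - b‖ := by
    rw [abs_sub_comm]
    exact abs_norm_sub_norm_le a b
  rw [h1]
  calc ‖a‖⁻¹ * ‖a - b‖ + |‖b‖ - ‖a‖| / ‖a‖ ≤ ‖a‖⁻¹ * ‖a - b‖ + ‖a - b‖ / ‖a‖ := by gcongr
    _ = _ := by field_simp; ring

end Near

lemma norm_toLp_sq {α : Type*} [MeasurableSpace α] {ν : Measure α} {f : α → ℝ}
    (hf : MemLp f 2 ν) : ‖hf.toLp f‖ ^ 2 = ∫ x, f x ^ 2 ∂ν := by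
  rw [← real_inner_self_eq_norm_sq, inner_toLp]
  simp only [sq]

lemma normalizedLp_eq {α ι : Type*} [MeasurableSpace α] {ν : Measure α} {φ : ι → α → ℝ}
    (hφ : ∀ n, MemLp (φ n) 2 ν) (n : ι) :
    normalizedLp φ hφ n = ‖(hφ n).toLp (φ n)‖⁻¹ • (hφ n).toLp (φ n) := by
  rw [normalizedLp, ← norm_toLp_sq (hφ n), Real.sqrt_sq (norm_nonneg _)]

/-- The measure on `(0, π]` with respect to which `L²(0, π)` is formed. -/
abbrev ν₀ : Measure ℝ := volume.restrict (Ioc 0 π)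

lemma memLp_cos (n : ℕ) : MemLp (fun x => Real.cos (n * x)) 2 ν₀ :=
  memLp_of_continuousOn (by fun_prop)

lemma exists_cos_hilbertBasis : ∃ b : HilbertBasis ℕ ℝ (Lp ℝ 2 ν₀),
    ⇑b = normalizedLp (fun (n : ℕ) x => Real.cos (n * x)) memLp_cos := by
  refine exists_hilbertBasis memLp_cos (fun n => ?_) (fun n m hnm => ?_)
    (fun f hf h => cos_complete hf h)
  · rw [← intervalIntegral.integral_of_le Real.pi_pos.le, integral_cos_sq]
    exact weight₀_pos n
  · rw [← intervalIntegral.integral_of_le Real.pi_pos.le, integral_cos_mul_cos hnm]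

section Completeness

variable {q : ℝ → ℝ} {h H : ℝ} {c c₁ : ℝ → ℝ → ℝ}

lemma IsCauchyPair.memLp (hc : IsCauchyPair q h c c₁) (μ : ℝ) : MemLp (c μ) 2 ν₀ :=
  memLp_of_continuousOn (hc.continuousOn μ)

/-- After normalisation `cos nx` and `c(rₙ, x)` differ by `O(1/n)` in `L²`, so the squares are
summable and a tail of the sum falls below `1`. Everything before that tail is left to the dimension
count. -/
lemma exists_summable_near (hc : IsCauchyPair q h c c₁) (hq : IntervalIntegrable q volume 0 π)
    {A : ℝ} {N : ℕ} (hA : 0 < A) {r : ℕ → ℝ}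
    (hr : ∀ n, N ≤ n → |r n - n| ≤ A / n ∧ A / n ≤ 1 / 4) :
    ∃ M, N ≤ M ∧ 1 ≤ M ∧
      Summable (fun n => ‖normalizedLp (fun (n : ℕ) x => Real.cos (n * x)) memLp_cos (n + M)
        - normalizedLp c hc.memLp (r (n + M) ^ 2)‖ ^ 2) ∧
      ∑' n, ‖normalizedLp (fun (n : ℕ) x => Real.cos (n * x)) memLp_cos (n + M)
        - normalizedLp c hc.memLp (r (n + M) ^ 2)‖ ^ 2 < 1 := by
  obtain ⟨B, hB0, hB⟩ := hc.exists_abs_sub_cos_le hq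
  have hπ := Real.pi_pos
  -- Passing from `cos nx` to `cos rₙx` costs `πA / n`, and from there to `c` costs `B / rₙ ≤ 2B /
  -- n`.
  set D := π * A + 2 * B with hD
  have hD0 : 0 < D := by positivity
  have key : ∀ n, N ≤ n → 1 ≤ n →
      ‖normalizedLp (fun (n : ℕ) x => Real.cos (n * x)) memLp_cos n
        - normalizedLp c hc.memLp (r n ^ 2)‖ ^ 2 ≤ 8 * D ^ 2 * (1 / (n : ℝ) ^ 2) := by
    intro n hNn hn
    have hn1 : (1 : ℝ) ≤ n := by exact_mod_cast hn
    have hn0 : (0 : ℝ) < n := by linarith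
    obtain ⟨hrn, hA4⟩ := hr n hNn
    have hr2 : (n : ℝ) / 2 ≤ r n := by linarith [(abs_le.1 (hrn.trans hA4)).1]
    have hr0 : 0 < r n := by linarith
    have hpt : ∀ x ∈ Ioc 0 π, |Real.cos (n * x) - c (r n ^ 2) x| ≤ D / n := by
      intro x hx
      have h1 := hB (r n) hr0 x (Ioc_subset_Icc_self hx)
      have h2 : |Real.cos (n * x) - Real.cos (r n * x)| ≤ π * (A / n) := by
        refine (abs_cos_sub_cos_le _ _).trans ?_
        rw [← sub_mul, abs_mul, abs_sub_comm, abs_of_pos hx.1, mul_comm]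
        exact mul_le_mul hx.2 hrn (abs_nonneg _) hπ.le
      have h3 : B / r n ≤ 2 * B / n := by
        rw [div_le_div_iff₀ hr0 hn0]
        nlinarith
      have h4 := abs_sub_le (Real.cos (n * x)) (Real.cos (r n * x)) (c (r n ^ 2) x)
      rw [abs_sub_comm (Real.cos (r n * x)) (c (r n ^ 2) x)] at h4
      have h5 : D / n = π * (A / n) + 2 * B / n := by rw [hD]; ring
      linarith
    have hcos : ‖(memLp_cos n).toLp _‖ ^ 2 = π / 2 := by
      rw [norm_toLp_sq, ← intervalIntegral.integral_of_le hπ.le, integral_cos_sq, weight₀,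
        if_neg (by omega)]
    have hcp : 0 < ‖(hc.memLp (r n ^ 2)).toLp _‖ ^ 2 := by
      rw [norm_toLp_sq, ← intervalIntegral.integral_of_le hπ.le]
      exact hc.integral_sq_pos _
    have hcosp : 0 < ‖(memLp_cos n).toLp _‖ := by
      have : 0 < ‖(memLp_cos n).toLp _‖ ^ 2 := by rw [hcos]; positivity
      exact lt_of_le_of_ne (norm_nonneg _) fun h0 => by simp [← h0] at this
    have hdiff : ‖(memLp_cos n).toLp _ - (hc.memLp (r n ^ 2)).toLp _‖ ^ 2 ≤ π * (D / n) ^ 2 := by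
      rw [← MemLp.toLp_sub, norm_toLp_sq]
      have := norm_setIntegral_le_of_norm_le_const (μ := volume) (s := Ioc 0 π)
        (f := fun x => (Real.cos (n * x) - c (r n ^ 2) x) ^ 2) (C := (D / n) ^ 2) (by simp)
        (fun x hx => by
          rw [norm_pow]
          exact pow_le_pow_left₀ (norm_nonneg _) (hpt x hx) 2)
      rw [Real.volume_real_Ioc_of_le hπ.le, sub_zero] at this
      have h2 := (le_abs_self _).trans this
      simp only [Pi.sub_apply]
      linarith
    rw [normalizedLp_eq, normalizedLp_eq]
    have hcp' : 0 < ‖(hc.memLp (r n ^ 2)).toLp _‖ :=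
      lt_of_le_of_ne (norm_nonneg _) fun h0 => by simp [← h0] at hcp
    have h6 := norm_normalize_sub_le hcosp hcp'
    refine (pow_le_pow_left₀ (norm_nonneg _) h6 2).trans ?_
    rw [div_pow, hcos, mul_pow, div_le_iff₀ (by positivity)]
    calc _ ≤ 2 ^ 2 * (π * (D / n) ^ 2) := by gcongr
      _ = _ := by field_simp; ring
  have hsum : Summable fun n : ℕ => 8 * D ^ 2 * (1 / (n : ℝ) ^ 2) :=
    (Real.summable_one_div_nat_pow.2 (by norm_num)).mul_left _
  have ht := tendsto_sum_nat_add (fun n : ℕ => 8 * D ^ 2 * (1 / (n : ℝ) ^ 2))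
  obtain ⟨M, hM1, hM2⟩ := ((ht.eventually_lt_const one_pos).and
    (eventually_ge_atTop (max N 1))).exists
  have hs2 := (summable_nat_add_iff M).2 hsum
  have hle : ∀ n, ‖normalizedLp (fun (n : ℕ) x => Real.cos (n * x)) memLp_cos (n + M)
        - normalizedLp c hc.memLp (r (n + M) ^ 2)‖ ^ 2
        ≤ 8 * D ^ 2 * (1 / ((n + M : ℕ) : ℝ) ^ 2) := fun n =>
    key (n + M) (by have := le_max_left N 1; omega) (by have := le_max_right N 1; omega)
  have hs3 := Summable.of_nonneg_of_le (fun n => sq_nonneg _) hle hs2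
  exact ⟨M, (le_max_left _ _).trans hM2, (le_max_right _ _).trans hM2, hs3,
    (hs3.tsum_le_tsum hle hs2).trans_lt hM1⟩

/-- The functions orthogonal to all the eigenfunctions in a set of eigenvalues. -/
def orthogonalTo (hc : IsCauchyPair q h c c₁) (S : Set ℝ) : Submodule ℝ (Lp ℝ 2 ν₀) :=
  (Submodule.span ℝ ((fun μ => (hc.memLp μ).toLp (c μ)) '' S))ᗮ

lemma mem_orthogonalTo (hc : IsCauchyPair q h c c₁) {S : Set ℝ} {v : Lp ℝ 2 ν₀} :
    v ∈ orthogonalTo hc S ↔ ∀ μ ∈ S, inner ℝ ((hc.memLp μ).toLp (c μ)) v = 0 := by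
  rw [orthogonalTo, Submodule.mem_orthogonal]
  constructor
  · exact fun hv μ hμ => hv _ (Submodule.subset_span ⟨μ, hμ, rfl⟩)
  · intro hv u hu
    induction hu using Submodule.span_induction with
    | mem u hu => obtain ⟨μ, hμ, rfl⟩ := hu; exact hv μ hμ
    | zero => exact inner_zero_left _
    | add x y _ _ hx hy => rw [inner_add_left, hx, hy, add_zero]
    | smul a x _ hx => rw [inner_smul_left, hx, mul_zero]

lemma inner_normalizedLp_of_mem (hc : IsCauchyPair q h c c₁) {S : Set ℝ} {v : Lp ℝ 2 ν₀}
    (hv : v ∈ orthogonalTo hc S) {μ : ℝ} (hμ : μ ∈ S) :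
    inner ℝ (normalizedLp c hc.memLp μ) v = 0 := by
  rw [normalizedLp_eq, inner_smul_left, (mem_orthogonalTo hc).1 hv μ hμ, mul_zero]

lemma intervalIntegrable_Lp (v : Lp ℝ 2 ν₀) : IntervalIntegrable v volume 0 π := by
  rw [intervalIntegrable_iff_integrableOn_Ioc_of_le Real.pi_pos.le]
  exact (Lp.memLp v).integrable (by norm_num)

lemma inner_toLp_left {f : ℝ → ℝ} (hf : MemLp f 2 ν₀) (v : Lp ℝ 2 ν₀) :
    inner ℝ (hf.toLp f) v = ∫ x in (0 : ℝ)..π, f x * v x := by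
  rw [intervalIntegral.integral_of_le Real.pi_pos.le, ← inner_toLp hf (Lp.memLp v), Lp.toLp_coeFn]

lemma inner_toLp_right {f : ℝ → ℝ} (hf : MemLp f 2 ν₀) (v : Lp ℝ 2 ν₀) :
    inner ℝ v (hf.toLp f) = ∫ x in (0 : ℝ)..π, v x * f x := by
  rw [real_inner_comm, inner_toLp_left]
  simp only [mul_comm]

lemma ae_eq_of_eqOn_Icc {f g : ℝ → ℝ} (hfg : ∀ x ∈ Icc 0 π, f x = g x) : f =ᵐ[ν₀] g :=
  (ae_restrict_iff' measurableSet_Ioc).2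
    (Eventually.of_forall fun x hx => hfg x (Ioc_subset_Icc_self hx))

/-- Injectivity of the solution operator, which excludes the eigenvalue `0`: a continuous `y`
vanishing almost everywhere vanishes on `(0, π]`, hence so do its derivatives on the open interval,
and the equation reduces to `v = 0`. -/
lemma IsBVPSolution.ae_eq_zero {κ : ℝ} {v y y₁ : ℝ → ℝ} (hy : IsBVPSolution q h H κ v y y₁)
    (h0 : y =ᵐ[ν₀] 0) : v =ᵐ[ν₀] 0 := by
  have h1 : ∀ x ∈ Ioc 0 π, y x = 0 :=
    Measure.eqOn_Ioc_of_ae_eq volume h0 (hy.continuousOn.mono Ioc_subset_Icc_self)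
      continuousOn_const
  have h2 : ∀ x ∈ Ioo 0 π, y₁ x = 0 := by
    intro x hx
    refine (hy.hasSecondDeriv.hasDerivAt hx).unique ((hasDerivAt_const x (0 : ℝ)).congr_of_eventuallyEq ?_)
    filter_upwards [Ioo_mem_nhds hx.1 hx.2] with z hz
    exact h1 z (Ioo_subset_Ioc_self hz)
  rw [ν₀, EventuallyEq, ← Measure.restrict_congr_set (Ioo_ae_eq_Ioc (a := (0 : ℝ)) (b := π)),
    ae_restrict_iff' measurableSet_Ioo]
  filter_upwards [hy.hasSecondDeriv.deriv_ae] with x hx hm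
  have h3 := (hx hm).unique ((hasDerivAt_const x (0 : ℝ)).congr_of_eventuallyEq (by
    filter_upwards [Ioo_mem_nhds hm.1 hm.2] with z hz
    exact h2 z hz))
  rw [h1 x (Ioo_subset_Ioc_self hm)] at h3
  simpa using h3

/-- The solution operator of the boundary value problem on `L²(0, π)`. -/
lemma exists_solutionOperator (hc : IsCauchyPair q h c c₁) (hq : IntervalIntegrable q volume 0 π)
    {κ : ℝ} (hκ : charFun H c c₁ κ ≠ 0) : ∃ R : Lp ℝ 2 ν₀ →ₗ[ℝ] Lp ℝ 2 ν₀,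
      ∀ v : Lp ℝ 2 ν₀, ∃ y y₁, ∃ hy : IsBVPSolution q h H κ v y y₁,
        R v = (memLp_of_continuousOn hy.continuousOn).toLp y := by
  choose y y₁ hy using fun v : Lp ℝ 2 ν₀ =>
    exists_isBVPSolution hc hq hκ (intervalIntegrable_Lp v)
  refine ⟨⟨⟨fun v => (memLp_of_continuousOn (hy v).continuousOn).toLp (y v), ?_⟩, ?_⟩,
    fun v => ⟨_, _, hy v, rfl⟩⟩
  · intro v w
    rw [← MemLp.toLp_add, MemLp.toLp_eq_toLp_iff]
    exact ae_eq_of_eqOn_Icc ((hy (v + w)).eqOn hc hq hκ ((hy v).add (hy w)) (Lp.coeFn_add v w))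
  · intro a v
    simp only [RingHom.id_apply]
    rw [← MemLp.toLp_const_smul, MemLp.toLp_eq_toLp_iff]
    exact ae_eq_of_eqOn_Icc ((hy (a • v)).eqOn hc hq hκ ((hy v).const_mul a) (Lp.coeFn_smul a v))

/-- The system of the eigenfunctions is complete. -/
lemma eigenfunctions_complete (hc : IsCauchyPair q h c c₁) (hq : IntervalIntegrable q volume 0 π)
    (hfin : FiniteDimensional ℝ (orthogonalTo hc {μ | charFun H c c₁ μ = 0})) :
    orthogonalTo hc {μ | charFun H c c₁ μ = 0} = ⊥ := by
  obtain ⟨κ, hκ⟩ := exists_charFun_ne_zero hc hq H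
  obtain ⟨R, hR⟩ := exists_solutionOperator hc hq hκ
  set W := orthogonalTo hc {μ | charFun H c c₁ μ = 0} with hW
  have hcint : ∀ μ, IntervalIntegrable (c μ) volume 0 π := fun μ => by
    refine ContinuousOn.intervalIntegrable ?_
    rw [uIcc_of_le Real.pi_pos.le]
    exact hc.continuousOn μ
  have hsymm : ∀ v w, inner ℝ (R v) w = inner ℝ v (R w) := by
    intro v w
    obtain ⟨y, y₁, hy, hRv⟩ := hR v
    obtain ⟨z, z₁, hz, hRw⟩ := hR w
    rw [hRv, hRw, inner_toLp_left, inner_toLp_right]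
    exact hy.symm hz (intervalIntegrable_Lp v) (intervalIntegrable_Lp w)
  -- The operator multiplies an eigenfunction by `1 / (κ - μ)`, so by symmetry it preserves
  -- orthogonality to the eigenfunctions.
  have hinv : ∀ v ∈ W, R v ∈ W := by
    intro v hv
    rw [hW, mem_orthogonalTo] at hv ⊢
    intro μ hμ
    obtain ⟨y, y₁, hy, hRv⟩ := hR v
    have h1 := hy.symm (hc.isBVPSolution hμ κ) (intervalIntegrable_Lp v) ((hcint μ).const_mul _)
    have h2 := hv μ hμ
    rw [inner_toLp_left] at h2
    simp only [mul_comm (v _), h2, mul_left_comm _ (κ - μ), intervalIntegral.integral_const_mul] at h1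
    have hne : κ - μ ≠ 0 := fun h0 => hκ (by rw [sub_eq_zero.1 h0]; exact hμ)
    rw [hRv, inner_toLp, ← intervalIntegral.integral_of_le Real.pi_pos.le]
    simp only [mul_comm (c μ _)]
    exact (mul_eq_zero.1 h1).resolve_left hne
  -- A symmetric operator on a nonzero finite-dimensional space has an eigenvector. Here such a
  -- vector would be an eigenfunction of the boundary value problem orthogonal to all
  -- eigenfunctions, itself included.
  have hsub : Subsingleton W := by
    refine LinearMap.IsSymmetric.subsingleton_of_no_eigenvalue_finiteDimensional
      (T := R.restrict hinv) (fun v w => hsymm v w) fun τ => ?_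
    rw [Submodule.eq_bot_iff]
    intro v hv
    rw [Module.End.mem_eigenspace_iff] at hv
    have hv' : R v = τ • (v : Lp ℝ 2 ν₀) := congrArg Subtype.val hv
    obtain ⟨y, y₁, hy, hRv⟩ := hR v
    have hyv : y =ᵐ[ν₀] fun x => τ * (v : Lp ℝ 2 ν₀) x := by
      have h1 := (memLp_of_continuousOn hy.continuousOn).coeFn_toLp
      rw [← hRv, hv'] at h1
      filter_upwards [h1, Lp.coeFn_smul τ (v : Lp ℝ 2 ν₀)] with x h2 h3
      rw [← h2, h3]
      rfl
    have hv0 : ((v : Lp ℝ 2 ν₀) : ℝ → ℝ) =ᵐ[ν₀] 0 := by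
      by_cases hτ : τ = 0
      · refine hy.ae_eq_zero (hyv.trans ?_)
        filter_upwards with x
        simp [hτ]
      · have hvy : ((v : Lp ℝ 2 ν₀) : ℝ → ℝ) =ᵐ[ν₀] fun x => τ⁻¹ * y x := by
          filter_upwards [hyv] with x hx
          rw [hx, inv_mul_cancel_left₀ hτ]
        -- Substituting `v = τ⁻¹ y` absorbs the right-hand side into the spectral parameter.
        have hs : IsSolution q (κ - τ⁻¹) y y₁ :=
          (hy.congr_ae hvy).hasSecondDeriv.congr_ae (Eventually.of_forall fun x _ => by ring)
        have hyc : ∀ x ∈ Icc 0 π, y x = y 0 * c (κ - τ⁻¹) x := by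
          refine hs.eqOn hq (z₁ := fun x => y 0 * c₁ (κ - τ⁻¹) x) ?_ ?_ ?_
          · exact ((hc.isSolution _).const_mul (y 0)).congr_ae
              (Eventually.of_forall fun x _ => by ring)
          · simp [hc.apply_zero]
          · rw [hc.deriv_zero, hy.left, mul_comm]
        by_cases hy0 : y 0 = 0
        · filter_upwards [hvy, ae_eq_of_eqOn_Icc hyc] with x h1 h2
          rw [h1, h2, hy0]
          simp
        · exfalso
          have hμ : charFun H c c₁ (κ - τ⁻¹) = 0 := (isEigenvalue_iff hc hq).1
            ⟨y, y₁, hs, by rw [hy.left, sub_self], hy.right, 0, left_mem_Icc.2 Real.pi_pos.le, hy0⟩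
          have h1 := (mem_orthogonalTo hc).1 v.2 _ hμ
          have hvc : ((v : Lp ℝ 2 ν₀) : ℝ → ℝ) =ᵐ[ν₀] fun x => τ⁻¹ * y 0 * c (κ - τ⁻¹) x := by
            filter_upwards [hvy, ae_eq_of_eqOn_Icc hyc] with x h1 h2
            rw [h1, h2, mul_assoc]
          rw [inner_toLp_left, intervalIntegral.integral_of_le Real.pi_pos.le,
            integral_congr_ae (g := fun x => τ⁻¹ * y 0 * c (κ - τ⁻¹) x ^ 2), integral_const_mul,
            ← intervalIntegral.integral_of_le Real.pi_pos.le] at h1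
          · exact (mul_ne_zero (mul_ne_zero (inv_ne_zero hτ) hy0)
              (hc.integral_sq_pos (κ - τ⁻¹)).ne') h1
          · filter_upwards [hvc] with x hx
            rw [hx]
            ring
    exact Subtype.ext (Lp.eq_zero_iff_ae_eq_zero.2 hv0)
  exact Submodule.eq_bot_of_subsingleton

end Completeness

/-! ### Completeness, counting and numbering of the eigenvalues -/

section Spectrum

variable {q : ℝ → ℝ} {h H : ℝ} {c c₁ : ℝ → ℝ → ℝ}

lemma sq_lt_sq_of_near {r : ℕ → ℝ} {N : ℕ} (hr : ∀ n, N ≤ n → |r n - n| ≤ 1 / 4) {m n : ℕ}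
    (hm : N ≤ m) (hm1 : 1 ≤ m) (hmn : m < n) : r m ^ 2 < r n ^ 2 := by
  have h1 := abs_le.1 (hr m hm)
  have h2 := abs_le.1 (hr n (hm.trans hmn.le))
  have h3 : (m : ℝ) + 1 ≤ n := by exact_mod_cast hmn
  have h4 : (1 : ℝ) ≤ m := by exact_mod_cast hm1
  exact pow_lt_pow_left₀ (by linarith) (by linarith) two_ne_zero

/-- The numbers `rₙ` are the square roots of all the eigenvalues from the `N`-th on. -/
structure IsSpectralTail (c c₁ : ℝ → ℝ → ℝ) (H A : ℝ) (N : ℕ) (r : ℕ → ℝ) (F : Finset ℝ) :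
    Prop where
  pos : 0 < A
  one_le : 1 ≤ N
  charFun_eq : ∀ n, N ≤ n → charFun H c c₁ (r n ^ 2) = 0
  near : ∀ n : ℕ, N ≤ n → |r n - n| ≤ A / n ∧ A / n ≤ 1 / 4
  card_eq : F.card = N
  charFun_iff : ∀ μ, charFun H c c₁ μ = 0 ↔ μ ∈ F ∨ ∃ n, N ≤ n ∧ r n ^ 2 = μ
  notMem : ∀ n, N ≤ n → r n ^ 2 ∉ F

/-- The comparison of bases is used in both directions. Cosines against the tail of the roots show
that the orthogonal complement of that tail has dimension at most `M`; this gives completeness and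
at most `M` further eigenvalues. Eigenfunctions against the tail of the cosines give at least `M`.
The exact count is what forces the root near `n` to have index `n`. -/
lemma exists_spectralTail (hc : IsCauchyPair q h c c₁) (hq : IntervalIntegrable q volume 0 π)
    (H : ℝ) : orthogonalTo hc {μ | charFun H c c₁ μ = 0} = ⊥ ∧
      ∃ A N r F, IsSpectralTail c c₁ H A N r F := by
  obtain ⟨A, N, hA, hN, r, hr⟩ := exists_root_near_nat hc hq H
  obtain ⟨M, hNM, hM1, hs, hlt⟩ := exists_summable_near hc hq hA fun n hn => (hr n hn).2
  obtain ⟨b₀, hb₀⟩ := exists_cos_hilbertBasis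
  set S : Set ℝ := {μ | charFun H c c₁ μ = 0} with hS
  set S₀ : Set ℝ := range fun n => r (n + M) ^ 2 with hS₀
  have hS₀S : S₀ ⊆ S := by
    rintro _ ⟨n, rfl⟩
    exact (hr (n + M) (by omega)).1
  have hr4 : ∀ n, M ≤ n → |r n - n| ≤ 1 / 4 := fun n hn =>
    (hr n (hNM.trans hn)).2.1.trans (hr n (hNM.trans hn)).2.2
  have hinj : Function.Injective fun n => r (n + M) ^ 2 := by
    refine StrictMono.injective (fun m n hmn => ?_)
    exact sq_lt_sq_of_near hr4 (by omega) (by omega) (by omega)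
  have hmono : orthogonalTo hc S ≤ orthogonalTo hc S₀ :=
    Submodule.orthogonal_le (Submodule.span_mono (image_mono hS₀S))
  -- The exceptions are the cosines of index below `M`.
  have hV₀ := finrank_le_of_near b₀ (j := fun n => n + M) (add_left_injective M)
    (F := Finset.range M) (fun i hi => ⟨i - M, by simp at hi; simp; omega⟩)
    (u := fun n => normalizedLp c hc.memLp (r (n + M) ^ 2))
    (by simpa only [hb₀] using hs) (by simpa only [hb₀] using hlt) (V := orthogonalTo hc S₀)
    (fun v hv n => inner_normalizedLp_of_mem hc hv ⟨n, rfl⟩)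
  obtain ⟨hfin₀, hle₀⟩ := hV₀
  rw [Finset.card_range] at hle₀
  have hbot : orthogonalTo hc S = ⊥ :=
    eigenfunctions_complete hc hq (Submodule.finiteDimensional_of_le hmono)
  refine ⟨hbot, ?_⟩
  obtain ⟨b₁, hb₁⟩ := exists_hilbertBasis (φ := fun μ : S => c μ) (ν := ν₀)
    (fun μ => hc.memLp μ)
    (fun μ => by
      rw [← intervalIntegral.integral_of_le Real.pi_pos.le]
      exact hc.integral_sq_pos μ)
    (fun μ κ hne => by
      rw [← intervalIntegral.integral_of_le Real.pi_pos.le]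
      exact integral_mul_eq_zero_of_charFun hc μ.2 κ.2 (fun h => hne (Subtype.ext h)))
    (fun f hf h0 => by
      have hm : hf.toLp f ∈ orthogonalTo hc S := by
        rw [mem_orthogonalTo]
        intro μ hμ
        rw [real_inner_comm, inner_toLp]
        exact h0 ⟨μ, hμ⟩
      rw [hbot, Submodule.mem_bot] at hm
      have h1 := hf.coeFn_toLp
      rw [hm] at h1
      exact h1.symm.trans (Lp.coeFn_zero _ _ _))
  have hb₁' : ∀ μ : S, b₁ μ = normalizedLp c hc.memLp μ := fun μ => by rw [hb₁]; rfl
  set O : Set S := {μ | (μ : ℝ) ∉ S₀} with hO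
  have horth : Orthonormal ℝ fun μ : O => b₁ μ := b₁.orthonormal.comp _ Subtype.val_injective
  have hmem : ∀ μ : O, b₁ μ ∈ orthogonalTo hc S₀ := by
    intro μ
    rw [mem_orthogonalTo]
    intro κ hκ
    rw [hb₁', normalizedLp_eq, inner_smul_right, inner_toLp,
      ← intervalIntegral.integral_of_le Real.pi_pos.le,
      integral_mul_eq_zero_of_charFun hc (hS₀S hκ) μ.1.2 (fun h => μ.2 (h ▸ hκ)), mul_zero]
  have hli : LinearIndependent ℝ fun μ : O => (⟨b₁ μ, hmem μ⟩ : orthogonalTo hc S₀) :=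
    LinearIndependent.of_comp (orthogonalTo hc S₀).subtype horth.linearIndependent
  have hOfin : Finite O := hli.finite
  have : Fintype O := Fintype.ofFinite O
  have hcard1 : O.toFinset.card ≤ M := by
    rw [toFinset_card]
    exact hli.fintype_card_le_finrank.trans hle₀
  -- The span of the first `M` cosines is orthogonal to the later ones, so its dimension `M` is
  -- bounded by the number of eigenvalues outside the tail.
  have hcard2 : M ≤ O.toFinset.card := by
    have hli0 : LinearIndependent ℝ fun i : Fin M => b₀ i :=
      (b₀.orthonormal.comp _ Fin.val_injective).linearIndependent
    have h1 := (finrank_le_of_near b₁ (j := fun n => (⟨r (n + M) ^ 2, hS₀S ⟨n, rfl⟩⟩ : S))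
      (fun m n hmn => hinj (congrArg Subtype.val hmn)) (F := O.toFinset)
      (fun i hi => by
        rw [mem_toFinset, hO, mem_ofPred_eq, not_not] at hi
        obtain ⟨n, hn⟩ := hi
        exact ⟨n, Subtype.ext hn⟩)
      (u := fun n => b₀ (n + M))
      (by simpa only [hb₀, hb₁', norm_sub_rev] using hs)
      (by simpa only [hb₀, hb₁', norm_sub_rev] using hlt)
      (V := Submodule.span ℝ (range fun i : Fin M => b₀ i)) (fun v hv n => by
        induction hv using Submodule.span_induction with
        | mem u hu =>
          obtain ⟨i, rfl⟩ := hu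
          exact b₀.orthonormal.2 (by have := i.2; omega)
        | zero => exact inner_zero_right _
        | add x y _ _ hx hy => rw [inner_add_right, hx, hy, add_zero]
        | smul a x _ hx => rw [inner_smul_right, hx, mul_zero])).2
    rwa [finrank_span_eq_card hli0, Fintype.card_fin] at h1
  refine ⟨A, M, r, O.toFinset.map (Function.Embedding.subtype _), hA, hM1,
    fun n hn => (hr n (hNM.trans hn)).1, fun n hn => (hr n (hNM.trans hn)).2, ?_, ?_, ?_⟩
  · rw [Finset.card_map]
    exact le_antisymm hcard1 hcard2
  · intro μ
    constructor
    · intro hμ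
      by_cases h0 : μ ∈ S₀
      · obtain ⟨n, hn⟩ := h0
        exact Or.inr ⟨n + M, by omega, hn⟩
      · refine Or.inl (Finset.mem_map.2 ⟨⟨μ, hμ⟩, ?_, rfl⟩)
        rw [mem_toFinset]
        exact h0
    · rintro (h0 | ⟨n, hn, rfl⟩)
      · obtain ⟨κ, -, rfl⟩ := Finset.mem_map.1 h0
        exact κ.2
      · exact (hr n (hNM.trans hn)).1
  · intro n hn h0
    obtain ⟨κ, hκ, h1⟩ := Finset.mem_map.1 h0
    rw [mem_toFinset] at hκ
    refine hκ ⟨n - M, ?_⟩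
    simp only [Nat.sub_add_cancel hn]
    exact h1.symm

/-- Existence of the sequence of the eigenvalues, with the square roots `rₙ` from some point on. -/
lemma exists_isEigenvalueSequence (hc : IsCauchyPair q h c c₁) (hq : IntervalIntegrable q volume 0 π)
    (H : ℝ) : ∃ lam, IsEigenvalueSequence q h H lam ∧ ∃ A M, ∃ r : ℕ → ℝ, 0 < A ∧ 1 ≤ M ∧
      ∀ n : ℕ, M ≤ n → lam n = r n ^ 2 ∧ |r n - n| ≤ A / n ∧ A / n ≤ 1 / 4 := by
  obtain ⟨-, A, N, r, F, ht⟩ := exists_spectralTail hc hq H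
  have hr4 : ∀ n, N ≤ n → |r n - n| ≤ 1 / 4 := fun n hn => (ht.near n hn).1.trans (ht.near n hn).2
  have hlt : ∀ {m n}, N ≤ m → m < n → r m ^ 2 < r n ^ 2 := fun hm hmn =>
    sq_lt_sq_of_near hr4 hm (ht.one_le.trans hm) hmn
  -- From `M` on the roots exceed every exceptional eigenvalue, so the increasing enumeration can be
  -- glued there.
  obtain ⟨M, hNM, hM⟩ : ∃ M, N ≤ M ∧ ∀ μ ∈ F, μ < r M ^ 2 := by
    obtain ⟨B, hB⟩ := F.exists_le
    obtain ⟨k, hk⟩ := exists_nat_gt (B + 2)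
    refine ⟨max N (max k 2), le_max_left _ _, fun μ hμ => (hB μ hμ).trans_lt ?_⟩
    have h1 := abs_le.1 (hr4 _ (le_max_left N (max k 2)))
    have h2 : (k : ℝ) ≤ (max N (max k 2) : ℕ) := by
      exact_mod_cast (le_max_left k 2).trans (le_max_right N _)
    have h3 : (2 : ℝ) ≤ (max N (max k 2) : ℕ) := by
      exact_mod_cast (le_max_right k 2).trans (le_max_right N _)
    nlinarith
  -- All eigenvalues below `r M ^ 2`. There are `N + (M - N) = M` of them, and they fill the places
  -- `0, …, M - 1` in increasing order.
  set S := F ∪ (Finset.Ico N M).image fun n => r n ^ 2 with hS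
  have hSM : ∀ μ ∈ S, μ < r M ^ 2 := by
    intro μ hμ
    rcases Finset.mem_union.1 hμ with h0 | h0
    · exact hM μ h0
    · obtain ⟨n, hn, rfl⟩ := Finset.mem_image.1 h0
      rw [Finset.mem_Ico] at hn
      exact hlt hn.1 hn.2
  have hcard : S.card = M := by
    rw [hS, Finset.card_union_of_disjoint, Finset.card_image_of_injOn, ht.card_eq, Nat.card_Ico]
    · omega
    · intro m hm n hn hmn
      rw [Finset.coe_Ico] at hm hn
      by_contra hne
      rcases lt_or_gt_of_ne hne with h1 | h1
      · exact (hlt hm.1 h1).ne hmn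
      · exact (hlt hn.1 h1).ne' hmn
    · rw [Finset.disjoint_right]
      intro μ hμ
      obtain ⟨n, hn, rfl⟩ := Finset.mem_image.1 hμ
      exact ht.notMem n (Finset.mem_Ico.1 hn).1
  set lam : ℕ → ℝ := fun n => if hn : n < M then S.orderEmbOfFin hcard ⟨n, hn⟩ else r n ^ 2 with hlam
  have hlam1 : ∀ n (hn : n < M), lam n = S.orderEmbOfFin hcard ⟨n, hn⟩ := fun n hn => by
    simp only [hlam, dif_pos hn]
  have hlam2 : ∀ n, M ≤ n → lam n = r n ^ 2 := fun n hn => by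
    simp only [hlam, dif_neg (not_lt.2 hn)]
  refine ⟨lam, ⟨strictMono_nat_of_lt_succ fun n => ?_, fun μ => ?_⟩, A, M, r, ht.pos,
    ht.one_le.trans hNM, fun n hn => ⟨hlam2 n hn, ht.near n (hNM.trans hn)⟩⟩
  · rcases lt_trichotomy (n + 1) M with h1 | h1 | h1
    · rw [hlam1 n (by omega), hlam1 (n + 1) h1, OrderEmbedding.lt_iff_lt]
      exact Fin.mk_lt_mk.2 (Nat.lt_succ_self n)
    · rw [hlam1 n (by omega), hlam2 (n + 1) h1.ge, h1]
      exact hSM _ (Finset.orderEmbOfFin_mem _ _ _)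
    · rw [hlam2 n (by omega), hlam2 (n + 1) h1.le]
      exact hlt (by omega) (Nat.lt_succ_self n)
  · rw [isEigenvalue_iff hc hq, ht.charFun_iff]
    constructor
    · rintro ⟨n, rfl⟩
      by_cases hn : n < M
      · rw [hlam1 n hn]
        have h1 := Finset.orderEmbOfFin_mem S hcard ⟨n, hn⟩
        rcases Finset.mem_union.1 h1 with h0 | h0
        · exact Or.inl h0
        · obtain ⟨k, hk, h2⟩ := Finset.mem_image.1 h0
          exact Or.inr ⟨k, (Finset.mem_Ico.1 hk).1, h2⟩
      · exact Or.inr ⟨n, by omega, (hlam2 n (not_lt.1 hn)).symm⟩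
    · intro h0
      by_cases hμ : μ ∈ S
      · have h1 : μ ∈ range (S.orderEmbOfFin hcard) := by
          rw [Finset.range_orderEmbOfFin]
          exact hμ
        obtain ⟨i, hi⟩ := h1
        exact ⟨i, by rw [hlam1 i i.2]; exact hi⟩
      · rcases h0 with h0 | ⟨n, hn, h0⟩
        · exact absurd (Finset.mem_union_left _ h0) hμ
        · refine ⟨n, ?_⟩
          rw [hlam2 n ?_, h0]
          by_contra hlt'
          exact hμ (Finset.mem_union_right _ (Finset.mem_image.2
            ⟨n, Finset.mem_Ico.2 ⟨hn, not_le.1 hlt'⟩, h0⟩))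

/-- The square roots of the eigenvalues are eventually close to the integers. -/
lemma IsEigenvalueSequence.exists_roots (hc : IsCauchyPair q h c c₁)
    (hq : IntervalIntegrable q volume 0 π) {lam : ℕ → ℝ} (hl : IsEigenvalueSequence q h H lam) :
    ∃ A M, ∃ r : ℕ → ℝ, 0 < A ∧ 1 ≤ M ∧
      ∀ n : ℕ, M ≤ n → lam n = r n ^ 2 ∧ |r n - n| ≤ A / n ∧ A / n ≤ 1 / 4 := by
  obtain ⟨lam', hl', hr⟩ := exists_isEigenvalueSequence hc hq H
  have : lam = lam' := by
    rw [← hl.1.range_inj hl'.1]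
    ext μ
    rw [mem_range, mem_range, hl.2, hl'.2]
  rwa [this]

/-- Parseval's identity for the eigenfunctions. -/
lemma IsEigenvalueSequence.hasSum (hc : IsCauchyPair q h c c₁) (hq : IntervalIntegrable q volume 0 π)
    {lam : ℕ → ℝ} (hl : IsEigenvalueSequence q h H lam) {f g : ℝ → ℝ} (hf : MemLp f 2 ν₀)
    (hg : MemLp g 2 ν₀) :
    HasSum (fun n => (∫ x in (0 : ℝ)..π, f x * c (lam n) x) * (∫ x in (0 : ℝ)..π, g x * c (lam n) x)
      / weight c lam n) (∫ x in (0 : ℝ)..π, f x * g x) := by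
  have hchar : ∀ n, charFun H c c₁ (lam n) = 0 := fun n =>
    (isEigenvalue_iff hc hq).1 ((hl.2 _).1 ⟨n, rfl⟩)
  simp only [weight, intervalIntegral.integral_of_le Real.pi_pos.le]
  refine parseval (φ := fun n => c (lam n)) (ν := ν₀) (fun n => hc.memLp _) ?_ ?_ ?_ hf hg
  · intro n
    rw [← intervalIntegral.integral_of_le Real.pi_pos.le]
    exact hc.integral_sq_pos _
  · intro n m hnm
    rw [← intervalIntegral.integral_of_le Real.pi_pos.le]
    exact integral_mul_eq_zero_of_charFun hc (hchar n) (hchar m) (hl.1.injective.ne hnm)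
  · intro f hf h0
    have hm : hf.toLp f ∈ orthogonalTo hc {μ | charFun H c c₁ μ = 0} := by
      rw [mem_orthogonalTo]
      intro μ hμ
      obtain ⟨n, rfl⟩ := (hl.2 μ).2 ((isEigenvalue_iff hc hq).2 hμ)
      rw [real_inner_comm, inner_toLp]
      exact h0 n
    rw [(exists_spectralTail hc hq H).1, Submodule.mem_bot] at hm
    have h1 := hf.coeFn_toLp
    rw [hm] at h1
    exact h1.symm.trans (Lp.coeFn_zero _ _ _)

end Spectrum

/-! ### Absolute and uniform convergence of the corrected series -/

lemma sum_Icc_one_eq_sum_range (g : ℕ → ℝ) (N : ℕ) :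
    ∑ n ∈ Finset.Icc 1 N, g n = ∑ n ∈ Finset.range N, g (n + 1) := by
  rw [Finset.range_eq_Ico, Finset.sum_Ico_add' g 0 N 1]
  rfl

/-- A series dominated by `aₙ / n` with `∑ aₙ²` bounded converges absolutely and uniformly. -/
lemma convergesAbsolutelyUniformlyOn_of_bound {f : ℕ → ℝ → ℝ → ℝ} {S : Set (ℝ × ℝ)}
    {a : ℕ → ℝ × ℝ → ℝ} {C : ℝ} {M : ℕ}
    (hf : ∀ n, M ≤ n → ∀ p ∈ S, |f n p.1 p.2| ≤ a n p * (1 / n))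
    (ha : ∀ p ∈ S, ∀ s : Finset ℕ, ∑ n ∈ s, a n p ^ 2 ≤ C) :
    ConvergesAbsolutelyUniformlyOn f S := by
  have hsum : Summable fun n : ℕ => (1 / (n : ℝ)) ^ 2 := by
    simpa only [one_div, inv_pow] using Real.summable_nat_pow_inv.2 (one_lt_two)
  set τ : ℕ → ℝ := fun m => ∑' n : ℕ, (1 / ((n + m : ℕ) : ℝ)) ^ 2 with hτ
  have hτ0 : Tendsto (fun m => √(C * τ (m + 1))) atTop (nhds 0) := by
    have h1 : Tendsto τ atTop (nhds 0) := tendsto_sum_nat_add fun n : ℕ => (1 / (n : ℝ)) ^ 2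
    have h2 := ((h1.comp (tendsto_add_atTop_nat 1)).const_mul C).sqrt
    simpa using h2
  -- Cauchy–Schwarz separates `∑ aₙ²`, bounded by `C`, from the tail of `∑ 1/n²`; the bound is the
  -- same for all points and all lengths of the block.
  have key : ∀ p ∈ S, ∀ m, M ≤ m → ∀ N, ∑ n ∈ Finset.range N, |f (n + m) p.1 p.2| ≤ √(C * τ m) := by
    intro p hp m hm N
    have h1 : ∑ n ∈ Finset.range N, |f (n + m) p.1 p.2|
        ≤ ∑ n ∈ Finset.range N, a (n + m) p * (1 / ((n + m : ℕ) : ℝ)) :=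
      Finset.sum_le_sum fun n _ => hf (n + m) (by omega) p hp
    have h2 : ∑ n ∈ Finset.range N, a (n + m) p ^ 2 ≤ C := by
      have := ha p hp ((Finset.range N).map (addRightEmbedding m))
      rwa [Finset.sum_map] at this
    have hs := (summable_nat_add_iff m).2 hsum
    have h3 : ∑ n ∈ Finset.range N, (1 / ((n + m : ℕ) : ℝ)) ^ 2 ≤ τ m :=
      hs.sum_le_tsum _ (fun n _ => sq_nonneg _)
    refine h1.trans (Real.le_sqrt_of_sq_le ((Finset.sum_mul_sq_le_sq_mul_sq _ _ _).trans ?_))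
    exact mul_le_mul h2 h3 (Finset.sum_nonneg fun n _ => sq_nonneg _)
      ((Finset.sum_nonneg fun n _ => sq_nonneg _).trans h2)
  have hsM : ∀ p ∈ S, ∀ m, M ≤ m → Summable fun n : ℕ => |f (n + m) p.1 p.2| := fun p hp m hm =>
    summable_of_sum_range_le (fun n => abs_nonneg _) (key p hp m hm)
  have hs1 : ∀ p ∈ S, Summable fun n : ℕ => |f (n + 1) p.1 p.2| := by
    intro p hp
    refine (summable_nat_add_iff (f := fun n => |f n p.1 p.2|) 1).2 ?_
    exact (summable_nat_add_iff (f := fun n => |f n p.1 p.2|) M).1 (hsM p hp M le_rfl)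
  have htail : ∀ p ∈ S, ∀ N, M ≤ N → ∑' n : ℕ, |f (n + (N + 1)) p.1 p.2| ≤ √(C * τ (N + 1)) :=
    fun p hp N hN => Real.tsum_le_of_sum_range_le (fun n => abs_nonneg _)
      (key p hp (N + 1) (by omega))
  refine ⟨hs1, ?_, ?_⟩
  · rw [Metric.tendstoUniformlyOn_iff]
    intro ε hε
    filter_upwards [hτ0.eventually_lt_const hε, eventually_ge_atTop M] with N hN hMN p hp
    have h1 := (hs1 p hp).sum_add_tsum_nat_add N
    simp only [add_assoc] at h1
    rw [sum_Icc_one_eq_sum_range, Real.dist_eq, ← h1, add_sub_cancel_left, abs_of_nonneg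
      (tsum_nonneg fun n => abs_nonneg _)]
    exact (htail p hp N hMN).trans_lt hN
  · rw [Metric.tendstoUniformlyOn_iff]
    intro ε hε
    filter_upwards [hτ0.eventually_lt_const hε, eventually_ge_atTop M] with N hN hMN p hp
    have h1 := (hs1 p hp).of_abs.sum_add_tsum_nat_add N
    simp only [add_assoc] at h1
    rw [sum_Icc_one_eq_sum_range, Real.dist_eq, ← h1, add_sub_cancel_left]
    refine lt_of_le_of_lt ?_ ((htail p hp N hMN).trans_lt hN)
    have := norm_tsum_le_tsum_norm (f := fun n => f (n + (N + 1)) p.1 p.2)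
      (hsM p hp (N + 1) (by omega))
    simpa only [Real.norm_eq_abs] using this

lemma abs_cos_sub_taylor_le {a u : ℝ} (hu : |u| ≤ 1) :
    |Real.cos (a + u) - Real.cos a + u * Real.sin a| ≤ 2 * u ^ 2 := by
  have e : Real.cos (a + u) - Real.cos a + u * Real.sin a
      = Real.cos a * (Real.cos u - 1) - Real.sin a * (Real.sin u - u) := by
    rw [Real.cos_add]; ring
  rw [e]
  refine (abs_sub _ _).trans ?_
  rw [abs_mul, abs_mul]
  have h1 : |Real.cos a| * |Real.cos u - 1| ≤ u ^ 2 / 2 :=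
    (mul_le_of_le_one_left (abs_nonneg _) (Real.abs_cos_le_one _)).trans (abs_cos_sub_one_le u)
  have h2 : |Real.sin a| * |Real.sin u - u| ≤ |u| ^ 3 :=
    (mul_le_of_le_one_left (abs_nonneg _) (Real.abs_sin_le_one _)).trans (abs_sin_sub_self_le hu)
  have h3 : |u| ^ 3 ≤ |u| ^ 2 := pow_le_pow_of_le_one (abs_nonneg _) hu (by norm_num)
  rw [sq_abs] at h3
  linarith [sq_nonneg u]

section Bessel

variable {f : ℝ → ℝ} {x B : ℝ}

lemma memLp_indicator (hf : ContinuousOn f (Icc 0 x)) :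
    MemLp ((Ioc 0 x).indicator f) 2 ν₀ := by
  obtain ⟨C, hC⟩ := isCompact_Icc.exists_bound_of_continuousOn hf
  have hm : AEStronglyMeasurable ((Ioc 0 x).indicator f) volume :=
    (aestronglyMeasurable_indicator_iff measurableSet_Ioc).2
      ((hf.mono Ioc_subset_Icc_self).aestronglyMeasurable measurableSet_Ioc)
  refine MemLp.of_bound hm.restrict |C| (Eventually.of_forall fun s => ?_)
  by_cases hs : s ∈ Ioc 0 x
  · rw [indicator_of_mem hs]
    exact (hC s (Ioc_subset_Icc_self hs)).trans (le_abs_self C)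
  · rw [indicator_of_notMem hs, norm_zero]
    exact abs_nonneg C

lemma integral_indicator_mul (hx : x ∈ Icc 0 π) (g : ℝ → ℝ) :
    ∫ s in (0 : ℝ)..π, (Ioc 0 x).indicator f s * g s = ∫ s in (0 : ℝ)..x, f s * g s := by
  rw [intervalIntegral.integral_of_le Real.pi_pos.le, intervalIntegral.integral_of_le hx.1]
  have e : (fun s => (Ioc 0 x).indicator f s * g s) = (Ioc 0 x).indicator fun s => f s * g s := by
    funext s
    by_cases hs : s ∈ Ioc 0 x <;> simp [hs]
  rw [e, integral_indicator measurableSet_Ioc, Measure.restrict_restrict measurableSet_Ioc,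
    inter_eq_self_of_subset_left (Ioc_subset_Ioc_right hx.2)]

lemma integral_indicator_sq_le (hB : ∀ s ∈ Icc 0 x, |f s| ≤ B) :
    ∫ s in (0 : ℝ)..π, (Ioc 0 x).indicator f s ^ 2 ≤ π * B ^ 2 := by
  have := intervalIntegral.norm_integral_le_of_norm_le_const (a := 0) (b := π)
    (f := fun s => (Ioc 0 x).indicator f s ^ 2) (C := B ^ 2) (fun s _ => by
      rw [norm_pow]
      by_cases hs : s ∈ Ioc 0 x
      · rw [indicator_of_mem hs]
        exact pow_le_pow_left₀ (norm_nonneg _) (hB s (Ioc_subset_Icc_self hs)) 2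
      · rw [indicator_of_notMem hs, norm_zero, zero_pow two_ne_zero]
        exact sq_nonneg _)
  rw [sub_zero, abs_of_pos Real.pi_pos] at this
  linarith [(le_abs_self _).trans this]

/-- Extension by zero turns an integral over `[0, x]` into a full Fourier coefficient. Bessel's
bound then depends on the supremum of `f` only and not on `x`, as uniform convergence requires. -/
lemma sum_integral_cos_sq_le (hx : x ∈ Icc 0 π) (hf : ContinuousOn f (Icc 0 x))
    (hB : ∀ s ∈ Icc 0 x, |f s| ≤ B) (F : Finset ℕ) :
    ∑ n ∈ F, (∫ s in (0 : ℝ)..x, f s * Real.cos (n * s)) ^ 2 ≤ π * (π * B ^ 2) := by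
  obtain ⟨h1, h2⟩ := bessel_cos (memLp_indicator hf)
  simp only [integral_indicator_mul hx] at h1 h2
  exact (h1.sum_le_tsum F fun n _ => sq_nonneg _).trans
    (h2.trans (mul_le_mul_of_nonneg_left (integral_indicator_sq_le hB) Real.pi_pos.le))

lemma sum_integral_sin_sq_le (hx : x ∈ Icc 0 π) (hf : ContinuousOn f (Icc 0 x))
    (hB : ∀ s ∈ Icc 0 x, |f s| ≤ B) (F : Finset ℕ) :
    ∑ n ∈ F, (∫ s in (0 : ℝ)..x, f s * Real.sin (n * s)) ^ 2 ≤ π * (π * B ^ 2) := by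
  obtain ⟨h1, h2⟩ := bessel_sin (memLp_indicator hf)
  simp only [integral_indicator_mul hx] at h1 h2
  exact (h1.sum_le_tsum F fun n _ => sq_nonneg _).trans
    (h2.trans (mul_le_mul_of_nonneg_left (integral_indicator_sq_le hB) Real.pi_pos.le))

end Bessel

section Terms

/-- The elementary estimate behind the bound of the terms of the series. -/
lemma abs_product_expansion_le {A B G₀ u e x t X Y sx st g k R₁ R₂ R₃ cn cr Cr : ℝ} (hA : 0 < A)
    (hB : 0 < B) (hG : 0 ≤ G₀) (hu : 0 < u) (he : |e| ≤ A * u) (hx : |x| ≤ π) (ht : |t| ≤ π)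
    (hsx : |sx| ≤ 1) (hst : |st| ≤ 1) (hCr : |Cr| ≤ 1) (hcn : |cn| ≤ B)
    (hd : |Cr - Y| ≤ π * (A * u)) (hR₁ : |R₁| ≤ 2 * (π * (A * u)) ^ 2)
    (hR₃ : |R₃| ≤ 2 * (π * (A * u)) ^ 2) (hR₂ : |R₂| ≤ G₀ * (2 * (π * (A * u)) ^ 2))
    (ecn : cn = X + g) (ecr : cr = X - e * x * sx + R₁ + g - e * k + R₂)
    (eCr : Cr = Y - e * t * st + R₃) :
    |cn * Y - cr * Cr - e * (x * sx * Y + t * st * X)|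
      ≤ (A + π * A + (3 + 2 * G₀ + 2 * B) * (π * A) ^ 2) * u * (u + |g| + |k|) := by
  -- With `u = 1/n`, `e = r - n`, and `g`, `k` the cosine and sine coefficients of the kernel
  -- section, removing the first-order terms leaves only summands with two small factors: `O(u²)`,
  -- or `e` times `g` or `k`.
  have e1 : cn * Y - cr * Cr - e * (x * sx * Y + t * st * X)
      = e * x * sx * (Cr - Y) + (-R₁ + e * k - R₂) * Cr + g * (e * t * st) - cn * R₃ := by
    rw [ecr, ecn, eCr]; ring
  have hπ := Real.pi_pos
  have hAu : 0 < A * u := by positivity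
  have b1 : |e * x * sx * (Cr - Y)| ≤ A * u * π * 1 * (π * (A * u)) := by
    rw [abs_mul, abs_mul, abs_mul]; gcongr
  have b2 : |(-R₁ + e * k - R₂) * Cr|
      ≤ (2 * (π * (A * u)) ^ 2 + A * u * |k| + G₀ * (2 * (π * (A * u)) ^ 2)) * 1 := by
    rw [abs_mul]
    gcongr
    refine (abs_sub _ _).trans (add_le_add ((abs_add_le _ _).trans (add_le_add ?_ ?_)) hR₂)
    · rwa [abs_neg]
    · rw [abs_mul]; gcongr
  have b3 : |g * (e * t * st)| ≤ |g| * (A * u * π * 1) := by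
    rw [abs_mul, abs_mul, abs_mul]; gcongr
  have b4 : |cn * R₃| ≤ B * (2 * (π * (A * u)) ^ 2) := by
    rw [abs_mul]; gcongr
  rw [e1]
  refine (abs_sub _ _).trans ((add_le_add ((abs_add_le _ _).trans (add_le_add ((abs_add_le _ _).trans
    (add_le_add b1 b2)) b3)) b4).trans ?_)
  have h1 : 0 ≤ π * A * u * |k| + A * u * |g| + A * u * u + π * A * u * u
      + (3 + 2 * G₀ + 2 * B) * (π * A) ^ 2 * u * (|g| + |k|) := by positivity
  linarith [show (A + π * A + (3 + 2 * G₀ + 2 * B) * (π * A) ^ 2) * u * (u + |g| + |k|)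
    = A * u * π * 1 * (π * (A * u))
      + (2 * (π * (A * u)) ^ 2 + A * u * |k| + G₀ * (2 * (π * (A * u)) ^ 2)) * 1
      + |g| * (A * u * π * 1) + B * (2 * (π * (A * u)) ^ 2)
      + (π * A * u * |k| + A * u * |g| + A * u * u + π * A * u * u
      + (3 + 2 * G₀ + 2 * B) * (π * A) ^ 2 * u * (|g| + |k|)) by ring]

variable {q : ℝ → ℝ} {h H : ℝ} {c c₁ G : ℝ → ℝ → ℝ} {lam : ℕ → ℝ}

lemma continuousOn_section {A : ℝ → ℝ → ℝ}
    (hA : ContinuousOn (fun p : ℝ × ℝ => A p.1 p.2) triangle) {x : ℝ} (hx : x ∈ Icc 0 π) :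
    ContinuousOn (A x) (Icc 0 x) :=
  hA.comp (f := fun s => (x, s)) (by fun_prop) fun _ hs => ⟨hs.1, hs.2, hx.2⟩

lemma IsCauchyPair.eq_cos_add_integral (hc : IsCauchyPair q h c c₁)
    (hq : IntervalIntegrable q volume 0 π) (hG : IsTransmutationKernel q h G) (ρ : ℝ) {x : ℝ}
    (hx : x ∈ Icc 0 π) :
    c (ρ ^ 2) x = Real.cos (ρ * x) + ∫ s in (0 : ℝ)..x, G x s * Real.cos (ρ * s) := by
  rw [hc.eq_volterra hq hG _ x hx, volterra]
  simp only [cosRoot_sq]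

/-- The expansion of the difference of the products with the parameters `n` and `r`. -/
lemma exists_product_bound (hc : IsCauchyPair q h c c₁) (hq : IntervalIntegrable q volume 0 π)
    (hG : IsTransmutationKernel q h G) {A : ℝ} (hA : 0 < A) :
    ∃ D, 0 < D ∧ ∀ (n : ℕ) (r : ℝ), 1 ≤ n → |r - n| ≤ A / n → A / n ≤ 1 / 4 →
      ∀ x ∈ Icc 0 π, ∀ t ∈ Icc 0 π,
      |c ((n : ℝ) ^ 2) x * Real.cos (n * t) - c (r ^ 2) x * Real.cos (r * t)
        - (r - n) * (x * Real.sin (n * x) * Real.cos (n * t)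
          + t * Real.sin (n * t) * Real.cos (n * x))|
      ≤ D * (1 / n) * (1 / n + |∫ s in (0 : ℝ)..x, G x s * Real.cos (n * s)|
        + |∫ s in (0 : ℝ)..x, G x s * s * Real.sin (n * s)|) := by
  obtain ⟨B, hB0, hB, -⟩ := hc.exists_bound hq
  obtain ⟨G₀, hG0, hGb⟩ := exists_bound_triangle hG.1
  have hπ := Real.pi_pos
  refine ⟨A + π * A + (3 + 2 * (G₀ * π) + 2 * B) * (π * A) ^ 2, by positivity,
    fun n r hn hrn hA4 x hx t ht => ?_⟩
  have hn0 : (0 : ℝ) < n := by exact_mod_cast hn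
  have hAu : A / n = A * (1 / n) := by ring
  have hu1 : ∀ s ∈ Icc 0 π, |(r - n) * s| ≤ π * (A * (1 / n)) := by
    intro s hs
    rw [abs_mul, abs_of_nonneg hs.1, mul_comm, ← hAu]
    exact mul_le_mul hs.2 hrn (abs_nonneg _) hπ.le
  have hR : ∀ s ∈ Icc 0 π, |Real.cos (r * s) - Real.cos (n * s) + (r - n) * s * Real.sin (n * s)|
      ≤ 2 * (π * (A * (1 / n))) ^ 2 := by
    intro s hs
    have h1 : |(r - n) * s| ≤ 1 := by
      refine (hu1 s hs).trans ?_
      rw [← hAu]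
      nlinarith [Real.pi_lt_four]
    have h2 := abs_cos_sub_taylor_le (a := n * s) h1
    rw [show (n : ℝ) * s + (r - n) * s = r * s by ring] at h2
    refine h2.trans (mul_le_mul_of_nonneg_left ?_ zero_le_two)
    rw [← sq_abs]
    exact pow_le_pow_left₀ (abs_nonneg _) (hu1 s hs) 2
  have hGc := continuousOn_section hG.1 hx
  have hint : ∀ w : ℝ → ℝ, Continuous w → IntervalIntegrable (fun s => G x s * w s) volume 0 x :=
    fun w hw => intervalIntegrable_volterra hG.1 hw.continuousOn hx
  refine abs_product_expansion_le (A := A) (B := B) (G₀ := G₀ * π)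
    (R₁ := Real.cos (r * x) - Real.cos (n * x) + (r - n) * x * Real.sin (n * x))
    (R₂ := ∫ s in (0 : ℝ)..x, G x s
      * (Real.cos (r * s) - Real.cos (n * s) + (r - n) * s * Real.sin (n * s)))
    (R₃ := Real.cos (r * t) - Real.cos (n * t) + (r - n) * t * Real.sin (n * t))
    hA hB0 (by positivity) (by positivity) (by rwa [← hAu]) ?_ ?_ (Real.abs_sin_le_one _)
    (Real.abs_sin_le_one _) (Real.abs_cos_le_one _) (hB _ x hx) ?_ (hR x hx) (hR t ht) ?_
    (hc.eq_cos_add_integral hq hG _ hx) ?_ ?_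
  · rw [abs_of_nonneg hx.1]; exact hx.2
  · rw [abs_of_nonneg ht.1]; exact ht.2
  · refine (abs_cos_sub_cos_le _ _).trans ?_
    rw [← sub_mul]
    exact hu1 t ht
  · have := intervalIntegral.norm_integral_le_of_norm_le_const (a := 0) (b := x)
      (f := fun s => G x s
        * (Real.cos (r * s) - Real.cos (n * s) + (r - n) * s * Real.sin (n * s)))
      (C := G₀ * (2 * (π * (A * (1 / n))) ^ 2)) (fun s hs => by
        rw [uIoc_of_le hx.1] at hs
        rw [norm_mul]
        exact mul_le_mul (hGb x s hs.1.le hs.2 hx.2) (hR s ⟨hs.1.le, hs.2.trans hx.2⟩)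
          (norm_nonneg _) hG0.le)
    rw [sub_zero, abs_of_nonneg hx.1] at this
    refine this.trans ?_
    calc _ ≤ G₀ * (2 * (π * (A * (1 / n))) ^ 2) * π :=
          mul_le_mul_of_nonneg_left hx.2 (by positivity)
      _ = _ := by ring
  · rw [hc.eq_cos_add_integral hq hG _ hx]
    have e : ∫ s in (0 : ℝ)..x, G x s
        * (Real.cos (r * s) - Real.cos (n * s) + (r - n) * s * Real.sin (n * s))
        = (∫ s in (0 : ℝ)..x, G x s * Real.cos (r * s)) - (∫ s in (0 : ℝ)..x, G x s * Real.cos (n * s))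
          + (r - n) * ∫ s in (0 : ℝ)..x, G x s * s * Real.sin (n * s) := by
      have i3 : IntervalIntegrable (fun s => G x s * s * Real.sin (n * s)) volume 0 x := by
        simpa only [mul_assoc] using hint (fun s => s * Real.sin (n * s)) (by fun_prop)
      rw [← intervalIntegral.integral_const_mul,
        ← intervalIntegral.integral_sub (hint _ (by fun_prop)) (hint _ (by fun_prop)),
        ← intervalIntegral.integral_add ((hint _ (by fun_prop)).sub (hint _ (by fun_prop)))
          (i3.const_mul _)]
      refine intervalIntegral.integral_congr fun s _ => ?_
      ring
    rw [e]
    ring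
  · ring

/-- Three errors enter: the product expansion around `n`, the deviation of `r - n` from `ω / (πn)`,
and the deviation of the weight from `π/2`. The correction is `2/π` times `ω / (πn)` times the
linear term of the product expansion, so it removes exactly the part of order `1/n` that has no
square summable factor. -/
lemma exists_termG_bound (hc : IsCauchyPair q h c c₁) (hq2 : MemLp q 2 ν₀)
    (hq : IntervalIntegrable q volume 0 π) (hl : IsEigenvalueSequence q h H lam)
    (hG : IsTransmutationKernel q h G) :
    ∃ C M, ∃ k : ℕ → ℝ, 0 < C ∧ Summable (fun n => k n ^ 2) ∧ ∀ n, M ≤ n →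
      ∀ x ∈ Icc 0 π, ∀ t ∈ Icc 0 π, |termG c lam (omega q h H) n x t|
        ≤ C * (k n + |∫ s in (0 : ℝ)..x, G x s * Real.cos (n * s)|
          + |∫ s in (0 : ℝ)..x, G x s * s * Real.sin (n * s)|) * (1 / n) := by
  obtain ⟨A, M, r, hA, hM, hr⟩ := hl.exists_roots hc hq
  obtain ⟨C₁, hC₁, hroot⟩ := exists_root_asymptotics hc hq H hA
  obtain ⟨C₂, hC₂, hweight⟩ := exists_weight_asymptotics hc hq hA
  obtain ⟨D, hD, hprod⟩ := exists_product_bound hc hq hG hA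
  obtain ⟨B, hB0, hB, -⟩ := hc.exists_bound hq
  have hπ := Real.pi_pos
  set ω := omega q h H
  set a : ℕ → ℝ := fun n => ∫ s in (0 : ℝ)..π, q s * Real.cos ((2 * n : ℕ) * s) with ha
  set b : ℕ → ℝ := fun n => ∫ s in (0 : ℝ)..π, q s * (π - s) * Real.sin ((2 * n : ℕ) * s) with hb
  -- Square summable by Bessel, since `a n` and `b n` are the Fourier coefficients of even index
  -- `2n` of `q` and of `(π - s) q`.
  set k : ℕ → ℝ := fun n => |a n| + |b n| + 1 / n with hk
  have hinj : Function.Injective fun n : ℕ => 2 * n := fun m n hmn => by simpa using hmn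
  have hsa : Summable fun n => a n ^ 2 := (bessel_cos hq2).1.comp_injective hinj
  have hsb : Summable fun n => b n ^ 2 := by
    have hm : MemLp (fun s => q s * (π - s)) 2 ν₀ := by
      have h1 : MemLp (fun s => π - s) ⊤ ν₀ := by
        refine memLp_top_of_bound (by fun_prop) π ?_
        refine (ae_restrict_iff' measurableSet_Ioc).2 (Eventually.of_forall fun s hs => ?_)
        rw [Real.norm_eq_abs, abs_le]
        exact ⟨by linarith [hs.2], by linarith [hs.1]⟩
      exact h1.mul hq2
    exact (bessel_sin hm).1.comp_injective hinj
  have hsn : Summable fun n : ℕ => (1 / (n : ℝ)) ^ 2 := by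
    simpa only [one_div, inv_pow] using Real.summable_nat_pow_inv.2 (one_lt_two)
  have hsk : Summable fun n => k n ^ 2 := by
    refine Summable.of_nonneg_of_le (fun n => sq_nonneg _) (fun n => ?_)
      (((hsa.add hsb).add hsn).mul_left 3)
    simp only [hk]
    rw [← sq_abs (a n), ← sq_abs (b n)]
    nlinarith [sq_nonneg (|a n| - |b n|), sq_nonneg (|a n| - 1 / n), sq_nonneg (|b n| - 1 / n)]
  have hevk : ∀ᶠ n in atTop, k n ^ 2 < 1 := hsk.tendsto_atTop_zero.eventually_lt_const one_pos
  have hevn : ∀ᶠ n : ℕ in atTop, C₂ / (n : ℝ) < π / 4 :=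
    (tendsto_const_div_atTop_nhds_zero_nat C₂).eventually_lt_const (by positivity)
  -- From here on the weight deviates from `π/2` by at most `π/4`, so division by it is harmless.
  obtain ⟨M', hM'⟩ := eventually_atTop.1 (hevk.and hevn)
  refine ⟨D + 4 * C₁ + C₂ * B, max M M', k, by positivity, hsk, fun n hn x hx t ht => ?_⟩
  have hn1 : 1 ≤ n := hM.trans ((le_max_left _ _).trans hn)
  have hn0 : (0 : ℝ) < n := by exact_mod_cast hn1
  obtain ⟨hlam, hrn, hA4⟩ := hr n ((le_max_left _ _).trans hn)
  obtain ⟨hk1, hC4⟩ := hM' n ((le_max_right _ _).trans hn)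
  have hk0 : 0 ≤ k n := by simp only [hk]; positivity
  have hk1' : k n ≤ 1 := by nlinarith
  have hchar : charFun H c c₁ (r n ^ 2) = 0 := by
    rw [← hlam]
    exact (isEigenvalue_iff hc hq).1 ((hl.2 _).1 ⟨n, rfl⟩)
  have h1 := hroot n (r n) hn1 hchar hrn hA4
  have h2 := hweight n (r n) hn1 hrn hA4
  have h3 := hprod n (r n) hn1 hrn hA4 x hx t ht
  set u : ℝ := 1 / n with hu
  have hu0 : 0 < u := by positivity
  set α := ∫ x in (0 : ℝ)..π, c (r n ^ 2) x ^ 2 with hα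
  set g := ∫ s in (0 : ℝ)..x, G x s * Real.cos (n * s)
  set g' := ∫ s in (0 : ℝ)..x, G x s * s * Real.sin (n * s)
  set E := x * Real.sin (n * x) * Real.cos (n * t) + t * Real.sin (n * t) * Real.cos (n * x) with hE
  have h1' : |r n - n - ω / (π * n)| ≤ C₁ * u * k n := by
    refine h1.trans ?_
    rw [hu, mul_one_div]
    refine mul_le_mul_of_nonneg_left ?_ (by positivity)
    simp only [hk, ha]
    linarith [abs_nonneg (b n)]
  have h2' : |α - π / 2| ≤ C₂ * u * k n := by
    refine h2.trans ?_
    rw [hu, mul_one_div]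
    refine mul_le_mul_of_nonneg_left ?_ (by positivity)
    simp only [hk, hb]
    linarith [abs_nonneg (a n)]
  have hα4 : π / 4 ≤ α := by
    have h4 : C₂ * u * k n ≤ π / 4 := by
      rw [hu, mul_one_div]
      exact (mul_le_of_le_one_right (by positivity) hk1').trans hC4.le
    linarith [(abs_le.1 (h2'.trans h4)).1]
  have hα0 : 0 < α := by linarith
  have huk : u ≤ k n := by
    simp only [hk]
    linarith [abs_nonneg (a n), abs_nonneg (b n)]
  have hEb : |E| ≤ 2 * π := by
    have hxs : ∀ y ∈ Icc 0 π, ∀ z w : ℝ, |y * Real.sin z * Real.cos w| ≤ π := by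
      intro y hy z w
      rw [abs_mul, abs_mul, abs_of_nonneg hy.1]
      refine (mul_le_of_le_one_right (by have := hy.1; positivity) (Real.abs_cos_le_one _)).trans ?_
      exact (mul_le_of_le_one_right hy.1 (Real.abs_sin_le_one _)).trans hy.2
    refine (abs_add_le _ _).trans ?_
    linarith [hxs x hx (n * x) (n * t), hxs t ht (n * t) (n * x)]
  have e1 : termG c lam ω n x t
      = (2 / π) * (c ((n : ℝ) ^ 2) x * Real.cos (n * t) - c (r n ^ 2) x * Real.cos (r n * t)
          - (r n - n) * E) + (2 / π) * ((r n - n - ω / (π * n)) * E)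
        + (α - π / 2) * (2 / (π * α)) * (c (r n ^ 2) x * Real.cos (r n * t)) := by
    rw [termG, correction, weight, weight₀, if_neg (by omega), hlam, cosRoot_sq, ← hα, ← hE]
    field_simp
    ring
  have h2π : 2 / π ≤ 1 := by rw [div_le_one hπ]; linarith [Real.pi_gt_three]
  have b1 := mul_le_mul h2π h3 (abs_nonneg _) zero_le_one
  have b2 : |(r n - n - ω / (π * n)) * E| ≤ C₁ * u * k n * (2 * π) := by
    rw [abs_mul]
    exact mul_le_mul h1' hEb (abs_nonneg _) (by positivity)
  have b3 : |(α - π / 2) * (2 / (π * α)) * (c (r n ^ 2) x * Real.cos (r n * t))|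
      ≤ C₂ * u * k n * 1 * (B * 1) := by
    rw [abs_mul, abs_mul, abs_mul (c _ _)]
    refine mul_le_mul (mul_le_mul h2' ?_ (abs_nonneg _) (by positivity))
      (mul_le_mul (hB _ x hx) (Real.abs_cos_le_one _) (abs_nonneg _) hB0.le) (by positivity)
      (by positivity)
    rw [abs_of_pos (by positivity), div_le_one (by positivity)]
    nlinarith [Real.pi_gt_three]
  rw [e1]
  refine (abs_add_le _ _).trans ((add_le_add (abs_add_le _ _) b3).trans ?_)
  rw [abs_mul, abs_mul (2 / π), abs_of_pos (by positivity : 0 < 2 / π)]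
  have b4 : 2 / π * |(r n - n - ω / (π * n)) * E| ≤ 4 * C₁ * u * k n := by
    refine (mul_le_mul_of_nonneg_left b2 (by positivity)).trans (le_of_eq ?_)
    field_simp
    ring
  have b5 : D * u * (u + |g| + |g'|) ≤ D * u * (k n + |g| + |g'|) := by gcongr
  have b6 : 0 ≤ (4 * C₁ + C₂ * B) * (|g| + |g'|) * u := by positivity
  linarith

/-- The terms of the series are dominated on the whole square. -/
lemma exists_termG_dominated (hc : IsCauchyPair q h c c₁) (hq2 : MemLp q 2 ν₀)
    (hq : IntervalIntegrable q volume 0 π) (hl : IsEigenvalueSequence q h H lam)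
    (hG : IsTransmutationKernel q h G) :
    ∃ (a : ℕ → ℝ → ℝ) (C : ℝ) (M : ℕ),
      (∀ n, M ≤ n → ∀ x ∈ Icc 0 π, ∀ t ∈ Icc 0 π,
        |termG c lam (omega q h H) n x t| ≤ a n x * (1 / n)) ∧
      ∀ x ∈ Icc 0 π, ∀ s : Finset ℕ, ∑ n ∈ s, a n x ^ 2 ≤ C := by
  obtain ⟨C, M, k, hC, hk, hb⟩ := exists_termG_bound hc hq2 hq hl hG
  obtain ⟨G₀, hG0, hGb⟩ := exists_bound_triangle hG.1
  refine ⟨fun n x => C * (k n + |∫ s in (0 : ℝ)..x, G x s * Real.cos (n * s)|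
          + |∫ s in (0 : ℝ)..x, G x s * s * Real.sin (n * s)|),
    3 * C ^ 2 * ((∑' n, k n ^ 2) + π * (π * G₀ ^ 2) + π * (π * (G₀ * π) ^ 2)), M, hb,
    fun x hx s => ?_⟩
  have hGc := continuousOn_section hG.1 hx
  have h1 := hk.sum_le_tsum s fun n _ => sq_nonneg _
  have h2 := sum_integral_cos_sq_le hx hGc (fun s hs => hGb x s hs.1 hs.2 hx.2) s
  have h3 := sum_integral_sin_sq_le hx (f := fun s => G x s * s) (B := G₀ * π)
    (hGc.mul continuousOn_id) (fun s hs => by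
      rw [abs_mul]
      refine mul_le_mul (hGb x s hs.1 hs.2 hx.2) ?_ (abs_nonneg _) hG0.le
      rw [abs_of_nonneg hs.1]
      exact hs.2.trans hx.2) s
  have h4 := add_le_add (add_le_add h1 h2) h3
  rw [← Finset.sum_add_distrib, ← Finset.sum_add_distrib] at h4
  refine le_trans ?_ (mul_le_mul_of_nonneg_left h4 (by positivity))
  rw [Finset.mul_sum]
  refine Finset.sum_le_sum fun n _ => ?_
  rw [mul_pow, mul_comm 3, mul_assoc]
  refine mul_le_mul_of_nonneg_left ?_ (sq_nonneg _)
  rw [← sq_abs (∫ s in (0 : ℝ)..x, G x s * Real.cos (n * s)),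
    ← sq_abs (∫ s in (0 : ℝ)..x, G x s * s * Real.sin (n * s))]
  set y := |∫ s in (0 : ℝ)..x, G x s * Real.cos (n * s)|
  set z := |∫ s in (0 : ℝ)..x, G x s * s * Real.sin (n * s)|
  nlinarith [sq_nonneg (k n - y), sq_nonneg (k n - z), sq_nonneg (y - z)]

/-- The closed square `[0, π] × [0, π]`. -/
def square : Set (ℝ × ℝ) := Icc 0 π ×ˢ Icc 0 π

lemma termG_convergesAbsolutelyUniformlyOn (hc : IsCauchyPair q h c c₁) (hq2 : MemLp q 2 ν₀)
    (hq : IntervalIntegrable q volume 0 π) (hl : IsEigenvalueSequence q h H lam)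
    (hG : IsTransmutationKernel q h G) :
    ConvergesAbsolutelyUniformlyOn (termG c lam (omega q h H)) square := by
  obtain ⟨a, C, M, h1, h2⟩ := exists_termG_dominated hc hq2 hq hl hG
  exact convergesAbsolutelyUniformlyOn_of_bound (a := fun n p => a n p.1)
    (fun n hn p hp => h1 n hn p.1 hp.1 p.2 hp.2) (fun p hp s => h2 p.1 hp.1 s)

/-- The symmetry behind the second representation: estimates for the first series on the whole
square, rather than on the triangle, serve both kernels. -/
lemma termH_eq_neg_termG (c : ℝ → ℝ → ℝ) (lam : ℕ → ℝ) (ω : ℝ) (n : ℕ) (x t : ℝ) :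
    termH c lam ω n x t = -termG c lam ω n t x := by
  rw [termH, termG, correction, correction]
  ring

lemma ConvergesAbsolutelyUniformlyOn.mono {f : ℕ → ℝ → ℝ → ℝ} {S T : Set (ℝ × ℝ)}
    (hf : ConvergesAbsolutelyUniformlyOn f T) (hST : S ⊆ T) : ConvergesAbsolutelyUniformlyOn f S :=
  ⟨fun p hp => hf.1 p (hST hp), hf.2.1.mono hST, hf.2.2.mono hST⟩

lemma termH_convergesAbsolutelyUniformlyOn
    (hf : ConvergesAbsolutelyUniformlyOn (termG c lam (omega q h H)) square) :
    ConvergesAbsolutelyUniformlyOn (termH c lam (omega q h H)) square := by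
  have hsw : ∀ p ∈ square, Prod.swap p ∈ square := fun p hp => ⟨hp.2, hp.1⟩
  simp only [ConvergesAbsolutelyUniformlyOn, termH_eq_neg_termG, abs_neg, Finset.sum_neg_distrib,
    tsum_neg]
  refine ⟨fun p hp => hf.1 p.swap (hsw p hp), ?_, ?_⟩
  · exact (hf.2.1.comp Prod.swap).mono hsw
  · have := (hf.2.2.comp Prod.swap).mono hsw
    exact this.neg

lemma triangle_subset_square : triangle ⊆ square := fun _ hp =>
  ⟨⟨hp.1.trans hp.2.1, hp.2.2⟩, ⟨hp.1, hp.2.1.trans hp.2.2⟩⟩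

end Terms

/-! ### The series tested against products -/

/-- The adjoint of the integral operator with kernel `A`. -/
lemma exists_adjoint {A : ℝ → ℝ → ℝ} (hA : ContinuousOn (fun p : ℝ × ℝ => A p.1 p.2) triangle)
    {w : ℝ → ℝ} (hw : ContinuousOn w (Icc 0 π)) :
    ∃ w' : ℝ → ℝ, ContinuousOn w' (Icc 0 π) ∧ ∀ u : ℝ → ℝ, ContinuousOn u (Icc 0 π) →
      ∫ x in (0 : ℝ)..π, (∫ s in (0 : ℝ)..x, A x s * u s) * w x
        = ∫ x in (0 : ℝ)..π, u x * w' x := by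
  obtain ⟨A', hA', hAA⟩ := exists_continuous_extension_triangle hA
  obtain ⟨v, hv, hvw⟩ := exists_continuous_extension_Icc hw
  refine ⟨fun s => ∫ x in s..π, A' x s * v x, ?_, fun u hu => ?_⟩
  · have h1 : Continuous fun s => ∫ x in π..s, A' x s * v x := by
      refine intervalIntegral.continuous_parametric_intervalIntegral_of_continuous
        (f := fun s x => A' x s * v x) ?_ continuous_id
      refine Continuous.mul (hA'.comp (continuous_snd.prodMk continuous_fst)) (by fun_prop)
    simp only [intervalIntegral.integral_symm π]
    exact h1.neg.continuousOn
  · have hu' : IntervalIntegrable u volume 0 π :=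
      ContinuousOn.intervalIntegrable (by rwa [uIcc_of_le Real.pi_pos.le])
    have h1 := integral_triangle_swap_mul (F := fun x s => A' x s * v x)
      (right_mem_Icc.2 Real.pi_pos.le) hu'
      (Continuous.mul (by exact hA') (by fun_prop))
    rw [← h1]
    refine intervalIntegral.integral_congr fun x hx => ?_
    rw [uIcc_of_le Real.pi_pos.le] at hx
    rw [← intervalIntegral.integral_mul_const]
    refine intervalIntegral.integral_congr fun s hs => ?_
    rw [uIcc_of_le hx.1] at hs
    rw [hAA x s hs.1 hs.2 hx.2, hvw x hx]
    ring

lemma intervalIntegrable_of_continuousOn {f : ℝ → ℝ} (hf : ContinuousOn f (Icc 0 π)) :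
    IntervalIntegrable f volume 0 π :=
  ContinuousOn.intervalIntegrable (by rwa [uIcc_of_le Real.pi_pos.le])

lemma continuousOn_integral_kernel {A : ℝ → ℝ → ℝ}
    (hA : ContinuousOn (fun p : ℝ × ℝ => A p.1 p.2) triangle) {u : ℝ → ℝ}
    (hu : ContinuousOn u (Icc 0 π)) :
    ContinuousOn (fun x => ∫ s in (0 : ℝ)..x, A x s * u s) (Icc 0 π) := by
  refine ((continuousOn_volterra hA hu).sub hu).congr fun x _ => ?_
  simp [volterra]

lemma integral_add_mul {f g w : ℝ → ℝ} (hf : ContinuousOn f (Icc 0 π))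
    (hg : ContinuousOn g (Icc 0 π)) (hw : ContinuousOn w (Icc 0 π)) :
    ∫ x in (0 : ℝ)..π, (f x + g x) * w x
      = (∫ x in (0 : ℝ)..π, f x * w x) + ∫ x in (0 : ℝ)..π, g x * w x := by
  have h1 : ContinuousOn (fun x => f x * w x) (Icc 0 π) := hf.mul hw
  have h2 : ContinuousOn (fun x => g x * w x) (Icc 0 π) := hg.mul hw
  rw [← intervalIntegral.integral_add (intervalIntegrable_of_continuousOn h1)
    (intervalIntegrable_of_continuousOn h2)]
  simp only [add_mul]

section WeakIdentity

variable {q : ℝ → ℝ} {h H : ℝ} {c c₁ G K : ℝ → ℝ → ℝ} {lam : ℕ → ℝ} {f g : ℝ → ℝ}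

/-- Parseval for the cosines applied to `T* g` and `f`: as `c(n, ·) = T cos(n ·)`, the coefficient
of `T* g` is the integral of `c(n, ·)` against `g`, and the sum is `⟨T f, g⟩`. -/
lemma hasSum_cos_kernel (hc : IsCauchyPair q h c c₁) (hq : IntervalIntegrable q volume 0 π)
    (hG : IsTransmutationKernel q h G) (hf : ContinuousOn f (Icc 0 π))
    (hg : ContinuousOn g (Icc 0 π)) :
    HasSum (fun n : ℕ => (∫ x in (0 : ℝ)..π, c ((n : ℝ) ^ 2) x * g x)
        * (∫ t in (0 : ℝ)..π, Real.cos (n * t) * f t) / weight₀ n)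
      ((∫ x in (0 : ℝ)..π, f x * g x)
        + ∫ x in (0 : ℝ)..π, (∫ s in (0 : ℝ)..x, G x s * f s) * g x) := by
  obtain ⟨g', hg', hadj⟩ := exists_adjoint hG.1 hg
  have hsum := hasSum_cos (memLp_of_continuousOn (hg.add hg')) (memLp_of_continuousOn hf)
  have e1 : ∀ n : ℕ, ∫ x in (0 : ℝ)..π, (g + g') x * Real.cos (n * x)
      = ∫ x in (0 : ℝ)..π, c ((n : ℝ) ^ 2) x * g x := by
    intro n
    have hcos : ContinuousOn (fun x => Real.cos (n * x)) (Icc 0 π) := by fun_prop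
    have h1 := hadj _ hcos
    simp only [Pi.add_apply]
    rw [integral_add_mul hg hg' hcos]
    simp only [mul_comm (g' _)]
    rw [← h1]
    simp only [mul_comm (g _)]
    rw [← integral_add_mul hcos (continuousOn_integral_kernel hG.1 hcos) hg]
    refine intervalIntegral.integral_congr fun x hx => ?_
    rw [uIcc_of_le Real.pi_pos.le] at hx
    rw [hc.eq_cos_add_integral hq hG n hx]
  have e2 : ∫ x in (0 : ℝ)..π, (g + g') x * f x = (∫ x in (0 : ℝ)..π, f x * g x)
        + ∫ x in (0 : ℝ)..π, (∫ s in (0 : ℝ)..x, G x s * f s) * g x := by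
    simp only [Pi.add_apply]
    rw [integral_add_mul hg hg' hf, hadj f hf]
    simp only [mul_comm]
  rw [e2] at hsum
  simpa only [e1, mul_comm (f _)] using hsum

/-- Parseval for the eigenfunctions applied to `g` and `(T⁻¹)* f`: as `cos ρₙ· = T⁻¹ c(ρₙ, ·)`, the
second coefficient is the integral of `cos ρₙ·` against `f`, and the sum is `⟨f, T⁻¹ g⟩`. -/
lemma hasSum_eigen_kernel (hc : IsCauchyPair q h c c₁) (hq : IntervalIntegrable q volume 0 π)
    (hl : IsEigenvalueSequence q h H lam) (hG : IsTransmutationKernel q h G)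
    (hK : IsInverseKernel G K) (hf : ContinuousOn f (Icc 0 π)) (hg : ContinuousOn g (Icc 0 π)) :
    HasSum (fun n : ℕ => (∫ x in (0 : ℝ)..π, c (lam n) x * g x)
        * (∫ t in (0 : ℝ)..π, cosRoot (lam n) t * f t) / weight c lam n)
      ((∫ x in (0 : ℝ)..π, f x * g x)
        + ∫ x in (0 : ℝ)..π, (∫ s in (0 : ℝ)..x, K x s * g s) * f x) := by
  obtain ⟨f', hf', hadj⟩ := exists_adjoint hK.1 hf
  have hsum := hl.hasSum hc hq (memLp_of_continuousOn hg) (memLp_of_continuousOn (hf.add hf'))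
  have e1 : ∀ n : ℕ, ∫ x in (0 : ℝ)..π, (f + f') x * c (lam n) x
      = ∫ x in (0 : ℝ)..π, cosRoot (lam n) x * f x := by
    intro n
    have hcn := hc.continuousOn (lam n)
    have h1 := hadj _ hcn
    simp only [Pi.add_apply]
    rw [integral_add_mul hf hf' hcn]
    simp only [mul_comm (f' _)]
    rw [← h1]
    simp only [mul_comm (f _)]
    rw [← integral_add_mul hcn (continuousOn_integral_kernel hK.1 hcn) hf]
    refine intervalIntegral.integral_congr fun x hx => ?_
    rw [uIcc_of_le Real.pi_pos.le] at hx
    congr 1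
    rw [← (hK.2 _ (continuous_cosRoot (lam n)).continuousOn x hx).1]
    exact volterra_congr (fun _ _ _ _ _ => rfl) (hc.eq_volterra hq hG (lam n)) hx
  have e2 : ∫ x in (0 : ℝ)..π, g x * (f + f') x = (∫ x in (0 : ℝ)..π, f x * g x)
        + ∫ x in (0 : ℝ)..π, (∫ s in (0 : ℝ)..x, K x s * g s) * f x := by
    simp only [Pi.add_apply, mul_comm (g _)]
    rw [integral_add_mul hf hf' hg, hadj g hg]
    simp only [mul_comm (g _)]
  rw [e2] at hsum
  simpa only [e1, mul_comm (g _)] using hsum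

/-- The cosine expansion of the indicator of `t < x`, in weak form. -/
lemma hasSum_sin_cos (hf : ContinuousOn f (Icc 0 π)) (hg : ContinuousOn g (Icc 0 π)) :
    HasSum (fun n : ℕ => 2 / (π * (n + 1 : ℕ))
        * ((∫ x in (0 : ℝ)..π, x * Real.sin ((n + 1 : ℕ) * x) * g x)
        * ∫ t in (0 : ℝ)..π, Real.cos ((n + 1 : ℕ) * t) * f t))
      ((∫ x in (0 : ℝ)..π, (∫ s in (0 : ℝ)..x, x * f s) * g x)
        - (∫ x in (0 : ℝ)..π, x ^ 2 * g x) * (∫ t in (0 : ℝ)..π, f t) / π) := by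
  -- The indicator of `t < x` with the factor `x` is a Volterra kernel. Its cosine coefficients in
  -- `t` are `x sin nx / n` for `n ≥ 1` and `x²` for `n = 0`; the latter is moved to the right-hand
  -- side.
  obtain ⟨g', hg', hadj⟩ := exists_adjoint (A := fun x _ => x) continuous_fst.continuousOn hg
  have hsum := hasSum_cos (memLp_of_continuousOn hg') (memLp_of_continuousOn hf)
  have hcoef : ∀ n : ℕ, ∫ x in (0 : ℝ)..π, g' x * Real.cos (n * x)
      = ∫ x in (0 : ℝ)..π, (∫ s in (0 : ℝ)..x, x * Real.cos (n * s)) * g x := by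
    intro n
    rw [hadj _ (by fun_prop)]
    simp only [mul_comm (g' _)]
  have hpos : ∀ n : ℕ, ∫ x in (0 : ℝ)..π, g' x * Real.cos ((n + 1 : ℕ) * x)
      = 1 / (n + 1 : ℕ) * ∫ x in (0 : ℝ)..π, x * Real.sin ((n + 1 : ℕ) * x) * g x := by
    intro n
    rw [hcoef, ← intervalIntegral.integral_const_mul]
    refine intervalIntegral.integral_congr fun x _ => ?_
    have hn : ((n + 1 : ℕ) : ℝ) ≠ 0 := by positivity
    rw [intervalIntegral.integral_const_mul,
      intervalIntegral.integral_comp_mul_left (fun s => Real.cos s) hn, integral_cos]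
    simp
    field_simp
  have hzero : ∫ x in (0 : ℝ)..π, g' x * Real.cos ((0 : ℕ) * x) = ∫ x in (0 : ℝ)..π, x ^ 2 * g x := by
    rw [hcoef]
    refine intervalIntegral.integral_congr fun x _ => ?_
    simp [sq]
  rw [← hasSum_nat_add_iff' 1] at hsum
  simp only [Finset.sum_range_one, hzero, hpos] at hsum
  have e2 : ∫ x in (0 : ℝ)..π, g' x * f x
      = ∫ x in (0 : ℝ)..π, (∫ s in (0 : ℝ)..x, x * f s) * g x := by
    rw [hadj f hf]
    simp only [mul_comm (g' _)]
  rw [e2] at hsum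
  convert! hsum using 1
  · funext n
    rw [weight₀, if_neg (Nat.succ_ne_zero n)]
    simp only [mul_comm (f _)]
    have := Real.pi_pos
    field_simp
  · simp [weight₀]

/-- The product measure on the square. -/
abbrev ν₂ : Measure (ℝ × ℝ) := ν₀.prod ν₀

lemma ν₂_eq : ν₂ = volume.restrict (Ioc 0 π ×ˢ Ioc 0 π) := by
  rw [ν₂, ν₀, Measure.prod_restrict]
  rfl

lemma isCompact_square : IsCompact square := isCompact_Icc.prod isCompact_Icc

lemma ae_mem_square : ∀ᵐ p ∂ν₂, p ∈ square := by
  rw [ν₂_eq]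
  filter_upwards [ae_restrict_mem (measurableSet_Ioc.prod measurableSet_Ioc)] with p hp
  exact ⟨Ioc_subset_Icc_self hp.1, Ioc_subset_Icc_self hp.2⟩

lemma integrable_of_continuousOn_square {Φ : ℝ × ℝ → ℝ} (hΦ : ContinuousOn Φ square) :
    Integrable Φ ν₂ := by
  rw [ν₂_eq]
  exact (hΦ.integrableOn_compact isCompact_square).mono_set
    (prod_mono Ioc_subset_Icc_self Ioc_subset_Icc_self)

lemma tendsto_integral_of_tendstoUniformlyOn {F : ℕ → ℝ × ℝ → ℝ} {Φ w : ℝ × ℝ → ℝ}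
    (hF : ∀ N, ContinuousOn (F N) square) (hΦ : TendstoUniformlyOn F Φ atTop square)
    (hw : ContinuousOn w square) :
    Tendsto (fun N => ∫ p, F N p * w p ∂ν₂) atTop (nhds (∫ p, Φ p * w p ∂ν₂)) := by
  have hΦc : ContinuousOn Φ square := hΦ.continuousOn (Frequently.of_forall hF)
  obtain ⟨C, hC⟩ := isCompact_square.exists_bound_of_continuousOn hΦc
  refine tendsto_integral_filter_of_dominated_convergence (fun p => (C + 1) * |w p|)
    (Eventually.of_forall fun N => (integrable_of_continuousOn_square ((hF N).mul hw)).1) ?_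
    ((integrable_of_continuousOn_square hw).abs.const_mul _) ?_
  · filter_upwards [Metric.tendstoUniformlyOn_iff.1 hΦ 1 one_pos] with N hN
    filter_upwards [ae_mem_square] with p hp
    rw [norm_mul, Real.norm_eq_abs, Real.norm_eq_abs]
    refine mul_le_mul_of_nonneg_right ?_ (abs_nonneg _)
    have h1 := hN p hp
    rw [Real.dist_eq, abs_sub_comm] at h1
    have h2 := hC p hp
    rw [Real.norm_eq_abs] at h2
    have h3 := abs_sub_abs_le_abs_sub (F N p) (Φ p)
    linarith
  · filter_upwards [ae_mem_square] with p hp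
    exact (hΦ.tendsto_at hp).mul_const _

lemma continuousOn_fst {u : ℝ → ℝ} (hu : ContinuousOn u (Icc 0 π)) :
    ContinuousOn (fun p : ℝ × ℝ => u p.1) square :=
  hu.comp (f := fun p : ℝ × ℝ => p.1) continuous_fst.continuousOn fun _ hp => hp.1

lemma continuousOn_snd {u : ℝ → ℝ} (hu : ContinuousOn u (Icc 0 π)) :
    ContinuousOn (fun p : ℝ × ℝ => u p.2) square :=
  hu.comp (f := fun p : ℝ × ℝ => p.2) continuous_snd.continuousOn fun _ hp => hp.2

lemma integral_mul_mul (u v f g : ℝ → ℝ) :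
    ∫ p : ℝ × ℝ, u p.1 * v p.2 * (g p.1 * f p.2) ∂ν₂
      = (∫ x in (0 : ℝ)..π, u x * g x) * ∫ t in (0 : ℝ)..π, v t * f t := by
  rw [intervalIntegral.integral_of_le Real.pi_pos.le, intervalIntegral.integral_of_le Real.pi_pos.le,
    ← integral_prod_mul]
  congr 1
  funext p
  ring

lemma continuousOn_termG (hc : IsCauchyPair q h c c₁) (lam : ℕ → ℝ) (ω : ℝ) (n : ℕ) :
    ContinuousOn (fun p : ℝ × ℝ => termG c lam ω n p.1 p.2) square := by
  have h1 := continuousOn_fst (hc.continuousOn ((n : ℝ) ^ 2))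
  have h2 := continuousOn_fst (hc.continuousOn (lam n))
  have h3 := continuous_cosRoot (lam n)
  unfold termG correction
  refine ((ContinuousOn.div_const ?_ _).sub (ContinuousOn.div_const ?_ _)).sub ?_
  · exact h1.mul (by fun_prop)
  · exact h2.mul (by fun_prop)
  · fun_prop

lemma integral_termG (hc : IsCauchyPair q h c c₁) (lam : ℕ → ℝ) (ω : ℝ) {n : ℕ}
    (hf : ContinuousOn f (Icc 0 π)) (hg : ContinuousOn g (Icc 0 π)) :
    ∫ p : ℝ × ℝ, termG c lam ω n p.1 p.2 * (g p.1 * f p.2) ∂ν₂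
      = (∫ x in (0 : ℝ)..π, c ((n : ℝ) ^ 2) x * g x)
          * (∫ t in (0 : ℝ)..π, Real.cos (n * t) * f t) / weight₀ n
        - (∫ x in (0 : ℝ)..π, c (lam n) x * g x)
          * (∫ t in (0 : ℝ)..π, cosRoot (lam n) t * f t) / weight c lam n
        - ω / π * (2 / (π * n) * ((∫ x in (0 : ℝ)..π, x * Real.sin (n * x) * g x)
          * ∫ t in (0 : ℝ)..π, Real.cos (n * t) * f t)
        + 2 / (π * n) * ((∫ x in (0 : ℝ)..π, x * Real.sin (n * x) * f x)
          * ∫ t in (0 : ℝ)..π, Real.cos (n * t) * g t)) := by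
  have hw : ContinuousOn (fun p : ℝ × ℝ => g p.1 * f p.2) square :=
    (continuousOn_fst hg).mul (continuousOn_snd hf)
  have hi : ∀ u v : ℝ → ℝ, ContinuousOn u (Icc 0 π) → ContinuousOn v (Icc 0 π) →
      Integrable (fun p : ℝ × ℝ => u p.1 * v p.2 * (g p.1 * f p.2)) ν₂ := fun u v hu hv =>
    integrable_of_continuousOn_square (((continuousOn_fst hu).mul (continuousOn_snd hv)).mul hw)
  have hcos : ContinuousOn (fun t : ℝ => Real.cos (n * t)) (Icc 0 π) := by fun_prop
  have hsin : ContinuousOn (fun t : ℝ => t * Real.sin (n * t)) (Icc 0 π) := by fun_prop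
  have i1 := hi _ _ (hc.continuousOn ((n : ℝ) ^ 2)) hcos
  have i2 := hi _ _ (hc.continuousOn (lam n)) (continuous_cosRoot (lam n)).continuousOn
  have i3 := hi _ _ hsin hcos
  have i4 := hi _ _ hcos hsin
  have e : ∀ p : ℝ × ℝ, termG c lam ω n p.1 p.2 * (g p.1 * f p.2)
      = ((1 / weight₀ n) * (c ((n : ℝ) ^ 2) p.1 * Real.cos (n * p.2) * (g p.1 * f p.2))
        - (1 / weight c lam n) * (c (lam n) p.1 * cosRoot (lam n) p.2 * (g p.1 * f p.2)))
        - ((ω / π * (2 / (π * n))) * (p.1 * Real.sin (n * p.1) * Real.cos (n * p.2)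
            * (g p.1 * f p.2))
          + (ω / π * (2 / (π * n))) * (Real.cos (n * p.1) * (p.2 * Real.sin (n * p.2))
            * (g p.1 * f p.2))) := by
    intro p
    rw [termG, correction]
    have hπ := Real.pi_ne_zero
    -- For `n = 0` the factors `1 / n` are zero by convention, and both sides lose their correction.
    rcases eq_or_ne (n : ℝ) 0 with hn | hn
    · simp only [hn, mul_zero, div_zero, zero_mul]
      ring
    · field_simp
  simp only [e]
  have i12 : Integrable (fun p : ℝ × ℝ =>
      (1 / weight₀ n) * (c ((n : ℝ) ^ 2) p.1 * Real.cos (n * p.2) * (g p.1 * f p.2))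
        - (1 / weight c lam n) * (c (lam n) p.1 * cosRoot (lam n) p.2 * (g p.1 * f p.2))) ν₂ :=
    (i1.const_mul _).sub (i2.const_mul _)
  rw [integral_sub i12 ((i3.const_mul _).fun_add (i4.const_mul _)),
    integral_sub (i1.const_mul _) (i2.const_mul _), integral_add (i3.const_mul _) (i4.const_mul _)]
  simp only [integral_const_mul]
  rw [integral_mul_mul (c ((n : ℝ) ^ 2)) (fun t => Real.cos (n * t)),
    integral_mul_mul (c (lam n)) (cosRoot (lam n)),
    integral_mul_mul (fun x => x * Real.sin (n * x)) (fun t => Real.cos (n * t)),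
    integral_mul_mul (fun t => Real.cos (n * t)) (fun x => x * Real.sin (n * x))]
  ring

/-- The sum of the series tested against a product of continuous functions. -/
lemma integral_tsum_termG (hc : IsCauchyPair q h c c₁) (hq2 : MemLp q 2 ν₀)
    (hq : IntervalIntegrable q volume 0 π) (hl : IsEigenvalueSequence q h H lam)
    (hG : IsTransmutationKernel q h G) (hK : IsInverseKernel G K)
    (hf : ContinuousOn f (Icc 0 π)) (hg : ContinuousOn g (Icc 0 π)) :
    ∫ p : ℝ × ℝ, (∑' n : ℕ, termG c lam (omega q h H) (n + 1) p.1 p.2) * (g p.1 * f p.2) ∂ν₂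
      = (∫ x in (0 : ℝ)..π, (∫ s in (0 : ℝ)..x, G x s * f s) * g x)
        - (∫ x in (0 : ℝ)..π, (∫ s in (0 : ℝ)..x, K x s * g s) * f x)
        - (∫ x in (0 : ℝ)..π, c 0 x * g x) * (∫ t in (0 : ℝ)..π, f t) / π
        + (∫ x in (0 : ℝ)..π, c (lam 0) x * g x) * (∫ t in (0 : ℝ)..π, cosRoot (lam 0) t * f t)
          / weight c lam 0
        - omega q h H / π * (((∫ x in (0 : ℝ)..π, (∫ s in (0 : ℝ)..x, x * f s) * g x)
            - (∫ x in (0 : ℝ)..π, x ^ 2 * g x) * (∫ t in (0 : ℝ)..π, f t) / π)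
          + ((∫ x in (0 : ℝ)..π, (∫ s in (0 : ℝ)..x, x * g s) * f x)
            - (∫ x in (0 : ℝ)..π, x ^ 2 * f x) * (∫ t in (0 : ℝ)..π, g t) / π)) := by
  set ω := omega q h H
  have hw : ContinuousOn (fun p : ℝ × ℝ => g p.1 * f p.2) square :=
    (continuousOn_fst hg).mul (continuousOn_snd hf)
  have hconv := (termG_convergesAbsolutelyUniformlyOn hc hq2 hq hl hG).2.2
  have hcont := continuousOn_termG hc lam ω
  have hint : ∀ n, Integrable (fun p : ℝ × ℝ => termG c lam ω n p.1 p.2 * (g p.1 * f p.2)) ν₂ :=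
    fun n => integrable_of_continuousOn_square ((hcont n).mul hw)
  have ht := tendsto_integral_of_tendstoUniformlyOn
    (fun N => continuousOn_finsetSum _ fun n _ => hcont n) hconv hw
  refine tendsto_nhds_unique ht ?_
  have h1 := hasSum_cos_kernel hc hq hG hf hg
  have h2 := hasSum_eigen_kernel hc hq hl hG hK hf hg
  -- The series starts at `n = 1`; the terms of index `0` are the ones carried by the closed-form
  -- part.
  rw [← hasSum_nat_add_iff' 1] at h1 h2
  have h3 := ((hasSum_sin_cos hf hg).add (hasSum_sin_cos hg hf)).mul_left (ω / π)
  have h4 := ((h1.sub h2).sub h3).tendsto_sum_nat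
  convert! h4 using 1
  · funext N
    simp only [Finset.sum_mul]
    rw [integral_finsetSum _ fun n _ => hint n]
    simp only [integral_termG hc lam ω hf hg]
    rw [sum_Icc_one_eq_sum_range]
  · congr 1
    simp [weight₀]
    ring

end WeakIdentity

/-! ### From the weak identity to the pointwise one -/

/-- A continuous function on the square that is orthogonal to all products supported near an
interior point vanishes at that point. -/
lemma eq_zero_of_forall_integral_mul {Θ : ℝ × ℝ → ℝ} (hΘ : ContinuousOn Θ square) {x₀ t₀ ε₀ : ℝ}
    (hx : x₀ ∈ Ioo 0 π) (ht : t₀ ∈ Ioo 0 π) (hε₀ : 0 < ε₀)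
    (h : ∀ f g : ℝ → ℝ, Continuous f → Continuous g → (∀ t, f t ≠ 0 → |t - t₀| < ε₀) →
      (∀ x, g x ≠ 0 → |x - x₀| < ε₀) → ∫ p : ℝ × ℝ, Θ p * (g p.1 * f p.2) ∂ν₂ = 0) :
    Θ (x₀, t₀) = 0 := by
  by_contra hne
  set U : Set (ℝ × ℝ) := Ioo 0 π ×ˢ Ioo 0 π with hU
  have hUo : IsOpen U := isOpen_Ioo.prod isOpen_Ioo
  have hUs : U ⊆ square := Set.prod_mono Ioo_subset_Icc_self Ioo_subset_Icc_self
  have hpU : (x₀, t₀) ∈ U := ⟨hx, ht⟩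
  have hc := hΘ.const_mul (Θ (x₀, t₀)) (x₀, t₀) (hUs hpU)
  have hpos : 0 < Θ (x₀, t₀) * Θ (x₀, t₀) := mul_self_pos.2 hne
  obtain ⟨δ, hδ, hball⟩ := Metric.mem_nhdsWithin_iff.1 (hc.eventually_const_lt hpos)
  set ε := min δ ε₀ with hε
  have hε0 : 0 < ε := lt_min hδ hε₀
  set f : ℝ → ℝ := fun t => max 0 (ε - |t - t₀|) with hf
  set g : ℝ → ℝ := fun x => max 0 (ε - |x - x₀|) with hg
  have hf0 : ∀ t, 0 ≤ f t := fun t => le_max_left _ _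
  have hg0 : ∀ x, 0 ≤ g x := fun x => le_max_left _ _
  have hfc : Continuous f := by fun_prop
  have hgc : Continuous g := by fun_prop
  have hfs : ∀ t, f t ≠ 0 → |t - t₀| < ε := by
    intro t h0
    by_contra hlt
    exact h0 (max_eq_left (by linarith))
  have hgs : ∀ x, g x ≠ 0 → |x - x₀| < ε := by
    intro x h0
    by_contra hlt
    exact h0 (max_eq_left (by linarith))
  have h0 := h f g hfc hgc (fun t ht => (hfs t ht).trans_le (min_le_right _ _))
    (fun x hx => (hgs x hx).trans_le (min_le_right _ _))
  -- The factor `Θ (x₀, t₀)` removes the sign: near the point the integrand is nonnegative against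
  -- hat functions, and strictly positive on an open set.
  set Ξ : ℝ × ℝ → ℝ := fun p => Θ (x₀, t₀) * (Θ p * (g p.1 * f p.2)) with hΞ
  have hΞi : Integrable Ξ ν₂ :=
    (integrable_of_continuousOn_square (hΘ.mul (by fun_prop))).const_mul _
  have hΞ0 : ∫ p, Ξ p ∂ν₂ = 0 := by rw [hΞ, integral_const_mul, h0, mul_zero]
  have hpos' : ∀ p ∈ square, |p.1 - x₀| < ε → |p.2 - t₀| < ε → 0 < Θ (x₀, t₀) * Θ p := by
    intro p hp h1 h2
    refine hball ⟨?_, hp⟩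
    rw [Metric.mem_ball, Prod.dist_eq, Real.dist_eq, Real.dist_eq]
    exact max_lt (h1.trans_le (min_le_left _ _)) (h2.trans_le (min_le_left _ _))
  have hΞnn : 0 ≤ᵐ[ν₂] Ξ := by
    filter_upwards [ae_mem_square] with p hp
    simp only [Pi.zero_apply, hΞ]
    by_cases h1 : g p.1 = 0
    · simp [h1]
    by_cases h2 : f p.2 = 0
    · simp [h2]
    rw [← mul_assoc]
    exact mul_nonneg (hpos' p hp (hgs _ h1) (hfs _ h2)).le (mul_nonneg (hg0 _) (hf0 _))
  have hlt : 0 < ∫ p, Ξ p ∂ν₂ := by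
    rw [integral_pos_iff_support_of_nonneg_ae hΞnn hΞi]
    have hsub : U ∩ Metric.ball (x₀, t₀) ε ⊆ Function.support Ξ := by
      rintro p ⟨hpU', hpb⟩
      rw [Metric.mem_ball, Prod.dist_eq, Real.dist_eq, Real.dist_eq, max_lt_iff] at hpb
      have h1 : 0 < g p.1 := lt_max_of_lt_right (by linarith [hpb.1])
      have h2 : 0 < f p.2 := lt_max_of_lt_right (by linarith [hpb.2])
      rw [Function.mem_support, hΞ]
      simp only
      rw [← mul_assoc]
      exact (mul_pos (hpos' p (hUs hpU') hpb.1 hpb.2) (mul_pos h1 h2)).ne'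
    have hVo : IsOpen (U ∩ Metric.ball (x₀, t₀) ε) := hUo.inter Metric.isOpen_ball
    refine lt_of_lt_of_le ?_ (measure_mono hsub)
    rw [ν₂_eq, Measure.restrict_apply hVo.measurableSet, inter_eq_self_of_subset_left
      (inter_subset_left.trans (Set.prod_mono Ioo_subset_Ioc_self Ioo_subset_Ioc_self))]
    exact hVo.measure_pos volume ⟨(x₀, t₀), hpU, Metric.mem_ball_self hε0⟩
  exact hlt.ne' hΞ0

section Separated

variable {A A' : ℝ → ℝ → ℝ} {f g : ℝ → ℝ}

/-- When the support of one factor lies strictly to the left of the other, a Volterra kernel acting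
in the wrong order never meets both. -/
lemma integral_kernel_eq_zero (hsep : ∀ t x, f t ≠ 0 → g x ≠ 0 → t < x) :
    ∫ x in (0 : ℝ)..π, (∫ s in (0 : ℝ)..x, A x s * g s) * f x = 0 := by
  rw [intervalIntegral.integral_congr (g := fun _ => 0), intervalIntegral.integral_zero]
  intro x hx
  rw [uIcc_of_le Real.pi_pos.le] at hx
  by_cases h0 : f x = 0
  · simp [h0]
  have : ∫ s in (0 : ℝ)..x, A x s * g s = 0 := by
    rw [intervalIntegral.integral_congr (g := fun _ => 0), intervalIntegral.integral_zero]
    intro s hs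
    rw [uIcc_of_le hx.1] at hs
    by_cases h1 : g s = 0
    · simp [h1]
    · exact absurd (hsep x s h0 h1) (not_lt.2 hs.2)
  simp [this]

/-- In the right order the constraint `s ≤ x` is automatic on the supports, so the Volterra pairing
is a plain double integral in which any continuous extension of the kernel may be used. -/
lemma integral_kernel_eq_integral (hsep : ∀ t x, f t ≠ 0 → g x ≠ 0 → t < x)
    (hA' : Continuous (Function.uncurry A'))
    (hAA : ∀ x t, 0 ≤ t → t ≤ x → x ≤ π → A' x t = A x t) (hf : Continuous f) (hg : Continuous g) :
    ∫ x in (0 : ℝ)..π, (∫ s in (0 : ℝ)..x, A x s * f s) * g x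
      = ∫ p : ℝ × ℝ, A' p.1 p.2 * (g p.1 * f p.2) ∂ν₂ := by
  have hA'2 : Continuous fun p : ℝ × ℝ => A' p.1 p.2 := hA'
  have hi : Integrable (fun p : ℝ × ℝ => A' p.1 p.2 * (g p.1 * f p.2)) ν₂ :=
    integrable_of_continuousOn_square (by fun_prop)
  rw [integral_prod _ hi, ← intervalIntegral.integral_of_le Real.pi_pos.le]
  refine intervalIntegral.integral_congr fun x hx => ?_
  rw [uIcc_of_le Real.pi_pos.le] at hx
  simp only
  rw [← intervalIntegral.integral_of_le Real.pi_pos.le]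
  have hs : Continuous fun s => A' x s * f s :=
    (hA'2.comp (continuous_const.prodMk continuous_id)).mul hf
  by_cases h0 : g x = 0
  · simp [h0]
  have h1 : ∫ s in x..π, A' x s * f s = 0 := by
    rw [intervalIntegral.integral_congr (g := fun _ => 0), intervalIntegral.integral_zero]
    intro s hs
    rw [uIcc_of_le hx.2] at hs
    by_cases h1 : f s = 0
    · simp [h1]
    · exact absurd (hsep s x h1 h0) (not_lt.2 hs.1)
  have h2 := intervalIntegral.integral_add_adjacent_intervals (hs.intervalIntegrable (μ := volume) 0 x)
    (hs.intervalIntegrable x π)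
  rw [h1, add_zero] at h2
  have h3 : ∫ s in (0 : ℝ)..x, A x s * f s = ∫ s in (0 : ℝ)..x, A' x s * f s := by
    refine intervalIntegral.integral_congr fun s hs => ?_
    rw [uIcc_of_le hx.1] at hs
    rw [hAA x s hs.1 hs.2 hx.2]
  rw [h3, h2, ← intervalIntegral.integral_mul_const]
  refine intervalIntegral.integral_congr fun s _ => ?_
  ring

end Separated

section Identity

variable {q : ℝ → ℝ} {h H : ℝ} {c c₁ G K : ℝ → ℝ → ℝ} {lam : ℕ → ℝ} {f g : ℝ → ℝ}

/-- The closed-form part of the representation of the kernels, `m` being the larger one of the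
variables. -/
def closedPart (c : ℝ → ℝ → ℝ) (lam : ℕ → ℝ) (ω : ℝ) (m : ℝ × ℝ → ℝ) (p : ℝ × ℝ) : ℝ :=
  c 0 p.1 / π - c (lam 0) p.1 * cosRoot (lam 0) p.2 / weight c lam 0
    + ω / π ^ 2 * (π * m p - p.1 ^ 2 - p.2 ^ 2)

lemma continuousOn_closedPart (hc : IsCauchyPair q h c c₁) (lam : ℕ → ℝ) (ω : ℝ) {m : ℝ × ℝ → ℝ}
    (hm : Continuous m) : ContinuousOn (closedPart c lam ω m) square := by
  have h1 := continuousOn_fst (hc.continuousOn 0)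
  have h2 := continuousOn_fst (hc.continuousOn (lam 0))
  have h3 := continuous_cosRoot (lam 0)
  unfold closedPart
  refine ((h1.div_const _).sub (ContinuousOn.div_const (h2.mul ?_) _)).add ?_ <;> fun_prop

lemma integral_closedPart (hc : IsCauchyPair q h c c₁) (lam : ℕ → ℝ) (ω : ℝ) {m : ℝ × ℝ → ℝ}
    (hm : Continuous m) (hf : Continuous f) (hg : Continuous g) :
    ∫ p : ℝ × ℝ, closedPart c lam ω m p * (g p.1 * f p.2) ∂ν₂
      = (∫ x in (0 : ℝ)..π, c 0 x * g x) * (∫ t in (0 : ℝ)..π, f t) / π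
        - (∫ x in (0 : ℝ)..π, c (lam 0) x * g x) * (∫ t in (0 : ℝ)..π, cosRoot (lam 0) t * f t)
          / weight c lam 0
        + ω / π * ((∫ p, m p * (g p.1 * f p.2) ∂ν₂)
          - (∫ x in (0 : ℝ)..π, x ^ 2 * g x) * (∫ t in (0 : ℝ)..π, f t) / π
          - (∫ x in (0 : ℝ)..π, x ^ 2 * f x) * (∫ t in (0 : ℝ)..π, g t) / π) := by
  have hw : ContinuousOn (fun p : ℝ × ℝ => g p.1 * f p.2) square := by fun_prop
  have hi : ∀ u v : ℝ → ℝ, ContinuousOn u (Icc 0 π) → ContinuousOn v (Icc 0 π) →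
      Integrable (fun p : ℝ × ℝ => u p.1 * v p.2 * (g p.1 * f p.2)) ν₂ := fun u v hu hv =>
    integrable_of_continuousOn_square (((continuousOn_fst hu).mul (continuousOn_snd hv)).mul hw)
  have i1 := hi _ (fun _ => 1) (hc.continuousOn 0) continuousOn_const
  have i2 := hi _ _ (hc.continuousOn (lam 0)) (continuous_cosRoot (lam 0)).continuousOn
  have i3 : Integrable (fun p : ℝ × ℝ => m p * (g p.1 * f p.2)) ν₂ :=
    integrable_of_continuousOn_square (hm.continuousOn.mul hw)
  have i4 := hi (fun x => x ^ 2) (fun _ => 1) (by fun_prop) continuousOn_const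
  have i5 := hi (fun _ => 1) (fun x => x ^ 2) continuousOn_const (by fun_prop)
  have e : ∀ p : ℝ × ℝ, closedPart c lam ω m p * (g p.1 * f p.2)
      = ((1 / π) * (c 0 p.1 * 1 * (g p.1 * f p.2))
        + (-(1 / weight c lam 0)) * (c (lam 0) p.1 * cosRoot (lam 0) p.2 * (g p.1 * f p.2)))
        + (((ω / π) * (m p * (g p.1 * f p.2))
          + (-(ω / π ^ 2)) * (p.1 ^ 2 * 1 * (g p.1 * f p.2)))
          + (-(ω / π ^ 2)) * (1 * p.2 ^ 2 * (g p.1 * f p.2))) := by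
    intro p
    rw [closedPart]
    have hπ := Real.pi_ne_zero
    field_simp
    ring
  simp only [e]
  rw [integral_add ((i1.const_mul _).fun_add (i2.const_mul _))
      (((i3.const_mul _).fun_add (i4.const_mul _)).fun_add (i5.const_mul _)),
    integral_add (i1.const_mul _) (i2.const_mul _),
    integral_add ((i3.const_mul _).fun_add (i4.const_mul _)) (i5.const_mul _),
    integral_add (i3.const_mul _) (i4.const_mul _)]
  simp only [integral_const_mul]
  rw [integral_mul_mul (c 0) (fun _ => 1), integral_mul_mul (c (lam 0)) (cosRoot (lam 0)),
    integral_mul_mul (fun x => x ^ 2) (fun _ => 1), integral_mul_mul (fun _ => 1) (fun x => x ^ 2)]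
  simp only [one_mul]
  ring

lemma continuousOn_tsum_termG (hc : IsCauchyPair q h c c₁) (hq2 : MemLp q 2 ν₀)
    (hq : IntervalIntegrable q volume 0 π) (hl : IsEigenvalueSequence q h H lam)
    (hG : IsTransmutationKernel q h G) : ContinuousOn (fun p : ℝ × ℝ =>
      ∑' n : ℕ, termG c lam (omega q h H) (n + 1) p.1 p.2) square :=
  (termG_convergesAbsolutelyUniformlyOn hc hq2 hq hl hG).2.2.continuousOn
    (Frequently.of_forall fun _ => continuousOn_finsetSum _ fun n _ => continuousOn_termG hc lam _ n)

/-- The sum of the series and of the closed-form part, tested against a product of continuous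
functions. -/
lemma integral_sum_add_closedPart (hc : IsCauchyPair q h c c₁) (hq2 : MemLp q 2 ν₀)
    (hq : IntervalIntegrable q volume 0 π) (hl : IsEigenvalueSequence q h H lam)
    (hG : IsTransmutationKernel q h G) (hK : IsInverseKernel G K) {m : ℝ × ℝ → ℝ}
    (hm : Continuous m) (hf : Continuous f) (hg : Continuous g) :
    ∫ p : ℝ × ℝ, ((∑' n : ℕ, termG c lam (omega q h H) (n + 1) p.1 p.2)
        + closedPart c lam (omega q h H) m p) * (g p.1 * f p.2) ∂ν₂
      = (∫ x in (0 : ℝ)..π, (∫ s in (0 : ℝ)..x, G x s * f s) * g x)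
        - (∫ x in (0 : ℝ)..π, (∫ s in (0 : ℝ)..x, K x s * g s) * f x)
        + omega q h H / π * ((∫ p, m p * (g p.1 * f p.2) ∂ν₂)
          - (∫ x in (0 : ℝ)..π, (∫ s in (0 : ℝ)..x, x * f s) * g x)
          - (∫ x in (0 : ℝ)..π, (∫ s in (0 : ℝ)..x, x * g s) * f x)) := by
  have hw : ContinuousOn (fun p : ℝ × ℝ => g p.1 * f p.2) square := by fun_prop
  have j1 : Integrable (fun p : ℝ × ℝ => (∑' n : ℕ, termG c lam (omega q h H) (n + 1) p.1 p.2)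
      * (g p.1 * f p.2)) ν₂ :=
    integrable_of_continuousOn_square ((continuousOn_tsum_termG hc hq2 hq hl hG).mul hw)
  have j2 : Integrable (fun p : ℝ × ℝ => closedPart c lam (omega q h H) m p
      * (g p.1 * f p.2)) ν₂ :=
    integrable_of_continuousOn_square ((continuousOn_closedPart hc lam _ hm).mul hw)
  simp only [add_mul]
  rw [integral_add j1 j2,
    integral_tsum_termG hc hq2 hq hl hG hK hf.continuousOn hg.continuousOn,
    integral_closedPart hc lam _ hm hf hg]
  ring

/-- The open triangle. -/
def openTriangle : Set (ℝ × ℝ) := {p | 0 < p.2 ∧ p.2 < p.1 ∧ p.1 < π}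

lemma triangle_subset_closure : triangle ⊆ closure openTriangle := by
  rintro ⟨x, t⟩ ⟨h0, h1, h2⟩
  simp only at h0 h1 h2
  -- Points of the triangle are moved towards `(2, 1)`, which is interior because `0 < 1 < 2 < π`.
  have hc : Continuous fun δ : ℝ => (x + δ * (2 - x), t + δ * (1 - t)) := by fun_prop
  have ht : Tendsto (fun δ : ℝ => (x + δ * (2 - x), t + δ * (1 - t))) (nhdsWithin 0 (Ioi 0))
      (nhds (x, t)) := by
    have := (hc.tendsto 0).mono_left (nhdsWithin_le_nhds (s := Ioi 0))
    simpa using this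
  refine mem_closure_of_tendsto ht ?_
  filter_upwards [Ioo_mem_nhdsGT (zero_lt_one' ℝ)] with δ hδ
  have h3 := Real.pi_gt_three
  refine ⟨?_, ?_, ?_⟩ <;> simp only <;> nlinarith [hδ.1, hδ.2]

lemma eq_on_triangle_of_eq_on_openTriangle {Φ Ψ : ℝ × ℝ → ℝ} (hΦ : ContinuousOn Φ triangle)
    (hΨ : ContinuousOn Ψ triangle) (he : EqOn Φ Ψ openTriangle) : EqOn Φ Ψ triangle :=
  he.of_subset_closure hΦ hΨ (fun _ hp => ⟨hp.1.le, hp.2.1.le, hp.2.2.le⟩) triangle_subset_closure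

/-- With `f` supported to the left of `g`, both pairings of the wrong order vanish: the one with `K`
and one half of the correction. The other half of the correction is cancelled by taking `m = x`, the
larger variable, so only `G` remains. -/
lemma kernel_eq_tsum (hc : IsCauchyPair q h c c₁) (hq2 : MemLp q 2 ν₀)
    (hq : IntervalIntegrable q volume 0 π) (hl : IsEigenvalueSequence q h H lam)
    (hG : IsTransmutationKernel q h G) (hK : IsInverseKernel G K) :
    ∀ p ∈ triangle, G p.1 p.2 = (∑' n : ℕ, termG c lam (omega q h H) (n + 1) p.1 p.2)
      + closedPart c lam (omega q h H) Prod.fst p := by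
  obtain ⟨G', hG', hGG⟩ := exists_continuous_extension_triangle hG.1
  have hG'2 : Continuous fun p : ℝ × ℝ => G' p.1 p.2 := hG'
  have hS := (continuousOn_tsum_termG hc hq2 hq hl hG).add
    (continuousOn_closedPart hc lam (omega q h H) continuous_fst)
  refine eq_on_triangle_of_eq_on_openTriangle hG.1 (hS.mono triangle_subset_square) ?_
  rintro ⟨x₀, t₀⟩ ⟨h0, h1, h2⟩
  simp only at h0 h1 h2
  -- Radius `(x₀ - t₀) / 2` around `t₀` and `x₀` keeps the two supports on the correct sides of each
  -- other.
  have key := eq_zero_of_forall_integral_mul (hS.sub hG'2.continuousOn) (x₀ := x₀) (t₀ := t₀)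
    (ε₀ := (x₀ - t₀) / 2) ⟨h0.trans h1, h2⟩ ⟨h0, h1.trans h2⟩ (by linarith) ?_
  · have h3 := sub_eq_zero.1 key
    simp only at h3 ⊢
    rw [← hGG x₀ t₀ h0.le h1.le h2.le]
    exact h3.symm
  · intro f g hf hg hfs hgs
    have hsep : ∀ t x, f t ≠ 0 → g x ≠ 0 → t < x := by
      intro t x ht hx
      have h3 := abs_lt.1 (hfs t ht)
      have h4 := abs_lt.1 (hgs x hx)
      linarith
    have hw : ContinuousOn (fun p : ℝ × ℝ => g p.1 * f p.2) square := by fun_prop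
    have j1 : Integrable (fun p : ℝ × ℝ => ((∑' n : ℕ, termG c lam (omega q h H) (n + 1) p.1 p.2)
        + closedPart c lam (omega q h H) Prod.fst p) * (g p.1 * f p.2)) ν₂ :=
      integrable_of_continuousOn_square (hS.mul hw)
    have j2 : Integrable (fun p : ℝ × ℝ => G' p.1 p.2 * (g p.1 * f p.2)) ν₂ :=
      integrable_of_continuousOn_square (hG'2.continuousOn.mul hw)
    simp only [Pi.sub_apply, Pi.add_apply, sub_mul]
    rw [integral_sub j1 j2]
    have h5 := integral_sum_add_closedPart hc hq2 hq hl hG hK continuous_fst hf hg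
    rw [integral_kernel_eq_zero hsep, integral_kernel_eq_zero (A := fun x _ => x) hsep,
      integral_kernel_eq_integral hsep hG' hGG hf hg,
      integral_kernel_eq_integral (A := fun x _ => x) (A' := fun x _ => x) hsep continuous_fst
        (fun _ _ _ _ _ => rfl) hf hg] at h5
    have h6 : ∫ p : ℝ × ℝ, ((∑' n : ℕ, termG c lam (omega q h H) (n + 1) p.1 p.2)
        + closedPart c lam (omega q h H) Prod.fst p) * (g p.1 * f p.2) ∂ν₂
        = ∫ p : ℝ × ℝ, G' p.1 p.2 * (g p.1 * f p.2) ∂ν₂ := by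
      rw [h5]
      ring
    exact sub_eq_zero.2 h6

/-- The same identity read below the diagonal, where `x₀ < t₀`: now the `G`-pairing vanishes, `-K(t,
x)` survives, and the larger variable is the second one. Exchanging the coordinates brings it back
to the triangle. -/
lemma inverseKernel_eq_tsum (hc : IsCauchyPair q h c c₁) (hq2 : MemLp q 2 ν₀)
    (hq : IntervalIntegrable q volume 0 π) (hl : IsEigenvalueSequence q h H lam)
    (hG : IsTransmutationKernel q h G) (hK : IsInverseKernel G K) :
    ∀ p ∈ triangle, K p.1 p.2 = -((∑' n : ℕ, termG c lam (omega q h H) (n + 1) p.2 p.1)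
      + closedPart c lam (omega q h H) Prod.snd p.swap) := by
  obtain ⟨K', hK', hKK⟩ := exists_continuous_extension_triangle hK.1
  have hK'2 : Continuous fun p : ℝ × ℝ => K' p.2 p.1 := hK'.comp continuous_swap
  have hS := (continuousOn_tsum_termG hc hq2 hq hl hG).add
    (continuousOn_closedPart hc lam (omega q h H) continuous_snd)
  have hS' := (hS.comp continuous_swap.continuousOn
    (fun p (hp : p ∈ square) => (⟨hp.2, hp.1⟩ : p.swap ∈ square))).neg
  refine eq_on_triangle_of_eq_on_openTriangle hK.1 (hS'.mono triangle_subset_square) ?_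
  rintro ⟨t₀, x₀⟩ ⟨h0, h1, h2⟩
  simp only at h0 h1 h2
  have key := eq_zero_of_forall_integral_mul (hS.add hK'2.continuousOn) (x₀ := x₀) (t₀ := t₀)
    (ε₀ := (t₀ - x₀) / 2) ⟨h0, h1.trans h2⟩ ⟨h0.trans h1, h2⟩ (by linarith) ?_
  · have h3 := eq_neg_of_add_eq_zero_right key
    simp only at h3 ⊢
    rw [← hKK t₀ x₀ h0.le h1.le h2.le]
    exact h3
  · intro f g hf hg hfs hgs
    have hsep : ∀ t x, g t ≠ 0 → f x ≠ 0 → t < x := by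
      intro t x ht hx
      have h3 := abs_lt.1 (hgs t ht)
      have h4 := abs_lt.1 (hfs x hx)
      linarith
    have hw : ContinuousOn (fun p : ℝ × ℝ => g p.1 * f p.2) square := by fun_prop
    have j1 : Integrable (fun p : ℝ × ℝ => ((∑' n : ℕ, termG c lam (omega q h H) (n + 1) p.1 p.2)
        + closedPart c lam (omega q h H) Prod.snd p) * (g p.1 * f p.2)) ν₂ :=
      integrable_of_continuousOn_square (hS.mul hw)
    have j2 : Integrable (fun p : ℝ × ℝ => K' p.2 p.1 * (g p.1 * f p.2)) ν₂ :=
      integrable_of_continuousOn_square (hK'2.continuousOn.mul hw)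
    simp only [Pi.add_apply, add_mul _ (K' _ _)]
    rw [integral_add j1 j2]
    have h5 := integral_sum_add_closedPart hc hq2 hq hl hG hK continuous_snd hf hg
    rw [integral_kernel_eq_zero hsep, integral_kernel_eq_zero (A := fun x _ => x) hsep,
      integral_kernel_eq_integral hsep hK' hKK hg hf,
      integral_kernel_eq_integral (A := fun x _ => x) (A' := fun x _ => x) hsep continuous_fst
        (fun _ _ _ _ _ => rfl) hg hf,
      ← integral_prod_swap (fun p : ℝ × ℝ => K' p.1 p.2 * (f p.1 * g p.2)),
      ← integral_prod_swap (fun p : ℝ × ℝ => p.1 * (f p.1 * g p.2))] at h5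
    simp only [Prod.fst_swap, Prod.snd_swap, mul_comm (f _)] at h5
    have h6 : ∫ p : ℝ × ℝ, ((∑' n : ℕ, termG c lam (omega q h H) (n + 1) p.1 p.2)
        + closedPart c lam (omega q h H) Prod.snd p) * (g p.1 * f p.2) ∂ν₂
        = -∫ p : ℝ × ℝ, K' p.2 p.1 * (g p.1 * f p.2) ∂ν₂ := by
      rw [h5]
      ring
    exact add_eq_zero_iff_eq_neg.2 h6

lemma neg_closedPart_snd (c : ℝ → ℝ → ℝ) (lam : ℕ → ℝ) (ω x t : ℝ) :
    -closedPart c lam ω Prod.snd (t, x) = closedH c lam ω x t := by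
  rw [closedPart, closedH]
  ring

end Identity

end SturmLiouville

end

theorem theorem2 (q : ℝ → ℝ) (hq : MemLp q 2 (volume.restrict (Ioo 0 π))) (h H : ℝ) :
    (∃ (c : ℝ → ℝ → ℝ) (lam : ℕ → ℝ) (G K : ℝ → ℝ → ℝ),
      SturmLiouville.IsCauchyFamily q h c ∧
      SturmLiouville.IsEigenvalueSequence q h H lam ∧
      SturmLiouville.IsTransmutationKernel q h G ∧
      SturmLiouville.IsInverseKernel G K) ∧
    ∀ (c : ℝ → ℝ → ℝ) (lam : ℕ → ℝ) (G K : ℝ → ℝ → ℝ),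
      SturmLiouville.IsCauchyFamily q h c →
      SturmLiouville.IsEigenvalueSequence q h H lam →
      SturmLiouville.IsTransmutationKernel q h G →
      SturmLiouville.IsInverseKernel G K →
      (∀ n, 0 < SturmLiouville.weight c lam n) ∧
      SturmLiouville.ConvergesAbsolutelyUniformlyOn
        (SturmLiouville.termG c lam (SturmLiouville.omega q h H)) SturmLiouville.triangle ∧
      SturmLiouville.ConvergesAbsolutelyUniformlyOn
        (SturmLiouville.termH c lam (SturmLiouville.omega q h H)) SturmLiouville.triangle ∧
      ∀ x t : ℝ, 0 ≤ t → t ≤ x → x ≤ π →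
        G x t = (∑' n : ℕ, SturmLiouville.termG c lam (SturmLiouville.omega q h H) (n + 1) x t)
          + SturmLiouville.closedG c lam (SturmLiouville.omega q h H) x t ∧
        K x t = (∑' n : ℕ, SturmLiouville.termH c lam (SturmLiouville.omega q h H) (n + 1) x t)
          + SturmLiouville.closedH c lam (SturmLiouville.omega q h H) x t := by
  have hqi := SturmLiouville.intervalIntegrable_of_memLp_two hq
  have hq2 := SturmLiouville.memLp_Ioc_of_Ioo hq
  constructor
  · obtain ⟨G, hG⟩ := SturmLiouville.exists_isTransmutationKernel hqi h
    obtain ⟨K, hK⟩ := SturmLiouville.exists_isInverseKernel hG.1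
    -- The Cauchy problem needs no separate existence theorem: `T cos √μ` solves it.
    have hc := hG.isCauchyFamily
    obtain ⟨c₁, hc₁⟩ := hc.exists_pair
    obtain ⟨lam, hl, -⟩ := SturmLiouville.exists_isEigenvalueSequence hc₁ hqi H
    exact ⟨_, lam, G, K, hc, hl, hG, hK⟩
  · intro c lam G K hc hl hG hK
    obtain ⟨c₁, hc₁⟩ := hc.exists_pair
    have hconv := SturmLiouville.termG_convergesAbsolutelyUniformlyOn hc₁ hq2 hqi hl hG
    refine ⟨fun n => hc₁.integral_sq_pos (lam n), hconv.mono SturmLiouville.triangle_subset_square,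
      (SturmLiouville.termH_convergesAbsolutelyUniformlyOn hconv).mono
        SturmLiouville.triangle_subset_square, fun x t h0 h1 h2 => ⟨?_, ?_⟩⟩
    · exact SturmLiouville.kernel_eq_tsum hc₁ hq2 hqi hl hG hK (x, t) ⟨h0, h1, h2⟩
    · have hkey := SturmLiouville.inverseKernel_eq_tsum hc₁ hq2 hqi hl hG hK (x, t) ⟨h0, h1, h2⟩
      rw [neg_add, ← tsum_neg] at hkey
      simp only [SturmLiouville.termH_eq_neg_termG]
      rw [← SturmLiouville.neg_closedPart_snd]
      exact hkey
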